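/- Let $k$ be an algebraically closed field of characteristic $p \ge 0$, let $X$ be a smooth connected projective curve over $k$, let $A$ be an elliptic curve over $k$, and let $\Phi \colon X \to A$ be a non-constant morphism of $k$-schemes. Let $n \ge 3$, and let $a_1,\dots,a_n$ be nonzero integers, not all divisible by $p$ (for $p=0$ the latter condition is automatic, since $0$ divides only $0$). Let $X^\dagger \subset X$ be an affine open subset and let $\Phi^\dagger \in \mathcal{O}(X^\dagger)$ be a regular function such that for all $P_1,\dots,P_n \in X^\dagger(k)$ (not necessarily distinct) $$\sum_{i=1}^n a_i \Phi(P_i) = 0 \text{ in } A(k) \quad\Longrightarrow\quad \sum_{i=1}^n a_i \Phi^\dagger(P_i) = 0 \text{ in } k.$$ Then $\Phi^\dagger$ is constant, i.e. it is the image of an element of $k$ in $\mathcal{O}(X^\dagger)$. If moreover $\sum_{i=1}^n a_i$ is not divisible by $p$ (for $p = 0$: if $\sum_{i=1}^n a_i \neq 0$), then $\Phi^\dagger = 0$. -/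

import Mathlib

open CategoryTheory AlgebraicGeometry MonoidalCategory MonObj

universe u

namespace EllipticRelations

noncomputable section

attribute [local instance] MvPolynomial.gradedAlgebra

/-- Projective `n`-space `ℙⁿ = Proj k[x₀, …, xₙ]` over a field `k`. -/
abbrev projectiveSpace (k : Type u) [Field k] (n : ℕ) : Scheme.{u} :=
  Proj (MvPolynomial.homogeneousSubmodule (Fin (n + 1)) k)

/-- The structure morphism `ℙⁿ ⟶ Spec k`. -/
def projectiveSpaceToSpec (k : Type u) [Field k] (n : ℕ) :
    projectiveSpace k n ⟶ Spec (.of k) :=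
  Proj.toSpecZero (MvPolynomial.homogeneousSubmodule (Fin (n + 1)) k) ≫
    Spec.map (CommRingCat.ofHom
      (algebraMap k (MvPolynomial.homogeneousSubmodule (Fin (n + 1)) k 0)))

variable {k : Type u} [Field k]

/-- A `k`-scheme is projective if it is isomorphic, over `k`, to a closed subscheme of
some projective space over `k`. -/
def IsProjective (X : Over (Spec (.of k))) : Prop :=
  ∃ (n : ℕ) (i : X.left ⟶ projectiveSpace k n),
    IsClosedImmersion i ∧ i ≫ projectiveSpaceToSpec k n = X.hom

/-- A smooth (connected) projective curve over `k`: an integral projective `k`-scheme which is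
smooth of relative dimension `1` over `k`. -/
class IsSmoothProjectiveCurve (X : Over (Spec (.of k))) : Prop where
  isIntegral : IsIntegral X.left
  smooth : SmoothOfRelativeDimension 1 X.hom
  isProjective : IsProjective X

/-- An elliptic curve over `k`: a one-dimensional abelian variety, i.e. a smooth projective curve
together with the structure of a commutative group scheme over `k`. -/
class EllipticCurve (A : Over (Spec (.of k))) extends
  GrpObj A, IsCommMonObj A, IsSmoothProjectiveCurve A

/-- The set `X(k)` of `k`-rational points of a `k`-scheme `X`. When `X` is a group scheme,
`X(k)` is a group, written multiplicatively by Mathlib. -/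
abbrev RatPoint (X : Over (Spec (.of k))) : Type u :=
  Over.mk (𝟙 (Spec (.of k))) ⟶ X

/-- A `k`-morphism is constant if it factors through a `k`-rational point of the target. -/
def IsConstant {X Y : Over (Spec (.of k))} (f : X ⟶ Y) : Prop :=
  ∃ Q : RatPoint Y, f = Over.homMk X.hom ≫ Q

/-- The set `U(k)` of `k`-rational points of `X` that lie in the open subset `U`. -/
abbrev RatPointIn (X : Over (Spec (.of k))) (U : X.left.Opens) : Type u :=
  {P : RatPoint X // ⊤ ≤ P.left ⁻¹ᵁ U}

/-- The value `φ(P) ∈ k` of a regular function `φ ∈ 𝒪(U)` at a rational point `P ∈ U(k)`: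
the pullback of `φ` along `P : Spec k ⟶ X`, an element of `Γ(Spec k) ≅ k`. -/
def value {X : Over (Spec (.of k))} {U : X.left.Opens} (φ : Γ(X.left, U))
    (P : RatPointIn X U) : k :=
  (Scheme.ΓSpecIso (.of k)).hom (P.1.left.appLE U ⊤ P.2 φ)

/-- The constant regular function on `U` with value `c ∈ k`, i.e. the image of `c` under the
structure map `k → 𝒪(U)`. -/
def constFun {X : Over (Spec (.of k))} (U : X.left.Opens) (c : k) : Γ(X.left, U) :=
  X.hom.appLE ⊤ U (le_of_le_of_eq le_top (Scheme.Hom.preimage_top X.hom).symm)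
    ((Scheme.ΓSpecIso (.of k)).inv c)

end

end EllipticRelations

/-! ### Function fields of group curves, and affine charts -/

namespace EllipticRelations

open Polynomial

/-! Call `φ(P)` a value over `x ∈ A(k)` when `Φ(P) = x`. Freezing all but three of the points turns
the hypothesis into a three-term relation in which one coefficient is invertible in `k`.
Multiplication by a nonzero integer on `A(k)` is onto with finite kernel (`isogenyMul`), so for
every `x` the relation has solutions `(x, y, z)` with `y`, `z` off a given finite set. Changing only
the value over `x` shows that there is at most one, so `φ` descends to a function `ψ` on `A(k)`
minus a finite set. Comparing the solutions `(x + b, y, z)` and `(x, y + b₂, z)`, where `a₂ b₂ = a₁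
b`, shows that `ψ(x + b) - ψ(x)` does not depend on `x` (`exists_translation_const`).

When `Φ` is inseparable `ψ` need not be rational, but `(s - ψ)^N` is, for every `s` and a fixed `N >
0` (`exists_values`). Translation only shifts `s`, so these functions extend over the exceptional
set, are regular everywhere and hence constant; taking `s = ψ(x₀)` forces `ψ = ψ(x₀)`
(`const_of_translation_const`). The relation among equal values then gives the second claim.

The other half of the work is the finiteness of `l`-torsion for primes `l`. If `l ≠ 0` in `k`,
multiplication by `l` acts as `l` on tangent vectors at the identity, so it is not trivial
(`id_pow_ne_one`) and has finite fibres. If `l` is the characteristic, suppose that the torsion is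
infinite; then it contains a group `H ≅ (ℤ/p)^r` with `r` as large as desired. Consider functions
with at most simple poles on one coset of `H`. A Riemann inequality
(`Chart.exists_card_le_finrank_add`) gives at least `|H| - C` dimensions of them, with `C`
independent of `H`. They are determined by their values on another coset: otherwise unipotence of
the `H`-action (`exists_fixed`) would give an invariant one vanishing there, although invariant ones
are constant (`eq_const_of_invariant`). For large `r` at least three dimensions of them have affine
values on `H`; each is changed by a constant under translation by `H`, hence is fixed by one residue
and one value, a contradiction (`Chart.finite_torsion`).

`GroupFunctionField` isolates what these arguments use, and `ellipticFunctionField` supplies it for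
`A`. -/

/-- A field `K` of rational functions on the points `G` of a complete nonsingular commutative group
curve: `v x f c` says that `f` is regular at `x` with value `c`, and `τ b` is the pullback along
translation by `b`. -/
structure GroupFunctionField (k K G : Type*) [Field k] [Field K] [Algebra k K]
    [AddCommGroup G] where
  v : G → K → k → Prop
  unique {x f c d} : v x f c → v x f d → c = d
  add {x f g c d} : v x f c → v x g d → v x (f + g) (c + d)
  mul {x f g c d} : v x f c → v x g d → v x (f * g) (c * d)
  const (x c) : v x (algebraMap k K c) c
  inv {x f c} : v x f c → c ≠ 0 → v x f⁻¹ c⁻¹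
  regular_or (x f) : (∃ c, v x f c) ∨ v x f⁻¹ 0
  uniformizer (x) : ∃ t, t ≠ 0 ∧ v x t 0 ∧ ∀ f, v x f 0 → ∃ c, v x (f / t) c
  exists_pow_mul {x t} : v x t 0 → ∀ g, ∃ n : ℕ, ∃ c, v x (t ^ n * g) c
  global {f} : (∀ x, ∃ c, v x f c) → ∃ c, f = algebraMap k K c
  τ : G → K →ₐ[k] K
  τ_add (a b f) : τ (a + b) f = τ a (τ b f)
  τ_v {x b f c} : v x (τ b f) c ↔ v (x + b) f c

namespace GroupFunctionField

variable {k K G : Type*} [Field k] [Field K] [Algebra k K] [AddCommGroup G]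
  (V : GroupFunctionField k K G)

/-- The functions regular at `x`. -/
def O (x : G) : Subalgebra k K where
  carrier := {f | ∃ c, V.v x f c}
  mul_mem' := fun ⟨_, h⟩ ⟨_, h'⟩ ↦ ⟨_, V.mul h h'⟩
  add_mem' := fun ⟨_, h⟩ ⟨_, h'⟩ ↦ ⟨_, V.add h h'⟩
  algebraMap_mem' := fun c ↦ ⟨c, V.const x c⟩

variable {V}

lemma v.mem {x : G} {f : K} {c : k} (h : V.v x f c) : f ∈ V.O x := ⟨c, h⟩

lemma v_one (x : G) : V.v x 1 1 := by simpa using V.const x 1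

lemma v_zero (x : G) : V.v x 0 0 := by simpa using V.const x 0

lemma v.neg {x : G} {f : K} {c : k} (h : V.v x f c) : V.v x (-f) (-c) := by
  simpa using V.mul (V.const x (-1)) h

lemma v.sub {x : G} {f g : K} {c d : k} (h : V.v x f c) (h' : V.v x g d) :
    V.v x (f - g) (c - d) := by
  simpa [sub_eq_add_neg] using V.add h h'.neg

lemma v.smul {x : G} {f : K} {c : k} (a : k) (h : V.v x f c) : V.v x (a • f) (a * c) := by
  simpa [Algebra.smul_def] using V.mul (V.const x a) h

lemma v.sub_const {x : G} {f : K} {c : k} (h : V.v x f c) (d : k) :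
    V.v x (f - algebraMap k K d) (c - d) := h.sub (V.const x d)

lemma v_inv_zero_of_notMem {x : G} {f : K} (h : f ∉ V.O x) : V.v x f⁻¹ 0 :=
  (V.regular_or x f).resolve_left h

lemma τ_mem {x b : G} {f : K} : V.τ b f ∈ V.O x ↔ f ∈ V.O (x + b) :=
  exists_congr fun _ ↦ V.τ_v

lemma τ_zero (f : K) : V.τ 0 f = f := by
  have h : V.τ 0 (V.τ 0 f) = V.τ 0 f := by rw [← V.τ_add, add_zero]
  exact (V.τ 0).injective h

lemma v_aeval {x : G} {f : K} {c : k} (h : V.v x f c) (p : k[X]) :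
    V.v x (aeval f p) (p.eval c) := by
  induction p using Polynomial.induction_on with
  | C a => simpa using V.const x a
  | add p q hp hq => simpa using V.add hp hq
  | monomial n a h' => simpa [pow_succ, _root_.mul_assoc] using V.mul h' h

lemma v_prod {I : Type*} {x : G} (s : Finset I) {f : I → K} {c : I → k}
    (h : ∀ i ∈ s, V.v x (f i) (c i)) : V.v x (∏ i ∈ s, f i) (∏ i ∈ s, c i) := by
  classical
  induction s using Finset.induction_on with
  | empty => simpa using v_one x
  | insert a s ha ih =>
    rw [Finset.prod_insert ha, Finset.prod_insert ha]
    exact V.mul (h a (by simp)) (ih fun i hi ↦ h i (by simp [hi]))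

variable (V)

/-- The functions with at most simple poles on `S` and regular elsewhere. -/
def poles (S : Set G) : Submodule k K where
  carrier := {g | ∀ x, (x ∉ S → g ∈ V.O x) ∧ ∀ t, V.v x t 0 → t * g ∈ V.O x}
  add_mem' := fun h h' x ↦ ⟨fun hx ↦ add_mem ((h x).1 hx) ((h' x).1 hx), fun t ht ↦ by
    rw [mul_add]; exact add_mem ((h x).2 t ht) ((h' x).2 t ht)⟩
  zero_mem' := fun x ↦ ⟨fun _ ↦ zero_mem _, fun t _ ↦ by simp⟩
  smul_mem' := fun c g h x ↦ ⟨fun hx ↦ (V.O x).smul_mem ((h x).1 hx) c, fun t ht ↦ by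
    rw [mul_smul_comm]; exact (V.O x).smul_mem ((h x).2 t ht) c⟩

/-- An affine chart of the curve: the complement of a finite set `T`, whose ring of functions is
free over `k[f]` with basis `y`, where `f` has a pole at every point of `T`. -/
structure Chart where
  T : Finset G
  f : K
  N : ℕ
  y : Fin N → K
  f_mem {x} : x ∉ T → f ∈ V.O x
  f_notMem {x} : x ∈ T → f ∉ V.O x
  y_mem {x} : x ∉ T → ∀ i, y i ∈ V.O x
  span {g} : (∀ x ∉ T, g ∈ V.O x) → ∃ P : Fin N → k[X], ∑ i, aeval f (P i) * y i = g
  indep {P : Fin N → k[X]} : ∑ i, aeval f (P i) * y i = 0 → P = 0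
  pole {s} : s ∉ T → ∃ e, e ∉ V.O s ∧ (∀ t, V.v s t 0 → t * e ∈ V.O s) ∧
    ∀ x ∉ T, x ≠ s → e ∈ V.O x

variable {V}

namespace Chart

variable (W : V.Chart)

/-- The combination of the basis with the given polynomial coefficients. -/
noncomputable def comb : (Fin W.N → k[X]) →ₗ[k] K where
  toFun P := ∑ i, aeval W.f (P i) * W.y i
  map_add' P Q := by simp [add_mul, Finset.sum_add_distrib]
  map_smul' c P := by simp [Finset.smul_sum]

lemma comb_apply (P : Fin W.N → k[X]) : W.comb P = ∑ i, aeval W.f (P i) * W.y i := rfl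

lemma comb_injective : Function.Injective W.comb := by
  rw [injective_iff_map_eq_zero]
  exact fun P hP ↦ W.indep hP

lemma comb_mem {x : G} (hx : x ∉ W.T) (P : Fin W.N → k[X]) : W.comb P ∈ V.O x := by
  obtain ⟨c, hc⟩ := W.f_mem hx
  rw [comb_apply]
  exact sum_mem fun i _ ↦ mul_mem (v_aeval hc _).mem (W.y_mem hx i)

lemma comb_mul (q : k[X]) (P : Fin W.N → k[X]) :
    W.comb (fun i ↦ q * P i) = aeval W.f q * W.comb P := by
  simp [comb_apply, Finset.mul_sum, _root_.mul_assoc]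

/-- Coefficient vectors of degree less than `n`. -/
noncomputable def coeffs (N n : ℕ) : Submodule k (Fin N → k[X]) :=
  Submodule.pi Set.univ fun _ ↦ degreeLT k n

end Chart

lemma finrank_coeffs (N n : ℕ) : Module.finrank k (Chart.coeffs (k := k) N n) = N * n ∧
    FiniteDimensional k (Chart.coeffs (k := k) N n) := by
  let e : (Fin N → (Fin n → k)) ≃ₗ[k] (Chart.coeffs (k := k) N n) :=
    { toFun := fun c ↦ ⟨fun i ↦ ((degreeLTEquiv k n).symm (c i)).1, by
        intro i _; exact ((degreeLTEquiv k n).symm (c i)).2⟩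
      map_add' := by intros; ext; simp
      map_smul' := by intros; ext; simp
      invFun := fun P i ↦ degreeLTEquiv k n ⟨P.1 i, P.2 i trivial⟩
      left_inv := by intro c; simp
      right_inv := by intro P; simp }
  refine ⟨?_, e.finiteDimensional⟩
  rw [← e.finrank_eq]
  simp [Module.finrank_pi_fintype]

end GroupFunctionField
end EllipticRelations

/-! ### A Riemann inequality -/

namespace EllipticRelations

open Polynomial

namespace GroupFunctionField

variable {k K G : Type*} [Field k] [Field K] [Algebra k K] [AddCommGroup G]
  {V : GroupFunctionField k K G}

namespace Chart

variable (W : V.Chart)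

lemma v_inv_f {x : G} (hx : x ∈ W.T) : V.v x W.f⁻¹ 0 := v_inv_zero_of_notMem (W.f_notMem hx)

lemma f_ne_zero {x : G} (hx : x ∈ W.T) : W.f ≠ 0 := by
  intro h
  exact W.f_notMem hx (h ▸ zero_mem _)

/-- A power of `1 / f` makes the basis regular at infinity. -/
lemma exists_pow_mul_y_mem : ∃ L : ℕ, ∀ x ∈ W.T, ∀ i, W.f⁻¹ ^ L * W.y i ∈ V.O x := by
  classical
  have h (x : G) (i : Fin W.N) : ∃ L : ℕ, x ∈ W.T → W.f⁻¹ ^ L * W.y i ∈ V.O x := by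
    by_cases hx : x ∈ W.T
    · obtain ⟨n, hn⟩ := V.exists_pow_mul (W.v_inv_f hx) (W.y i)
      exact ⟨n, fun _ ↦ hn⟩
    · exact ⟨0, fun h ↦ absurd h hx⟩
  choose L hL using h
  refine ⟨W.T.sup fun x ↦ Finset.univ.sup (L x), fun x hx i ↦ ?_⟩
  have hle : L x i ≤ W.T.sup fun x ↦ Finset.univ.sup (L x) :=
    (Finset.le_sup (f := L x) (Finset.mem_univ i)).trans
      (Finset.le_sup (f := fun x ↦ Finset.univ.sup (L x)) hx)
  obtain ⟨m, hm⟩ := Nat.exists_eq_add_of_le' hle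
  rw [hm, pow_add, _root_.mul_assoc]
  exact mul_mem (pow_mem (W.v_inv_f hx).mem _) (hL x i hx)

lemma aeval_mul_inv_pow_mem {x : G} (hx : x ∈ W.T) {m : ℕ} {p : k[X]} (hp : p ∈ degreeLT k m) :
    aeval W.f p * W.f⁻¹ ^ m ∈ V.O x := by
  rw [mem_degreeLT] at hp
  by_cases h : p = 0
  · simp [h]
  rw [aeval_eq_sum_range' ((natDegree_lt_iff_degree_lt h).2 hp), Finset.sum_mul]
  refine sum_mem fun j hj ↦ ?_
  obtain ⟨i, rfl⟩ := Nat.exists_eq_add_of_le (Finset.mem_range.1 hj).le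
  rw [smul_mul_assoc, pow_add, ← _root_.mul_assoc, ← mul_pow, mul_inv_cancel₀ (W.f_ne_zero hx),
    one_pow, _root_.one_mul]
  exact (V.O x).smul_mem (pow_mem (W.v_inv_f hx).mem _) _

/-- The quotient is the product of the `1 / (1 - c s / f)`, and `1 / f` vanishes at the points of
`T`. -/
lemma pow_div_prod_mem {x : G} (hx : x ∈ W.T) {I : Type*} (S : Finset I) (c : I → k) :
    W.f ^ S.card / aeval W.f (∏ s ∈ S, (X - C (c s))) ∈ V.O x := by
  have h : V.v x (∏ s ∈ S, (1 - algebraMap k K (c s) * W.f⁻¹)) (∏ s ∈ S, 1) := by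
    refine v_prod S fun s _ ↦ ?_
    simpa using (v_one x).sub (V.mul (V.const x (c s)) (W.v_inv_f hx))
  have h' := V.inv h (by simp)
  convert h'.mem using 1
  have hf := W.f_ne_zero hx
  rw [map_prod, ← Finset.prod_const, ← Finset.prod_div_distrib, ← Finset.prod_inv_distrib]
  refine Finset.prod_congr rfl fun s _ ↦ ?_
  rw [← inv_div]
  congr 1
  simp only [map_sub, aeval_X, aeval_C]
  field_simp

lemma aeval_f_ne_zero {q : k[X]} (hq : q ≠ 0) : aeval W.f q ≠ 0 := by
  intro h
  obtain ⟨P, hP⟩ := W.span (g := 1) fun x _ ↦ one_mem _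
  have h0 : W.comb (fun i ↦ q * P i) = 0 := by rw [comb_mul, h, zero_mul]
  have hP0 : P = 0 := by
    funext i
    simpa [hq] using congrFun (W.indep h0) i
  simp [hP0] at hP

end Chart

/-- A Riemann inequality for reduced divisors in the chart, with a uniform constant. -/
theorem Chart.exists_card_le_finrank_add (W : V.Chart) : ∃ C : ℕ, ∀ S : Finset G,
    Disjoint S W.T → ∃ M : Submodule k K, FiniteDimensional k M ∧ M ≤ V.poles (S : Set G) ∧
      S.card ≤ Module.finrank k M + C := by
  classical
  obtain ⟨L, hL⟩ := W.exists_pow_mul_y_mem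
  -- The term `N * L` is the dimension lost to regularity on `T`; the extra `L` covers the sets with
  -- fewer than `L` points, for which the zero space suffices.
  refine ⟨W.N * L + L, fun S hS ↦ ?_⟩
  have hST {x : G} (hx : x ∈ S) : x ∉ W.T := Finset.disjoint_left.1 hS hx
  by_cases hn : S.card < L
  · exact ⟨⊥, inferInstance, bot_le, by omega⟩
  obtain ⟨m, hm⟩ := Nat.exists_eq_add_of_le' (not_lt.1 hn)
  have hval : ∀ s : S, ∃ c, V.v s W.f c := fun s ↦ W.f_mem (hST s.2)
  choose c hc using hval
  set q : k[X] := ∏ s ∈ S.attach, (X - C (c s)) with hq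
  have hqm : q.Monic := monic_prod_of_monic _ _ fun s _ ↦ monic_X_sub_C _
  have hqd : q.degree = S.card := by
    rw [degree_eq_natDegree hqm.ne_zero, hq,
      natDegree_prod_of_monic _ _ fun s _ ↦ monic_X_sub_C _]; simp
  have hq0 : aeval W.f q ≠ 0 := W.aeval_f_ne_zero hqm.ne_zero
  have hpole : ∀ s : S, _ := fun s ↦ W.pole (hST s.2)
  choose e he het hex using hpole
  -- Multiplication by `q(f)` clears the pole of `e s`. Reducing the coefficients modulo `q` alters
  -- `e s` only by a function regular on the chart.
  have hexP (s : S) : ∃ P ∈ Chart.coeffs W.N S.card, ∃ Q,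
      W.comb P = aeval W.f q * (e s - W.comb Q) := by
    have hreg : ∀ x ∉ W.T, aeval W.f q * e s ∈ V.O x := by
      intro x hx
      by_cases hxs : x = s
      · subst hxs
        have hdvd : X - C (c s) ∣ q := Finset.dvd_prod_of_mem _ (Finset.mem_attach _ s)
        obtain ⟨q', hq'⟩ := hdvd
        rw [hq', map_mul, mul_right_comm]
        refine mul_mem (het s _ ?_) (v_aeval (hc s) q').mem
        have hv := v_aeval (hc s) (X - C (c s))
        rwa [eval_sub, eval_X, eval_C, sub_self] at hv
      · obtain ⟨d, hd⟩ := W.f_mem hx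
        exact mul_mem (v_aeval hd q).mem (hex s x hx hxs)
    obtain ⟨P, hP⟩ := W.span hreg
    refine ⟨fun i ↦ P i %ₘ q, fun i _ ↦ ?_, fun i ↦ P i /ₘ q, ?_⟩
    · rw [SetLike.mem_coe, mem_degreeLT, ← hqd]
      exact degree_modByMonic_lt _ hqm
    · rw [mul_sub, ← comb_mul, eq_sub_iff_add_eq, ← map_add, ← hP]
      change _ = W.comb P
      congr 1
      funext i
      exact modByMonic_add_div _ q
  choose P hP Q hPQ using hexP
  let D : K →ₗ[k] K := LinearMap.mulLeft k (aeval W.f q)⁻¹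
  let θ : (Fin W.N → k[X]) →ₗ[k] K := D ∘ₗ W.comb
  have hθP (s : S) : θ (P s) = e s - W.comb (Q s) := by
    simp [θ, D, hPQ, hq0]
  have hθ : Function.Injective θ := by
    refine Function.Injective.comp (g := D) ?_ W.comb_injective
    exact mul_right_injective₀ (inv_ne_zero hq0)
  have hPi : LinearIndependent k P := by
    rw [Fintype.linearIndependent_iff]
    intro a ha s
    by_contra hs
    have h0 := congrArg θ ha
    simp only [map_sum, map_smul, hθP, map_zero] at h0
    rw [← Finset.add_sum_erase _ _ (Finset.mem_univ s)] at h0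
    have hmem : ∑ i ∈ Finset.univ.erase s, a i • (e i - W.comb (Q i)) ∈ V.O s := by
      refine sum_mem fun i hi ↦ (V.O s.1).smul_mem (sub_mem ?_ ?_) _
      · exact hex i s (hST s.2) fun h ↦ (Finset.ne_of_mem_erase hi) (Subtype.ext h.symm)
      · exact W.comb_mem (hST s.2) _
    have h1 : a s • (e s - W.comb (Q s)) ∈ V.O s.1 := by
      rw [eq_neg_of_add_eq_zero_left h0]
      exact neg_mem hmem
    have h2 := (V.O s.1).smul_mem h1 (a s)⁻¹
    rw [inv_smul_smul₀ hs] at h2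
    exact he s (by simpa using add_mem h2 (W.comb_mem (hST s.2) (Q s)))
  obtain ⟨r1, f1⟩ := finrank_coeffs (k := k) W.N m
  obtain ⟨r2, f2⟩ := finrank_coeffs (k := k) W.N S.card
  let J := Submodule.span k (Set.range P)
  have r3 : Module.finrank k J = S.card := by
    rw [finrank_span_eq_card hPi]; simp
  have f3 : FiniteDimensional k J := FiniteDimensional.span_of_finite k (Set.finite_range P)
  have hsup : Chart.coeffs W.N m ⊔ J ≤ Chart.coeffs (k := k) W.N S.card := by
    refine sup_le (fun P hP i hi ↦ degreeLT_mono (by omega) (hP i hi)) ?_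
    rw [Submodule.span_le]
    rintro _ ⟨s, rfl⟩
    exact hP s
  have h1 := Submodule.finrank_sup_add_finrank_inf_eq (Chart.coeffs (k := k) W.N m) J
  have h2 := Submodule.finrank_mono hsup
  -- Lying in `J` makes the poles on the chart simple and supported on `S`; coefficients of degree
  -- below `m = |S| - L` give regularity on `T`. Both spaces lie in dimension `N * |S|`, so they
  -- meet in dimension at least `|S| - N * L`.
  refine ⟨(Chart.coeffs (k := k) W.N m ⊓ J).map θ, inferInstance, ?_, ?_⟩
  · rintro _ ⟨R, ⟨hRm, hRJ⟩, rfl⟩ x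
    by_cases hx : x ∈ W.T
    · have hmem : θ R ∈ V.O x := by
        have : θ R = ∑ i, (aeval W.f (R i) * W.f⁻¹ ^ m) * (W.f⁻¹ ^ L * W.y i) *
            (W.f ^ S.attach.card / aeval W.f q) := by
          have hf := W.f_ne_zero hx
          simp only [θ, D, LinearMap.comp_apply, LinearMap.mulLeft_apply, comb_apply,
            Finset.mul_sum, Finset.card_attach]
          refine Finset.sum_congr rfl fun i _ ↦ ?_
          rw [hm, pow_add, inv_pow, inv_pow]
          field_simp
        rw [this]
        refine sum_mem fun i _ ↦ mul_mem (mul_mem ?_ (hL x hx i)) ?_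
        · exact W.aeval_mul_inv_pow_mem hx (hRm i trivial)
        · exact W.pow_div_prod_mem hx _ _
      exact ⟨fun _ ↦ hmem, fun t ht ↦ mul_mem ht.mem hmem⟩
    · refine Submodule.span_induction (p := fun R _ ↦ (x ∉ (S : Set G) → θ R ∈ V.O x) ∧
        ∀ t, V.v x t 0 → t * θ R ∈ V.O x) ?_ ?_ ?_ ?_ hRJ
      · rintro _ ⟨s, rfl⟩
        rw [hθP]
        refine ⟨fun hxS ↦ sub_mem (hex s x hx ?_) (W.comb_mem hx _), fun t ht ↦ ?_⟩
        · rintro rfl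
          exact hxS s.2
        · rw [mul_sub]
          refine sub_mem ?_ (mul_mem ht.mem (W.comb_mem hx _))
          by_cases hxs : x = s
          · subst hxs
            exact het s t ht
          · exact mul_mem ht.mem (hex s x hx hxs)
      · simp
      · intro A B _ _ hA hB
        rw [map_add]
        refine ⟨fun h ↦ add_mem (hA.1 h) (hB.1 h), fun t ht ↦ ?_⟩
        rw [mul_add]
        exact add_mem (hA.2 t ht) (hB.2 t ht)
      · intro a A _ hA
        rw [map_smul]
        refine ⟨fun h ↦ (V.O x).smul_mem (hA.1 h) a, fun t ht ↦ ?_⟩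
        rw [mul_smul_comm]
        exact (V.O x).smul_mem (hA.2 t ht) a
  · rw [LinearEquiv.finrank_eq (Submodule.equivMapOfInjective θ hθ _).symm]
    rw [r1, r3] at h1
    rw [r2, hm, Nat.mul_add] at h2
    omega

end GroupFunctionField
end EllipticRelations

/-! ### Functions invariant under translations -/

namespace EllipticRelations

open Polynomial

namespace GroupFunctionField

variable {k K G : Type*} [Field k] [Field K] [Algebra k K] [AddCommGroup G]
  {V : GroupFunctionField k K G}

lemma τ_comm (a b : G) (f : K) : V.τ a (V.τ b f) = V.τ b (V.τ a f) := by
  rw [← V.τ_add, ← V.τ_add, add_comm]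

lemma simple_pole_τ {x b : G} {g : K} (hg : ∀ t, V.v (x + b) t 0 → t * g ∈ V.O (x + b)) :
    ∀ t, V.v x t 0 → t * V.τ b g ∈ V.O x := by
  intro t ht
  have h : t = V.τ b (V.τ (-b) t) := by rw [← V.τ_add, add_neg_cancel, τ_zero]
  rw [h, ← map_mul, τ_mem]
  apply hg
  rw [V.τ_v, add_neg_cancel_right]
  exact ht

/-- The value of `t * g` for a uniformizer `t` serves as a residue, and `a` is the ratio of the two
residues. -/
lemma exists_sub_smul_mem {x : G} {g₁ g₂ : K} (h₁ : ∀ t, V.v x t 0 → t * g₁ ∈ V.O x)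
    (h₂ : ∀ t, V.v x t 0 → t * g₂ ∈ V.O x) (h : g₂ ∉ V.O x) : ∃ a : k, g₁ - a • g₂ ∈ V.O x := by
  obtain ⟨t, ht0, ht, hdiv⟩ := V.uniformizer x
  obtain ⟨c₁, hc₁⟩ := h₁ t ht
  obtain ⟨c₂, hc₂⟩ := h₂ t ht
  have hc : c₂ ≠ 0 := by
    rintro rfl
    have := hdiv _ hc₂
    rw [mul_div_cancel_left₀ _ ht0] at this
    exact h this
  refine ⟨c₁ / c₂, ?_⟩
  have h0 : V.v x (t * (g₁ - (c₁ / c₂) • g₂)) 0 := by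
    have := hc₁.sub (hc₂.smul (c₁ / c₂))
    rw [div_mul_cancel₀ _ hc, sub_self] at this
    rwa [mul_sub, mul_smul_comm]
  have := hdiv _ h0
  rwa [mul_div_cancel_left₀ _ ht0] at this

section Invariant

variable {H : AddSubgroup G} {x₀ : G} {g : K}

lemma v_add_of_invariant (hinv : ∀ h ∈ H, V.τ h g = g) {x h : G} (hh : h ∈ H) {c : k} :
    V.v (x + h) g c ↔ V.v x g c := by
  rw [← V.τ_v, hinv h hh]

/-- Invariance carries regularity at `x₀` to the whole coset, so no pole remains. -/
lemma eq_const_of_invariant_of_mem (hg : g ∈ V.poles {x | x - x₀ ∈ H})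
    (hinv : ∀ h ∈ H, V.τ h g = g) (hx₀ : g ∈ V.O x₀) : ∃ c, g = algebraMap k K c := by
  refine V.global fun x ↦ ?_
  by_cases hx : x - x₀ ∈ H
  · obtain ⟨c, hc⟩ := hx₀
    refine ⟨c, ?_⟩
    rw [← v_add_of_invariant hinv hx] at hc
    simpa using hc
  · exact (hg x).1 hx

/-- The translate of `g` is a Möbius function of `g`. Its simple poles lie on `y + H`, where `g - w`
vanishes, so the product is invariant with at most simple poles on `x₀ + H`; subtracting a multiple
of `g` leaves a constant. If `a * w + b` were zero, the factor `g - w` would cancel and the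
translate would be constant. -/
lemma mul_τ_eq_of_invariant (hg : g ∈ V.poles {x | x - x₀ ∈ H})
    (hinv : ∀ h ∈ H, V.τ h g = g) (hx₀ : g ∉ V.O x₀) {y : G} {w : k} (hy : V.v y g w) :
    ∃ a b : k, (g - algebraMap k K w) * V.τ (x₀ - y) g = a • g + algebraMap k K b ∧
      a * w + b ≠ 0 := by
  set g' := V.τ (x₀ - y) g with hg'
  set u := (g - algebraMap k K w) * g' with hu
  have hmem {x : G} (hx : x - y ∉ H) : g' ∈ V.O x := by
    rw [hg', τ_mem]
    refine (hg _).1 ?_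
    simpa [show x + (x₀ - y) - x₀ = x - y by abel] using hx
  have hmem' {x : G} (hx : x - y ∈ H) : u ∈ V.O x := by
    refine simple_pole_τ (hg _).2 _ ?_
    have := (v_add_of_invariant hinv hx).2 hy
    rw [add_sub_cancel] at this
    simpa using this.sub_const w
  have hup : u ∈ V.poles {x | x - x₀ ∈ H} := by
    intro x
    by_cases hx : x - y ∈ H
    · exact ⟨fun _ ↦ hmem' hx, fun t ht ↦ mul_mem ht.mem (hmem' hx)⟩
    · refine ⟨fun h ↦ mul_mem (sub_mem ((hg x).1 h) (V.const x w).mem) (hmem hx), fun t ht ↦ ?_⟩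
      rw [hu, ← _root_.mul_assoc, mul_sub]
      exact mul_mem (sub_mem ((hg x).2 t ht) (mul_mem ht.mem (V.const x w).mem)) (hmem hx)
  have hui : ∀ h ∈ H, V.τ h u = u := by
    intro h hh
    rw [hu, map_mul, map_sub, AlgHom.commutes, hinv h hh, hg', τ_comm, hinv h hh]
  obtain ⟨a, ha⟩ := exists_sub_smul_mem (hup x₀).2 (hg x₀).2 hx₀
  obtain ⟨b, hb⟩ := eq_const_of_invariant_of_mem
    (sub_mem hup (Submodule.smul_mem _ a hg)) (by
      intro h hh
      rw [map_sub, map_smul, hui h hh, hinv h hh]) ha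
  have hub : u = a • g + algebraMap k K b := by rw [← hb]; abel
  refine ⟨a, b, hub, fun h0 ↦ ?_⟩
  have hgw : g - algebraMap k K w ≠ 0 := by
    intro h
    exact hx₀ (by rw [sub_eq_zero.1 h]; exact (V.const x₀ w).mem)
  have h1 : (g - algebraMap k K w) * g' = (g - algebraMap k K w) * algebraMap k K a := by
    rw [← hu, hub, eq_neg_of_add_eq_zero_right h0, Algebra.smul_def]
    simp only [map_neg, map_mul]
    ring
  have h2 := mul_left_cancel₀ hgw h1
  refine hx₀ ?_
  have h3 : g' ∈ V.O y := by rw [h2]; exact (V.const y a).mem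
  rw [hg', τ_mem] at h3
  simpa using h3

/-- At a point `z` outside `y + H` the translate of `g` is regular, so the Möbius identity evaluated
at `z` would read `0 = a * w + b`. -/
lemma sub_mem_of_invariant (hg : g ∈ V.poles {x | x - x₀ ∈ H})
    (hinv : ∀ h ∈ H, V.τ h g = g) (hx₀ : g ∉ V.O x₀) {y z : G} {w : k} (hy : V.v y g w)
    (hz : V.v z g w) : z - y ∈ H := by
  by_contra hzy
  obtain ⟨a, b, hab, hne⟩ := mul_τ_eq_of_invariant hg hinv hx₀ hy
  have hmem : V.τ (x₀ - y) g ∈ V.O z := by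
    rw [τ_mem]
    refine (hg _).1 ?_
    simpa [show z + (x₀ - y) - x₀ = z - y by abel] using hzy
  obtain ⟨d, hd⟩ := hmem
  have h1 := V.mul (hz.sub_const w) hd
  rw [hab, sub_self, zero_mul] at h1
  exact hne (V.unique (V.add (hz.smul a) (V.const z b)) h1)

/-- If `g` omitted `w`, then `1 / (g - w)` would be regular everywhere, hence constant. -/
lemma exists_v_of_invariant (hx₀ : g ∉ V.O x₀) (w : k) : ∃ z, V.v z g w := by
  by_contra! hno
  have hgw : g - algebraMap k K w ≠ 0 := by
    intro h
    exact hx₀ (by rw [sub_eq_zero.1 h]; exact (V.const x₀ w).mem)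
  obtain ⟨c, hc⟩ := V.global (f := (g - algebraMap k K w)⁻¹) fun x ↦ by
    by_cases hx : g - algebraMap k K w ∈ V.O x
    · obtain ⟨c, hc⟩ := hx
      refine ⟨_, V.inv hc ?_⟩
      rintro rfl
      refine hno x ?_
      simpa using V.add hc (V.const x w)
    · exact (v_inv_zero_of_notMem hx).mem
  refine hx₀ ?_
  have : g = algebraMap k K (c⁻¹ + w) := by
    rw [map_add, map_inv₀, ← hc, inv_inv]; ring
  rw [this]
  exact (V.const x₀ _).mem

/-- The quotient of the curve by a finite group of translations is not rational. -/
theorem eq_const_of_invariant [IsAlgClosed k] (hH : H ≠ ⊤) (hg : g ∈ V.poles {x | x - x₀ ∈ H})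
    (hinv : ∀ h ∈ H, V.τ h g = g) : ∃ c, g = algebraMap k K c := by
  by_contra hconst
  have hx₀ : g ∉ V.O x₀ := fun h ↦ hconst (eq_const_of_invariant_of_mem hg hinv h)
  obtain ⟨b, -, hb⟩ := SetLike.exists_of_lt hH.lt_top
  obtain ⟨w, hw⟩ : g ∈ V.O (x₀ - b) := (hg _).1 (by simpa using hb)
  obtain ⟨α, β, hαβ, hne⟩ := mul_τ_eq_of_invariant hg hinv hx₀ hw
  rw [sub_sub_cancel] at hαβ
  -- Translation by `b` acts on values of `g` as a Möbius map, and `r` is a fixed point of it. At a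
  -- point `z` with `g = r` also `g(z + b) = r`, so `b ∈ H` by injectivity on cosets, against the
  -- choice of `b`.
  obtain ⟨r, hr⟩ := IsAlgClosed.exists_root (C 1 * X ^ 2 + C (-(w + α)) * X + C (-β) : k[X])
    (by rw [degree_quadratic one_ne_zero]; decide)
  have hr' : r * (r - w) = α * r + β := by
    simp only [IsRoot.def, eval_add, eval_mul, eval_pow, eval_C, eval_X] at hr
    linear_combination hr
  have hrw : r - w ≠ 0 := by
    intro h
    rw [sub_eq_zero] at h
    subst h
    simp only [sub_self, mul_zero] at hr'
    exact hne hr'.symm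
  obtain ⟨z, hz⟩ := exists_v_of_invariant hx₀ r
  have hzb : V.τ b g ∈ V.O z := by
    rw [τ_mem]
    refine (hg _).1 fun hmem ↦ hrw ?_
    have h1 : z - (x₀ - b) ∈ H := by
      simpa [show z + b - x₀ = z - (x₀ - b) by abel] using hmem
    have h2 := (v_add_of_invariant hinv h1).2 hw
    rw [add_sub_cancel] at h2
    rw [V.unique hz h2, sub_self]
  obtain ⟨d, hd⟩ := hzb
  have h3 := V.mul (hz.sub_const w) hd
  rw [hαβ] at h3
  have h4 := V.unique h3 (V.add (hz.smul α) (V.const z β))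
  rw [← hr', mul_comm r] at h4
  have h5 := mul_left_cancel₀ hrw h4
  rw [h5, V.τ_v] at hd
  exact hb (by simpa using sub_mem_of_invariant hg hinv hx₀ hz hd)

end Invariant

/-- Commuting translations of order `p` have a common fixed vector in characteristic `p`. -/
lemma exists_fixed {p : ℕ} [Fact p.Prime] [CharP k p] (N : Submodule k K) (hN : N ≠ ⊥)
    (F : Finset G) (hF : ∀ h ∈ F, p • h = 0) (hstab : ∀ h ∈ F, ∀ g ∈ N, V.τ h g ∈ N) :
    ∃ g ∈ N, g ≠ 0 ∧ ∀ h ∈ F, V.τ h g = g := by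
  classical
  induction F using Finset.induction_on with
  | empty =>
    obtain ⟨g, hg, hg0⟩ := (Submodule.ne_bot_iff N).1 hN
    exact ⟨g, hg, hg0, by simp⟩
  | insert a F ha ih =>
    obtain ⟨g, hgN, hg0, hg⟩ := ih (fun h hh ↦ hF h (by simp [hh]))
      fun h hh ↦ hstab h (by simp [hh])
    have hpow (n : ℕ) (f : K) : ((V.τ a).toLinearMap ^ n : Module.End k K) f = V.τ (n • a) f := by
      induction n generalizing f with
      | zero => simp [τ_zero]
      | succ n ih => rw [pow_succ, Module.End.mul_apply, ih, succ_nsmul, V.τ_add]; rfl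
    -- In characteristic `p`, `(τ - 1)^p = τ^p - 1 = 0`. The last nonzero iterate `D ^ n` of `g` is
    -- fixed by `a`, and stays fixed by `F` because translations commute.
    let D : Module.End k K := (V.τ a).toLinearMap - 1
    have hDapp (f : K) : D f = V.τ a f - f := rfl
    have hchar : CharP (Module.End k K) p :=
      charP_of_injective_algebraMap (FaithfulSMul.algebraMap_injective k (Module.End k K)) p
    have hDp : D ^ p = 0 := by
      rw [sub_pow_char_of_commute p (Commute.one_right _), one_pow]
      ext f
      simp [hpow, hF a (by simp), τ_zero]
    have hprop (n : ℕ) : (D ^ n) g ∈ N ∧ ∀ h ∈ F, V.τ h ((D ^ n) g) = (D ^ n) g := by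
      induction n with
      | zero => exact ⟨hgN, hg⟩
      | succ n ih =>
        rw [pow_succ', Module.End.mul_apply, hDapp]
        refine ⟨sub_mem (hstab a (by simp) _ ih.1) ih.1, fun h hh ↦ ?_⟩
        rw [map_sub, τ_comm, ih.2 h hh]
    have hex : ∃ n, (D ^ n) g = 0 := ⟨p, by simp [hDp]⟩
    obtain ⟨n, hn⟩ : ∃ n, Nat.find hex = n + 1 := by
      refine Nat.exists_eq_succ_of_ne_zero fun h ↦ hg0 ?_
      have := Nat.find_spec hex
      rw [h] at this
      simpa using this
    have hz := Nat.find_spec hex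
    rw [hn, pow_succ', Module.End.mul_apply, hDapp, sub_eq_zero] at hz
    refine ⟨(D ^ n) g, (hprop n).1, Nat.find_min hex (by omega), fun h hh ↦ ?_⟩
    rcases Finset.mem_insert.1 hh with rfl | hh
    · exact hz
    · exact (hprop n).2 h hh

end GroupFunctionField
end EllipticRelations

/-! ### Finiteness of the `p`-torsion in characteristic `p` -/

namespace EllipticRelations

open Polynomial

lemma exists_linearMap_injective_of_infinite (F N : Type*) [Field F] [Finite F] [AddCommGroup N]
    [Module F N] [Infinite N] (r : ℕ) : ∃ φ : (Fin r → F) →ₗ[F] N, Function.Injective φ := by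
  let b := Module.Basis.ofVectorSpace F N
  have hI : Infinite (Module.Basis.ofVectorSpaceIndex F N) := by
    by_contra h
    rw [not_infinite_iff_finite] at h
    have : Module.Finite F N := Module.Finite.of_basis b
    have : Finite N := Module.finite_of_finite F
    exact not_finite N
  let e : Fin r ↪ Module.Basis.ofVectorSpaceIndex F N :=
    Fin.valEmbedding.trans (Infinite.natEmbedding _)
  exact ⟨Fintype.linearCombination F (b ∘ e),
    linearIndependent_iff_injective_fintypeLinearCombination.1
      (b.linearIndependent.comp e e.injective)⟩

/-- An infinite elementary abelian `p`-group contains finite ones of every rank. -/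
lemma exists_zmod_pi_injective {G : Type*} [AddCommGroup G] {p : ℕ} [Fact p.Prime]
    (hG : {x : G | p • x = 0}.Infinite) (r : ℕ) :
    ∃ φ : (Fin r → ZMod p) →+ G, Function.Injective φ := by
  let N : AddSubgroup G := (nsmulAddMonoidHom p : G →+ G).ker
  have hN (x : N) : p • x = 0 := Subtype.ext x.2
  let _ : Module (ZMod p) N := AddCommGroup.zmodModule hN
  have hinf : Infinite N := hG.to_subtype
  obtain ⟨φ, hφ⟩ := exists_linearMap_injective_of_infinite (ZMod p) N r
  exact ⟨N.subtype.comp φ.toAddMonoidHom, N.subtype_injective.comp hφ⟩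

/-- The `k`-valued affine functions on `(ℤ/p)ʳ`. -/
noncomputable def affineFunctions (k : Type*) [Field k] (p r : ℕ) [CharP k p] :
    (k × (Fin r → k)) →ₗ[k] ((Fin r → ZMod p) → k) where
  toFun c u := c.1 + ∑ i, c.2 i * ZMod.castHom (dvd_refl p) k (u i)
  map_add' c d := by
    funext u
    simp only [Prod.fst_add, Prod.snd_add, Pi.add_apply, add_mul, Finset.sum_add_distrib]
    ring
  map_smul' a c := by
    funext u
    simp [mul_add, Finset.mul_sum, _root_.mul_assoc]

lemma affineFunctions_apply {k : Type*} [Field k] {p r : ℕ} [CharP k p] (c : k × (Fin r → k))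
    (u : Fin r → ZMod p) : affineFunctions k p r c u =
      c.1 + ∑ i, c.2 i * ZMod.castHom (dvd_refl p) k (u i) := rfl

lemma affineFunctions_apply_add {k : Type*} [Field k] {p r : ℕ} [CharP k p] (c : k × (Fin r → k))
    (u u' : Fin r → ZMod p) : affineFunctions k p r c (u + u') =
      affineFunctions k p r c u + ∑ i, c.2 i * ZMod.castHom (dvd_refl p) k (u' i) := by
  simp only [affineFunctions_apply, Pi.add_apply, map_add, mul_add, Finset.sum_add_distrib]
  ring

lemma affineFunctions_injective {k : Type*} [Field k] {p r : ℕ} [CharP k p] [Fact p.Prime] :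
    Function.Injective (affineFunctions k p r) := by
  rw [injective_iff_map_eq_zero]
  rintro ⟨c, a⟩ h
  have h0 : c = 0 := by simpa [affineFunctions_apply] using congrFun h 0
  subst h0
  refine Prod.ext rfl (funext fun i ↦ ?_)
  have := congrFun h (Pi.single i 1)
  simpa [affineFunctions_apply, Pi.single_apply, apply_ite, -ZMod.castHom_apply] using this

namespace GroupFunctionField

variable {k K G : Type*} [Field k] [Field K] [Algebra k K] [AddCommGroup G]
  {V : GroupFunctionField k K G}

variable (V) in
/-- Evaluation of regular functions at a point. -/
noncomputable def ev (x : G) : V.O x →ₗ[k] k where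
  toFun f := f.2.choose
  map_add' f g := V.unique (f + g).2.choose_spec (V.add f.2.choose_spec g.2.choose_spec)
  map_smul' a f := V.unique (a • f).2.choose_spec (f.2.choose_spec.smul a)

lemma v_ev {x : G} (f : V.O x) : V.v x f (V.ev x f) := f.2.choose_spec

/-- The `p`-torsion of the group of points is finite in characteristic `p`. -/
theorem Chart.finite_torsion (W : V.Chart) [IsAlgClosed k] [Infinite G] (p : ℕ) [Fact p.Prime]
    [CharP k p] : {x : G | p • x = 0}.Finite := by
  classical
  by_contra hinf
  obtain ⟨C, hC⟩ := W.exists_card_le_finrank_add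
  -- With rank `C + 2` the affine functions have dimension `C + 3`, so they meet a subspace of
  -- codimension at most `C` in dimension at least `3`, one more than a residue and a value can
  -- detect.
  obtain ⟨φ, hφ⟩ := exists_zmod_pi_injective hinf (C + 2)
  set U := Fin (C + 2) → ZMod p with hU
  set H := φ.range with hH
  have hpH : ∀ h ∈ H, p • h = 0 := by
    rintro _ ⟨u, rfl⟩
    rw [← map_nsmul]
    have : p • u = 0 := by funext i; simp
    rw [this, map_zero]
  have hHfin : (H : Set G).Finite := Set.finite_range φ
  have hHtop : H ≠ ⊤ := by
    intro h
    rw [h] at hHfin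
    exact Set.infinite_univ hHfin
  obtain ⟨x₀, hx₀⟩ : ∃ x₀, ∀ u, x₀ + φ u ∉ W.T := by
    have hbad : (⋃ u : U, (fun x ↦ x - φ u) '' (W.T : Set G)).Finite :=
      Set.finite_iUnion fun u ↦ W.T.finite_toSet.image _
    obtain ⟨x₀, hx₀⟩ := hbad.exists_notMem
    refine ⟨x₀, fun u hu ↦ hx₀ (Set.mem_iUnion.2 ⟨u, x₀ + φ u, hu, by simp⟩)⟩
  set S : Finset G := Finset.univ.image fun u : U ↦ x₀ + φ u with hS
  have hScard : S.card = Fintype.card U := by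
    exact Finset.card_image_of_injective _ ((add_right_injective x₀).comp hφ)
  have hSset : (S : Set G) = {x | x - x₀ ∈ H} := by
    ext x
    simp only [hS, Finset.coe_image, Finset.coe_univ, Set.image_univ, Set.mem_range,
      Set.mem_ofPred_eq, hH, AddMonoidHom.mem_range]
    exact exists_congr fun u ↦ by rw [eq_sub_iff_add_eq, add_comm]
  obtain ⟨M, hMfin, hM, hMcard⟩ := hC S (by
    rw [Finset.disjoint_left]
    intro x hx
    obtain ⟨u, -, rfl⟩ := Finset.mem_image.1 hx
    exact hx₀ u)
  rw [hSset] at hM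
  obtain ⟨z, hz⟩ : ∃ z, z - x₀ ∉ H := by
    obtain ⟨b, -, hb⟩ := SetLike.exists_of_lt hHtop.lt_top
    exact ⟨b + x₀, by simpa using hb⟩
  set E := V.poles {x | x - x₀ ∈ H} with hE
  have hzu (u : U) : z + φ u - x₀ ∉ H := by
    rw [add_sub_right_comm]
    exact fun h ↦ hz ((H.add_mem_cancel_right ⟨u, rfl⟩).1 h)
  have hreg (g : E) (u : U) : g.1 ∈ V.O (z + φ u) := (g.2 _).1 (hzu u)
  have hstab {g : K} (hg : g ∈ E) (u : U) : V.τ (φ u) g ∈ E := by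
    intro x
    refine ⟨fun hx ↦ τ_mem.2 ((hg _).1 fun h ↦ hx ?_), simple_pole_τ (hg _).2⟩
    have : x + φ u - x₀ ∈ H := h
    rw [add_sub_right_comm] at this
    exact (H.add_mem_cancel_right ⟨u, rfl⟩).1 this
  let ev : E →ₗ[k] (U → k) := LinearMap.pi fun u ↦
    V.ev (z + φ u) ∘ₗ (E.subtype.codRestrict (Subalgebra.toSubmodule (V.O (z + φ u)))
      fun g ↦ hreg g u)
  have hev (g : E) (u : U) : V.v (z + φ u) g (ev g u) := v_ev (⟨g.1, hreg g u⟩ : V.O (z + φ u))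
  -- The kernel is stable under `H`. If it were nonzero it would contain a nonzero `H`-invariant
  -- function, which is constant and vanishes on the coset of `z`.
  have hevinj : Function.Injective ev := by
    rw [← LinearMap.ker_eq_bot]
    by_contra hker
    obtain ⟨g, hgN, hg0, hgf⟩ := exists_fixed (V := V) (p := p) (ev.ker.map E.subtype)
      (fun h ↦ hker (Submodule.map_injective_of_injective E.subtype_injective
        (by rw [h, Submodule.map_bot]))) (Finset.univ.image φ) (by
        intro h hh
        obtain ⟨u, -, rfl⟩ := Finset.mem_image.1 hh
        exact hpH _ ⟨u, rfl⟩) (by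
        intro h hh g hg
        obtain ⟨u, -, rfl⟩ := Finset.mem_image.1 hh
        obtain ⟨g, hg, rfl⟩ := hg
        refine ⟨⟨_, hstab g.2 u⟩, ?_, rfl⟩
        refine LinearMap.mem_ker.2 (funext fun u' ↦ ?_)
        have h1 := hev ⟨_, hstab g.2 u⟩ u'
        rw [V.τ_v, add_assoc, ← map_add] at h1
        have h2 := V.unique h1 (hev g (u' + u))
        rw [h2, LinearMap.mem_ker.1 hg]
        rfl)
    obtain ⟨g, hg, rfl⟩ := hgN
    obtain ⟨c, hc⟩ := eq_const_of_invariant hHtop g.2 (by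
      rintro _ ⟨u, rfl⟩
      exact hgf _ (Finset.mem_image_of_mem _ (Finset.mem_univ u)))
    have h1 := hev g 0
    rw [LinearMap.mem_ker.1 hg, hc] at h1
    have h2 : c = 0 := V.unique (V.const _ c) h1
    rw [h2, map_zero] at hc
    exact hg0 hc
  obtain ⟨t, ht0, ht, hdiv⟩ := V.uniformizer x₀
  let res : E →ₗ[k] k := V.ev x₀ ∘ₗ
    ((LinearMap.mulLeft k t ∘ₗ E.subtype).codRestrict (Subalgebra.toSubmodule (V.O x₀))
      fun g ↦ (g.2 x₀).2 t ht)
  have hres (g : E) : V.v x₀ (t * g.1) (res g) := v_ev (⟨t * g.1, _⟩ : V.O x₀)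
  let M' : Submodule k E := M.comap E.subtype
  have hM' : Module.finrank k M' = Module.finrank k M :=
    (Submodule.comapSubtypeEquivOfLe hM).finrank_eq
  have hM'fin : FiniteDimensional k M' :=
    (Submodule.comapSubtypeEquivOfLe hM).symm.finiteDimensional
  let B : Submodule k (U → k) := M'.map ev ⊓ (affineFunctions k p (C + 2)).range
  have hB : 3 ≤ Module.finrank k B := by
    have h1 := Submodule.finrank_sup_add_finrank_inf_eq (M'.map ev)
      (affineFunctions k p (C + 2)).range
    have h2 := Submodule.finrank_le (M'.map ev ⊔ (affineFunctions k p (C + 2)).range)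
    rw [LinearEquiv.finrank_eq (Submodule.equivMapOfInjective ev hevinj M').symm, hM',
      LinearMap.finrank_range_of_inj affineFunctions_injective] at h1
    rw [Module.finrank_fintype_fun_eq_card, ← hScard] at h2
    simp only [Module.finrank_prod, Module.finrank_self, Module.finrank_fintype_fun_eq_card,
      Fintype.card_fin] at h1
    change 3 ≤ Module.finrank k ↥(M'.map ev ⊓ (affineFunctions k p (C + 2)).range)
    omega
  let B' : Submodule k E := B.comap ev
  have hBB' : Module.finrank k B ≤ Module.finrank k B' := by
    have h1 : B'.map ev = B := by
      rw [Submodule.map_comap_eq, inf_eq_right]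
      exact inf_le_left.trans (LinearMap.map_le_range)
    rw [← h1, LinearEquiv.finrank_eq (Submodule.equivMapOfInjective ev hevinj B').symm]
  -- Zero residue means regular at `x₀`, and, through `hdiff`, on the whole coset of `x₀`. Such a
  -- function is constant, and its value at `z` decides whether it is zero.
  have hinj : Function.Injective
      ((res.prod (LinearMap.proj (0 : U) ∘ₗ ev)).domRestrict B') := by
    rw [injective_iff_map_eq_zero]
    rintro ⟨g, hgB⟩ hg
    obtain ⟨hg1, hg2⟩ := Prod.ext_iff.1 hg
    replace hg1 : res g = 0 := hg1
    replace hg2 : ev g 0 = 0 := hg2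
    obtain ⟨-, ⟨a, ha⟩⟩ : ev g ∈ B := hgB
    have hgx₀ : g.1 ∈ V.O x₀ := by
      have h1 := hres g
      rw [hg1] at h1
      have h2 := hdiv _ h1
      rwa [mul_div_cancel_left₀ _ ht0] at h2
    -- An affine function changes by a constant under translation; injectivity of `ev` lifts this
    -- from the values to `g` itself.
    have hdiff (u : U) : ∃ c, V.τ (φ u) g.1 = g.1 + algebraMap k K c := by
      set c := ∑ i, a.2 i * ZMod.castHom (dvd_refl p) k (u i) with hc
      have hcE : algebraMap k K c ∈ E := fun x ↦
        ⟨fun _ ↦ (V.const x c).mem, fun t ht ↦ mul_mem ht.mem (V.const x c).mem⟩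
      have h1 : (⟨_, hstab g.2 u⟩ : E) = g + ⟨_, hcE⟩ := by
        apply hevinj
        funext u'
        have h1 := hev ⟨_, hstab g.2 u⟩ u'
        rw [V.τ_v, add_assoc, ← map_add] at h1
        rw [V.unique h1 (hev g (u' + u))]
        have h2 := hev ⟨_, hcE⟩ u'
        rw [map_add, Pi.add_apply, V.unique h2 (V.const _ c), ← ha]
        exact affineFunctions_apply_add a u' u
      exact ⟨c, congrArg Subtype.val h1⟩
    obtain ⟨c, hc⟩ := V.global (f := g.1) fun x ↦ by
      by_cases hx : x - x₀ ∈ H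
      · obtain ⟨u, hu⟩ := hx
        obtain ⟨c, hc⟩ := hdiff u
        have h1 : V.τ (φ u) g.1 ∈ V.O x₀ := by
          rw [hc]; exact add_mem hgx₀ (V.const _ c).mem
        rw [τ_mem, hu, add_sub_cancel] at h1
        exact h1
      · exact (g.2 x).1 hx
    have h1 := hev g 0
    rw [hg2, hc] at h1
    have h2 := V.unique (V.const _ c) h1
    rw [h2, map_zero] at hc
    exact Subtype.ext (Subtype.ext hc)
  have h1 := LinearMap.finrank_le_finrank_of_injective hinj
  rw [Module.finrank_prod, Module.finrank_self] at h1
  omega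

end GroupFunctionField
end EllipticRelations

/-! ### From linear relations between values to constancy -/

namespace EllipticRelations

open Polynomial Filter

section Relation

variable {k G : Type*} [Field k] [AddCommGroup G]

/-- The hypothesis that multiplication by nonzero integers is surjective with finite kernel. -/
structure IsogenyMul (G : Type*) [AddCommGroup G] : Prop where
  surjective {m : ℤ} : m ≠ 0 → Function.Surjective fun x : G ↦ m • x
  finite_ker {m : ℤ} : m ≠ 0 → {x : G | m • x = 0}.Finite

lemma IsogenyMul.tendsto (hG : IsogenyMul G) {m : ℤ} (hm : m ≠ 0) (u : G) :
    Tendsto (fun y : G ↦ u - m • y) cofinite cofinite := by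
  refine Tendsto.cofinite_of_finite_preimage_singleton fun w ↦ ?_
  obtain ⟨y₀, hy₀⟩ := hG.surjective hm (u - w)
  refine ((hG.finite_ker hm).image fun x ↦ x + y₀).subset fun y hy ↦ ⟨y - y₀, ?_, by simp⟩
  have h1 : u - m • y = w := hy
  have h2 : m • y₀ = u - w := hy₀
  change m • (y - y₀) = 0
  rw [smul_sub, h2, ← h1]
  abel

/-- A bad `y` would send `u - a • y` into the finite set `b • T`, and this map has finite fibres. -/
lemma IsogenyMul.eventually_exists (hG : IsogenyMul G) {T : Set G} (hT : T.Finite) {a b : ℤ}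
    (ha : a ≠ 0) (hb : b ≠ 0) (u : G) : ∀ᶠ y in cofinite, ∃ z ∉ T, a • y + b • z = u := by
  have h : ∀ᶠ w in cofinite, w ∉ (fun z : G ↦ b • z) '' T := (hT.image _).eventually_cofinite_notMem
  refine ((hG.tendsto ha u).eventually h).mono fun y hy ↦ ?_
  obtain ⟨z, hz⟩ := hG.surjective hb (u - a • y)
  have hz' : b • z = u - a • y := hz
  exact ⟨z, fun hzT ↦ hy ⟨z, hzT, hz⟩, by rw [hz']; abel⟩

lemma eventually_add_notMem {T : Set G} (hT : T.Finite) (b : G) : ∀ᶠ y in cofinite, y + b ∉ T :=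
  (add_left_injective b).tendsto_cofinite.eventually hT.eventually_cofinite_notMem

lemma sum_eq_three_add {I R : Type*} [Fintype I] [DecidableEq I] [AddCommGroup R] {i₁ i₂ i₃ : I}
    (h₂ : i₂ ≠ i₁) (h₃₁ : i₃ ≠ i₁) (h₃₂ : i₃ ≠ i₂) (f : I → R) : ∑ i, f i =
      f i₁ + f i₂ + f i₃ + ∑ i ∈ ((Finset.univ.erase i₁).erase i₂).erase i₃, f i := by
  rw [← Finset.add_sum_erase _ _ (Finset.mem_univ i₁),
    ← Finset.add_sum_erase (Finset.univ.erase i₁) _ (a := i₂) (by simp [h₂]),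
    ← Finset.add_sum_erase ((Finset.univ.erase i₁).erase i₂) _ (a := i₃) (by simp [h₃₁, h₃₂])]
  abel

/-- A three-term relation between the values of a function on a group: translation changes the
values by a constant. -/
lemma exists_translation_const [Infinite G] (hG : IsogenyMul G) {T : Set G} (hT : T.Finite)
    {ψ : G → k}
    {a₁ a₂ a₃ : ℤ} (h₁ : (a₁ : k) ≠ 0) (h₂ : a₂ ≠ 0) (h₃ : a₃ ≠ 0) {c₀ : G} {e₀ : k}
    (hrel : ∀ x ∉ T, ∀ y ∉ T, ∀ z ∉ T, a₁ • x + a₂ • y + a₃ • z + c₀ = 0 →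
      a₁ * ψ x + a₂ * ψ y + a₃ * ψ z + e₀ = 0) (b : G) :
    ∃ D, ∀ x ∉ T, x + b ∉ T → ψ (x + b) = ψ x + D := by
  obtain ⟨b₂, hb₂⟩ := hG.surjective h₂ (a₁ • b)
  replace hb₂ : a₂ • b₂ = a₁ • b := hb₂
  -- Moving `b` from the first variable to the second as `b₂` keeps `z` fixed, so `a₁ * (ψ (x + b) -
  -- ψ x) = a₂ * (ψ (y + b₂) - ψ y)`. The same `y` serves `x` and `x'`.
  have key : ∀ x ∉ T, x + b ∉ T → ∀ x' ∉ T, x' + b ∉ T →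
      ψ (x + b) - ψ x = ψ (x' + b) - ψ x' := by
    intro x hx hxb x' hx' hxb'
    obtain ⟨y, ⟨⟨⟨hy, hy'⟩, z, hz, hxz⟩, z', hz', hxz'⟩⟩ :=
      (((hT.eventually_cofinite_notMem.and (eventually_add_notMem hT b₂)).and
        (hG.eventually_exists hT h₂ h₃ (-c₀ - a₁ • (x + b)))).and
        (hG.eventually_exists hT h₂ h₃ (-c₀ - a₁ • (x' + b)))).exists
    have e1 := hrel _ hxb _ hy _ hz (by rw [add_assoc (a₁ • _), hxz]; abel)
    have e2 := hrel _ hx _ hy' _ hz (by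
      rw [smul_add, hb₂]
      rw [eq_sub_iff_add_eq, smul_add] at hxz
      rw [← add_eq_zero_iff_eq_neg.2 hxz]
      abel)
    have e3 := hrel _ hxb' _ hy _ hz' (by rw [add_assoc (a₁ • _), hxz']; abel)
    have e4 := hrel _ hx' _ hy' _ hz' (by
      rw [smul_add, hb₂]
      rw [eq_sub_iff_add_eq, smul_add] at hxz'
      rw [← add_eq_zero_iff_eq_neg.2 hxz']
      abel)
    apply mul_left_cancel₀ h₁
    linear_combination e1 - e2 - e3 + e4
  obtain ⟨x', hx', hxb'⟩ :=
    (hT.eventually_cofinite_notMem.and (eventually_add_notMem hT b)).exists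
  refine ⟨ψ (x' + b) - ψ x', fun x hx hxb ↦ ?_⟩
  rw [← key x hx hxb x' hx' hxb']
  ring

end Relation

namespace GroupFunctionField

variable {k K G : Type*} [Field k] [Field K] [Algebra k K] [AddCommGroup G] [Infinite G]
  {V : GroupFunctionField k K G}

/-- If translation changes `ψ` by constants and the polynomial function `(s - ψ) ^ N` is rational
for every `s`, then `ψ` is constant. -/
lemma const_of_translation_const (hid : ∀ f : K, f ≠ 0 → {x | V.v x f 0}.Finite) {T : Set G}
    (hT : T.Finite) {ψ : G → k} (htr : ∀ b, ∃ D, ∀ x ∉ T, x + b ∉ T → ψ (x + b) = ψ x + D)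
    {N : ℕ} (hN : N ≠ 0) {M : k → K} (hM : ∀ x ∉ T, ∀ s, V.v x (M s) ((s - ψ x) ^ N)) {x₀ : G}
    (hx₀ : x₀ ∉ T) : ∀ x ∉ T, ψ x = ψ x₀ := by
  obtain ⟨c, hc⟩ := V.global (f := M (ψ x₀)) fun y ↦ by
    obtain ⟨b, hb⟩ : ∃ b, y + b ∉ T := by
      obtain ⟨b, hb⟩ := (eventually_add_notMem hT y).exists
      exact ⟨b, by rwa [add_comm]⟩
    obtain ⟨D, hD⟩ := htr b
    -- Both sides take the value `(ψ x₀ - ψ x) ^ N` at almost every `x`. The right side is regular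
    -- at `y`, since `y + b` avoids `T`.
    have heq : M (ψ x₀) = V.τ b (M (ψ x₀ + D)) := by
      by_contra hne
      have h1 := hid _ (sub_ne_zero.2 hne)
      obtain ⟨x, ⟨hx, hxb⟩, hx0⟩ := ((hT.eventually_cofinite_notMem.and
        (eventually_add_notMem hT b)).and h1.eventually_cofinite_notMem).exists
      refine hx0 ?_
      have h2 := (hM x hx (ψ x₀)).sub (V.τ_v.2 (hM _ hxb (ψ x₀ + D)))
      rw [hD x hx hxb, add_sub_add_right_eq_sub, sub_self] at h2
      exact h2
    rw [heq]
    exact ⟨_, V.τ_v.2 (hM _ hb _)⟩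
  have hc0 : c = 0 := by
    have h1 := hM x₀ hx₀ (ψ x₀)
    rw [hc, sub_self, zero_pow hN] at h1
    exact V.unique (V.const _ c) h1
  intro x hx
  have h1 := hM x hx (ψ x₀)
  rw [hc, hc0, map_zero] at h1
  have h2 := V.unique h1 (v_zero x)
  exact (sub_eq_zero.1 (pow_eq_zero_iff hN |>.1 h2)).symm

/-- The abstract form of the main theorem: `L x c` says that `c` is a value over `x`. -/
theorem exists_const_of_relation (hG : IsogenyMul G)
    (hid : ∀ f : K, f ≠ 0 → {x | V.v x f 0}.Finite) {T : Set G} (hT : T.Finite)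
    {L : G → k → Prop} (hL : ∀ x ∉ T, ∃ c, L x c) {N : ℕ} (hN : N ≠ 0) {M : k → K}
    (hM : ∀ x ∉ T, ∀ c, (∀ d, L x d → d = c) → ∀ s, V.v x (M s) ((s - c) ^ N))
    {n : ℕ} (hn : 3 ≤ n) {a : Fin n → ℤ} (ha : ∀ i, a i ≠ 0) {i₁ : Fin n} (hi₁ : (a i₁ : k) ≠ 0)
    (hrel : ∀ (x : Fin n → G) (c : Fin n → k), (∀ i, L (x i) (c i)) → ∑ i, a i • x i = 0 →
      ∑ i, a i * c i = 0) :
    ∃ c : k, (∀ x ∉ T, ∀ d, L x d → d = c) ∧ ((∑ i, (a i : k)) ≠ 0 → c = 0) := by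
  classical
  obtain ⟨i₂, hi₂⟩ : ∃ i₂, i₂ ≠ i₁ := by
    have : Nontrivial (Fin n) := Fin.nontrivial_iff_two_le.2 (by omega)
    exact exists_ne i₁
  obtain ⟨i₃, hi₃₁, hi₃₂⟩ : ∃ i₃, i₃ ≠ i₁ ∧ i₃ ≠ i₂ := by
    have : ((Finset.univ.erase i₁).erase i₂).Nonempty := by
      rw [← Finset.card_pos, Finset.card_erase_of_mem (by simp [hi₂]),
        Finset.card_erase_of_mem (by simp), Finset.card_univ, Fintype.card_fin]
      omega
    obtain ⟨i₃, h⟩ := this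
    simp only [Finset.mem_erase, Finset.mem_univ, and_true] at h
    exact ⟨i₃, h.2, h.1⟩
  obtain ⟨w, hw⟩ := hT.eventually_cofinite_notMem.exists
  obtain ⟨d, hd⟩ := hL w hw
  set F := ((Finset.univ.erase i₁).erase i₂).erase i₃ with hF
  -- All the other variables are frozen at the point `w` with its value `d`.
  have hthree {x y z : G} {c₁ c₂ c₃ : k} (h₁ : L x c₁) (h₂ : L y c₂) (h₃ : L z c₃)
      (h : a i₁ • x + a i₂ • y + a i₃ • z + ∑ i ∈ F, a i • w = 0) :
      a i₁ * c₁ + a i₂ * c₂ + a i₃ * c₃ + ∑ i ∈ F, a i * d = 0 := by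
    have := hrel (fun i ↦ if i = i₁ then x else if i = i₂ then y else if i = i₃ then z else w)
      (fun i ↦ if i = i₁ then c₁ else if i = i₂ then c₂ else if i = i₃ then c₃ else d)
      (fun i ↦ by split_ifs <;> assumption) (by
        rw [sum_eq_three_add hi₂ hi₃₁ hi₃₂]
        simp only [hi₂, hi₃₁, hi₃₂, if_true, if_false]
        rw [← h]
        congr 1
        refine Finset.sum_congr rfl fun i hi ↦ ?_
        simp only [hF, Finset.mem_erase] at hi
        simp [hi.1, hi.2.1, hi.2.2.1])
    rw [sum_eq_three_add hi₂ hi₃₁ hi₃₂] at this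
    simp only [hi₂, hi₃₁, hi₃₂, if_true, if_false] at this
    rw [← this]
    congr 1
    refine Finset.sum_congr rfl fun i hi ↦ ?_
    simp only [Finset.mem_erase] at hi
    simp [hi.1, hi.2.1, hi.2.2.1]
  have hsolve (x : G) : ∃ y ∉ T, ∃ z ∉ T,
      a i₁ • x + a i₂ • y + a i₃ • z + ∑ i ∈ F, a i • w = 0 := by
    obtain ⟨y, hy, z, hz, h⟩ := (hT.eventually_cofinite_notMem.and (hG.eventually_exists hT
      (ha i₂) (ha i₃) (-(∑ i ∈ F, a i • w) - a i₁ • x))).exists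
    exact ⟨y, hy, z, hz, by rw [add_assoc (a i₁ • x), h]; abel⟩
  -- The same `y`, `z` and their values complete both `c` and `c'`, and the coefficient `a i₁`
  -- cancels in `k`.
  have huniq {x : G} {c c' : k} (hc : L x c) (hc' : L x c') : c = c' := by
    obtain ⟨y, hy, z, hz, h⟩ := hsolve x
    obtain ⟨c₂, h₂⟩ := hL y hy
    obtain ⟨c₃, h₃⟩ := hL z hz
    apply mul_left_cancel₀ hi₁
    linear_combination hthree hc h₂ h₃ h - hthree hc' h₂ h₃ h
  have hψ : ∃ ψ : G → k, ∀ x ∉ T, L x (ψ x) := by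
    choose! ψ hψ using hL
    exact ⟨ψ, hψ⟩
  obtain ⟨ψ, hψ⟩ := hψ
  have hconst := const_of_translation_const hid hT (ψ := ψ) (N := N) (M := M)
    (exists_translation_const hG hT hi₁ (ha i₂) (ha i₃)
      (fun x hx y hy z hz h ↦ hthree (hψ x hx) (hψ y hy) (hψ z hz) h)) hN
    (fun x hx ↦ hM x hx _ fun d hd ↦ huniq hd (hψ x hx)) hw
  refine ⟨ψ w, fun x hx d hd ↦ by rw [huniq hd (hψ x hx), hconst x hx], fun hsum ↦ ?_⟩
  obtain ⟨y, hy, z, hz, h⟩ := hsolve w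
  have h1 := hthree (hψ w hw) (hψ y hy) (hψ z hz) h
  rw [hconst y hy, hconst z hz, huniq hd (hψ w hw)] at h1
  have h2 := sum_eq_three_add hi₂ hi₃₁ hi₃₂ fun i ↦ (a i : k) * ψ w
  rw [← hF, h1, ← Finset.sum_mul] at h2
  exact (mul_eq_zero.1 h2).resolve_left hsum

end GroupFunctionField
end EllipticRelations

/-! ### Differentials, Dedekind domains and Noether normalization -/

namespace EllipticRelations

open Polynomial

section Points

variable {k S : Type*} [Field k] [CommRing S] [Algebra k S]

lemma exists_algHom_ker_eq [IsAlgClosed k] [Algebra.FiniteType k S] (m : Ideal S) [m.IsMaximal] :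
    ∃ χ : S →ₐ[k] k, RingHom.ker χ = m := by
  let _ := Ideal.Quotient.field m
  have : Module.Finite k (S ⧸ m) := finite_of_finite_type_of_isJacobsonRing k (S ⧸ m)
  have hb : Function.Bijective (algebraMap k (S ⧸ m)) :=
    IsAlgClosed.algebraMap_bijective_of_isIntegral
  let e := (AlgEquiv.ofBijective (Algebra.ofId k (S ⧸ m)) hb).symm
  refine ⟨e.toAlgHom.comp (Ideal.Quotient.mkₐ k m), ?_⟩
  ext x
  simp [RingHom.mem_ker, Ideal.Quotient.eq_zero_iff_mem]

lemma algHom_eq_of_ker_le {χ χ' : S →ₐ[k] k} (h : RingHom.ker χ ≤ RingHom.ker χ') : χ = χ' := by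
  ext x
  have h1 : x - algebraMap k S (χ x) ∈ RingHom.ker χ := by simp [RingHom.mem_ker]
  have h2 := h h1
  rw [RingHom.mem_ker, map_sub, AlgHom.commutes, sub_eq_zero] at h2
  exact h2.symm

lemma isMaximal_ker (χ : S →ₐ[k] k) : (RingHom.ker χ).IsMaximal :=
  RingHom.ker_isMaximal_of_surjective χ fun c ↦ ⟨algebraMap k S c, by simp⟩

end Points

section Kaehler

variable {k S : Type*} [Field k] [CommRing S] [Algebra k S]

/-- A function whose differential vanishes at a rational point where it has value zero vanishes
there to second order. -/
lemma mem_sq_of_kaehler (χ : S →ₐ[k] k) {ω : Ω[S⁄k]} {f a : S} (hf : χ f = 0) (ha : χ a = 0)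
    (hD : KaehlerDifferential.D k S f = a • ω) : f ∈ RingHom.ker χ ^ 2 := by
  by_contra hmem
  -- A functional that kills the square of the maximal ideal but not `f` gives the derivation `s ↦ l
  -- (s - χ s)` into `k`. It factors through the differentials, so it kills `f` because `χ a = 0`.
  obtain ⟨l, hl, hle⟩ := Submodule.exists_le_ker_of_notMem
    (p := (RingHom.ker χ ^ 2 : Ideal S).restrictScalars k) (v := f)
    (by rwa [Submodule.restrictScalars_mem])
  let _ : Module S k := Module.compHom k χ.toRingHom
  have hsmul (s : S) (c : k) : s • c = χ s * c := rfl
  have : IsScalarTower k S k := ⟨fun x y z ↦ by simp [hsmul, _root_.mul_assoc]⟩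
  let d : Derivation k S k := Derivation.mk'
    (l ∘ₗ (LinearMap.id - (Algebra.linearMap k S) ∘ₗ χ.toLinearMap)) (by
      intro s t
      have h1 : (s - algebraMap k S (χ s)) * (t - algebraMap k S (χ t)) ∈ RingHom.ker χ ^ 2 := by
        rw [pow_two]
        exact Ideal.mul_mem_mul (by simp [RingHom.mem_ker]) (by simp [RingHom.mem_ker])
      have h2 : l ((s - algebraMap k S (χ s)) * (t - algebraMap k S (χ t))) = 0 := hle h1
      have h3 : s * t - algebraMap k S (χ (s * t)) =
          (s - algebraMap k S (χ s)) * (t - algebraMap k S (χ t)) +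
          (χ s • (t - algebraMap k S (χ t)) + χ t • (s - algebraMap k S (χ s))) := by
        simp only [Algebra.smul_def, map_mul]
        ring
      simp only [LinearMap.comp_apply, LinearMap.sub_apply, LinearMap.id_apply,
        AlgHom.toLinearMap_apply, Algebra.linearMap_apply, hsmul]
      rw [h3, map_add, h2, map_add, map_smul, map_smul, zero_add]
      rfl)
  have h1 : d f = l f := by
    change l (f - algebraMap k S (χ f)) = l f
    rw [hf, map_zero, sub_zero]
  have h2 : d f = 0 := by
    rw [← Derivation.liftKaehlerDifferential_comp_D, hD, map_smul, hsmul, ha, zero_mul]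
  exact hl (h1.symm.trans h2)

variable [IsAlgClosed k] [Algebra.FiniteType k S]

/-- The coefficient of `df` along `ω`, evaluated at the point, decides the class of `f` modulo `m ^
2`. So one `t` generates `m` modulo `m ^ 2`, with `t = 0` if all these coefficients vanish, and
Nakayama's lemma finishes in the local ring. -/
lemma isPrincipal_maximalIdeal_of_kaehler {ω : Ω[S⁄k]} (hω : ∀ x : Ω[S⁄k], ∃ c : S, c • ω = x)
    (m : Ideal S) [m.IsMaximal] :
    (IsLocalRing.maximalIdeal (Localization.AtPrime m)).IsPrincipal := by
  obtain ⟨χ, hχ⟩ := exists_algHom_ker_eq (k := k) m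
  have : IsNoetherianRing S := Algebra.FiniteType.isNoetherianRing k S
  obtain ⟨t, ht, hle⟩ : ∃ t ∈ m, m ≤ Ideal.span {t} ⊔ m ^ 2 := by
    by_cases h : ∃ t ∈ m, ∃ b, χ b ≠ 0 ∧ KaehlerDifferential.D k S t = b • ω
    · obtain ⟨t, ht, b, hb, htb⟩ := h
      refine ⟨t, ht, fun f hf ↦ ?_⟩
      obtain ⟨a, ha⟩ := hω (KaehlerDifferential.D k S f)
      have h1 : f - (χ a / χ b) • t ∈ m ^ 2 := by
        rw [← hχ] at hf ht ⊢
        refine mem_sq_of_kaehler χ (ω := ω) (a := a - (χ a / χ b) • b) ?_ ?_ ?_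
        · simp [RingHom.mem_ker.1 hf, RingHom.mem_ker.1 ht]
        · simp [hb]
        · simp [htb, ← ha, sub_smul]
      rw [← sub_add_cancel f ((χ a / χ b) • t), add_comm]
      refine Submodule.add_mem_sup ?_ h1
      rw [Algebra.smul_def]
      exact Ideal.mul_mem_left _ _ (Ideal.mem_span_singleton_self t)
    · push Not at h
      refine ⟨0, zero_mem _, fun f hf ↦ Submodule.mem_sup_right ?_⟩
      obtain ⟨a, ha⟩ := hω (KaehlerDifferential.D k S f)
      have h0 : χ a = 0 := by
        by_contra hne
        exact h f hf a hne ha.symm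
      rw [← hχ] at hf ⊢
      exact mem_sq_of_kaehler χ hf h0 ha.symm
  refine ⟨algebraMap S _ t, le_antisymm ?_ ?_⟩
  · refine Submodule.le_of_le_smul_of_le_jacobson_bot
      (I := IsLocalRing.maximalIdeal (Localization.AtPrime m)) (IsNoetherian.noetherian _)
      (IsLocalRing.maximalIdeal_le_jacobson _) ?_
    have h1 := Ideal.map_mono (f := algebraMap S (Localization.AtPrime m)) hle
    rw [Ideal.map_sup, Ideal.map_pow, Ideal.map_span, Set.image_singleton,
      Localization.AtPrime.map_eq_maximalIdeal, pow_two] at h1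
    exact h1
  · rw [Submodule.span_singleton_le_iff_mem, ← Localization.AtPrime.map_eq_maximalIdeal]
    exact Ideal.mem_map_of_mem _ ht

/-- A domain of finite type over an algebraically closed field whose Kähler differentials are free
of rank one is a Dedekind domain. -/
theorem isDedekindDomain_of_kaehler [IsDomain S] {ω : Ω[S⁄k]}
    (hω : ∀ x : Ω[S⁄k], ∃ c : S, c • ω = x) :
    IsDedekindDomain S := by
  have : IsNoetherianRing S := Algebra.FiniteType.isNoetherianRing k S
  have hmax (P : Ideal S) (hP : P ≠ ⊥) (hPp : P.IsPrime) : P.IsMaximal := by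
    obtain ⟨m, hm, hPm⟩ := P.exists_le_maximal hPp.ne_top
    have htfae := tfae_of_isNoetherianRing_of_isLocalRing_of_isDomain (Localization.AtPrime m)
    have h0 : IsIntegrallyClosed (Localization.AtPrime m) ∧
        ∀ P : Ideal (Localization.AtPrime m), P ≠ ⊥ → P.IsPrime →
          P = IsLocalRing.maximalIdeal (Localization.AtPrime m) :=
      (htfae.out 4 3).1 (isPrincipal_maximalIdeal_of_kaehler hω m)
    have h1 := h0.2 (P.map (algebraMap S (Localization.AtPrime m)))
    have hdisj : Disjoint (m.primeCompl : Set S) (P : Set S) := by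
      rw [Set.disjoint_left]
      exact fun x hx hxP ↦ hx (hPm hxP)
    have h2 := h1 (fun h0 ↦ hP ((Ideal.map_eq_bot_iff_of_injective
      (IsLocalization.injective _ m.primeCompl_le_nonZeroDivisors)).1 h0))
      (IsLocalization.isPrime_of_isPrime_disjoint m.primeCompl _ P hPp hdisj)
    have h3 := IsLocalization.under_map_of_isPrime_disjoint m.primeCompl
      (Localization.AtPrime m) hPp hdisj
    rw [h2, Localization.AtPrime.under_maximalIdeal] at h3
    rwa [← h3]
  have : IsDedekindDomainDvr S :=
    { is_dvr_at_nonzero_prime := fun P hP hPp ↦ by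
        have := hmax P hP hPp
        exact ((IsDiscreteValuationRing.TFAE (Localization.AtPrime P)
          (IsLocalization.AtPrime.not_isField S hP _)).out 4 0).1
          (isPrincipal_maximalIdeal_of_kaehler hω P) }
  infer_instance

/-- A field of finite type over the algebraically closed `k` is `k` itself, which has no
differentials. -/
lemma not_isField_of_kaehler [Nontrivial S] [Nontrivial Ω[S⁄k]] : ¬ IsField S := by
  intro h
  let _ := h.toField
  have : Module.Finite k S := finite_of_finite_type_of_isJacobsonRing k S
  have hb : Function.Bijective (algebraMap k S) :=
    IsAlgClosed.algebraMap_bijective_of_isIntegral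
  have := KaehlerDifferential.subsingleton_of_surjective k S hb.2
  exact not_subsingleton Ω[S⁄k] this

end Kaehler

section Noether

variable {k S : Type*} [Field k] [CommRing S] [Algebra k S]

/-- The kernel of setting the first variable to zero lies strictly inside the ideal of the origin,
which contains the second variable. -/
lemma MvPolynomial.exists_isPrime_not_isMaximal {s : ℕ} (hs : 2 ≤ s) :
    ∃ P : Ideal (MvPolynomial (Fin s) k), P.IsPrime ∧ P ≠ ⊥ ∧ ¬ P.IsMaximal := by
  let i₀ : Fin s := ⟨0, by omega⟩
  let i₁ : Fin s := ⟨1, by omega⟩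
  let θ : MvPolynomial (Fin s) k →ₐ[k] MvPolynomial (Fin s) k :=
    MvPolynomial.aeval fun i ↦ if i = i₀ then 0 else MvPolynomial.X i
  have hX₁ : θ (MvPolynomial.X i₁) = MvPolynomial.X i₁ := by simp [θ, i₁, i₀]
  refine ⟨RingHom.ker θ, RingHom.ker_isPrime _, fun h ↦ ?_, fun h ↦ ?_⟩
  · have h0 : (MvPolynomial.X i₀ : MvPolynomial (Fin s) k) ∈ RingHom.ker θ := by
      simp [RingHom.mem_ker, θ]
    rw [h, Ideal.mem_bot] at h0
    exact MvPolynomial.X_ne_zero i₀ h0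
  · let ε : MvPolynomial (Fin s) k →ₐ[k] k := MvPolynomial.aeval 0
    have hε : ε.comp θ = ε := by
      ext i
      by_cases hi : i = i₀ <;> simp [ε, θ, hi]
    have hle : RingHom.ker θ ≤ RingHom.ker ε := fun x hx ↦ by
      rw [RingHom.mem_ker] at hx ⊢
      rw [← hε, AlgHom.comp_apply, hx, map_zero]
    have heq := h.eq_of_le (RingHom.ker_ne_top _) hle
    have h1 : (MvPolynomial.X i₁ : MvPolynomial (Fin s) k) ∈ RingHom.ker ε := by
      simp [RingHom.mem_ker, ε]
    rw [← heq, RingHom.mem_ker, hX₁] at h1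
    exact MvPolynomial.X_ne_zero i₁ h1

variable [Algebra.FiniteType k S] [IsDomain S]

/-- Noether normalization in dimension one. -/
theorem exists_finite_aeval [Ring.DimensionLEOne S] (hS : ¬ IsField S) :
    ∃ f : S, Function.Injective (aeval (R := k) f) ∧ (aeval (R := k) f).Finite := by
  obtain ⟨s, g, hinj, hfin⟩ := exists_finite_inj_algHom_of_fg k S
  -- With two variables, a nonzero prime that is not maximal would lie under a nonzero, hence
  -- maximal, prime of `S`; integrality forbids this.
  have hs : s < 2 := by
    by_contra hs
    obtain ⟨P, hP, hP0, hPm⟩ := MvPolynomial.exists_isPrime_not_isMaximal (k := k) (not_lt.1 hs)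
    algebraize [g.toRingHom]
    have hInt : Algebra.IsIntegral (MvPolynomial (Fin s) k) S := ⟨hfin.to_isIntegral⟩
    obtain ⟨Q, -, hQ, hQP⟩ := Ideal.exists_ideal_over_prime_of_isIntegral P (⊥ : Ideal S) (by
      intro x hx
      have : g x = 0 := hx
      rw [(map_eq_zero_iff g hinj).1 this]
      exact zero_mem _)
    have hQ0 : Q ≠ ⊥ := by
      rintro rfl
      refine hP0 (hQP.symm.trans ?_)
      rw [eq_bot_iff]
      intro x hx
      have : g x = 0 := hx
      rw [(map_eq_zero_iff g hinj).1 this]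
      exact zero_mem _
    have := hQ.isMaximal hQ0
    exact hPm (hQP ▸ Ideal.isMaximal_comap_of_isIntegral_of_isMaximal Q)
  have hs0 : s ≠ 0 := by
    rintro rfl
    refine hS ?_
    algebraize [g.toRingHom]
    have hInt : Algebra.IsIntegral (MvPolynomial (Fin 0) k) S := ⟨hfin.to_isIntegral⟩
    exact isField_of_isIntegral_of_isField'
      ((MvPolynomial.isEmptyAlgEquiv k (Fin 0)).toMulEquiv.isField (Field.toIsField k))
  obtain rfl : s = 1 := by omega
  let e : k[X] ≃ₐ[k] MvPolynomial (Fin 1) k := (MvPolynomial.uniqueAlgEquiv k (Fin 1)).symm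
  have hge : g.comp e.toAlgHom = aeval (g (e X)) := by
    ext
    simp
  refine ⟨g (e X), ?_, ?_⟩
  · rw [← hge]
    exact hinj.comp e.injective
  · rw [← hge]
    exact hfin.comp (RingHom.Finite.of_surjective _ e.surjective)

end Noether

end EllipticRelations

/-! ### Lifting points along algebraic extensions -/

namespace EllipticRelations

open Polynomial

section GenericallyFinite

variable {k R S : Type u} [Field k] [IsAlgClosed k] [CommRing R] [CommRing S] [Algebra k R]
  [Algebra k S] [Algebra R S] [IsScalarTower k R S] [IsDomain R] [IsDomain S]

/-- An extension of one-dimensional domains of finite type over a field is algebraic. -/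
theorem isAlgebraic_of_dimensionLEOne [Algebra.FiniteType k S] [Ring.DimensionLEOne S]
    (hR : ¬ IsField R) [FaithfulSMul R S] : Algebra.IsAlgebraic R S := by
  have hinj : Function.Injective (algebraMap R S) := FaithfulSMul.algebraMap_injective R S
  have hRt : ¬ Algebra.IsAlgebraic k R := fun h ↦ by
    have := Algebra.isAlgebraic_iff_isIntegral.1 h
    exact hR (isField_of_isIntegral_of_isField' (Field.toIsField k))
  have hS : ¬ IsField S := fun h ↦ by
    let _ := h.toField
    have : Module.Finite k S := finite_of_finite_type_of_isJacobsonRing k S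
    have : Algebra.IsIntegral k R := ⟨fun x ↦ (isIntegral_algebraMap_iff hinj).1
      (Algebra.IsIntegral.isIntegral (algebraMap R S x))⟩
    exact hR (isField_of_isIntegral_of_isField' (Field.toIsField k))
  obtain ⟨f, hfinj, hfin⟩ := exists_finite_aeval (k := k) hS
  have halg : Algebra.IsAlgebraic (Algebra.adjoin k {f}) S := by
    refine ⟨fun x ↦ IsIntegral.isAlgebraic ?_⟩
    obtain ⟨p, hp, hpx⟩ := hfin.to_isIntegral x
    let j : k[X] →+* Algebra.adjoin k {f} :=
      ((aeval f).codRestrict (Algebra.adjoin k {f})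
        fun q ↦ aeval_mem_adjoin_singleton k f).toRingHom
    refine ⟨p.map j, hp.map j, ?_⟩
    rw [eval₂_map]
    exact hpx
  have h1 : Algebra.trdeg k S ≤ 1 := by
    simpa using Algebra.IsAlgebraic.trdeg_le_cardinalMk k ({f} : Set S)
  -- Transcendence degrees add up: the total is at most `1`, and `R` over `k` already uses it.
  have h2 := trdeg_add_eq k R (A := S)
  have : FaithfulSMul k R := inferInstance
  have h3 : 1 ≤ Algebra.trdeg k R := by
    rw [Cardinal.one_le_iff_ne_zero, Ne, trdeg_eq_zero_iff]
    exact hRt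
  rw [← trdeg_eq_zero_iff]
  rw [← h2] at h1
  by_contra hne
  have h4 : 1 ≤ Algebra.trdeg R S := Cardinal.one_le_iff_ne_zero.2 hne
  have h5 : (2 : Cardinal) ≤ 1 := by
    calc (2 : Cardinal) = 1 + 1 := by norm_num
      _ ≤ _ := add_le_add h3 h4
      _ ≤ 1 := h1
  norm_num at h5

/-- For an algebraic extension `R ⊆ S` of domains and `φ : S`, over a dense open set of points the
roots of a polynomial over `R` are the values of `φ` at points of `S`. -/
theorem exists_polynomial_of_isAlgebraic [Algebra.FiniteType k S] [FaithfulSMul R S]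
    [IsIntegrallyClosed R] [Algebra.IsAlgebraic R S] (φ : S) :
    ∃ y : R, y ≠ 0 ∧ ∃ m : R[X], m.Monic ∧ m.natDegree ≠ 0 ∧ ∀ χ : R →ₐ[k] k, χ y ≠ 0 →
      ∀ c, (m.map χ.toRingHom).IsRoot (χ y * c) →
        ∃ χ' : S →ₐ[k] k, (∀ r, χ' (algebraMap R S r) = χ r) ∧ χ' φ = c := by
  classical
  have hinj : Function.Injective (algebraMap R S) := FaithfulSMul.algebraMap_injective R S
  obtain ⟨s, hs⟩ := Algebra.FiniteType.out (R := k) (A := S)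
  obtain ⟨y, hy0, hy⟩ := Algebra.IsAlgebraic.exists_integral_multiples R (insert φ s)
  have hφ : IsIntegral R (y • φ) := hy φ (by simp)
  -- Since `y` clears the denominators of the generators, `S` becomes integral over `R` once `y` is
  -- inverted.
  have hpow (z : S) : ∃ n : ℕ, IsIntegral R (y ^ n • z) := by
    have hz : z ∈ Algebra.adjoin k (s : Set S) := hs ▸ Algebra.mem_top
    have hyint (n : ℕ) : IsIntegral R (algebraMap R S (y ^ n)) := isIntegral_algebraMap
    induction hz using Algebra.adjoin_induction with
    | mem x hx => exact ⟨1, by simpa using hy x (by simp [Finset.mem_coe.1 hx])⟩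
    | algebraMap r =>
      refine ⟨0, ?_⟩
      rw [pow_zero, one_smul, IsScalarTower.algebraMap_apply k R S]
      exact isIntegral_algebraMap
    | add a b _ _ ha hb =>
      obtain ⟨n, hn⟩ := ha
      obtain ⟨l, hl⟩ := hb
      refine ⟨n + l, ?_⟩
      have : y ^ (n + l) • (a + b) = algebraMap R S (y ^ l) * (y ^ n • a) +
          algebraMap R S (y ^ n) * (y ^ l • b) := by
        simp only [Algebra.smul_def, pow_add, map_mul, map_pow]
        ring
      rw [this]
      exact ((hyint l).mul hn).add ((hyint n).mul hl)
    | mul a b _ _ ha hb =>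
      obtain ⟨n, hn⟩ := ha
      obtain ⟨l, hl⟩ := hb
      refine ⟨n + l, ?_⟩
      have : y ^ (n + l) • (a * b) = (y ^ n • a) * (y ^ l • b) := by
        simp only [Algebra.smul_def, pow_add, map_mul, map_pow]
        ring
      rw [this]
      exact hn.mul hl
  refine ⟨y, hy0, minpoly R (y • φ), minpoly.monic hφ, (minpoly.natDegree_pos hφ).ne', ?_⟩
  intro χ hχy c hc
  -- A maximal ideal containing `J` is the required point, so it remains to see that `J` is proper.
  let J : Ideal S := (RingHom.ker χ).map (algebraMap R S) ⊔ Ideal.span {φ - algebraMap k S c}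
  have hJ : J ≠ ⊤ := by
    intro htop
    let D := integralClosure R S
    let φ' : D := ⟨y • φ, hφ⟩
    let _ : Algebra R[X] D := (aeval φ').toAlgebra
    have htower : IsScalarTower R R[X] D := IsScalarTower.of_algebraMap_eq fun r ↦ by
      rw [RingHom.algebraMap_toAlgebra]
      exact (aeval_C φ' r).symm
    have hInt : Algebra.IsIntegral R[X] D := Algebra.IsIntegral.tower_top R
    let ε : R[X] →+* k := eval₂RingHom χ.toRingHom (χ y * c)
    have hmε (q : R[X]) (hq : aeval φ' q = 0) : ε q = 0 := by
      have h1 : aeval (y • φ) q = 0 := by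
        have := congrArg D.val hq
        rw [map_zero, ← aeval_algHom_apply] at this
        exact this
      obtain ⟨q', rfl⟩ := minpoly.isIntegrallyClosed_dvd hφ h1
      rw [map_mul]
      have : ε (minpoly R (y • φ)) = 0 := by
        rw [IsRoot.def, Polynomial.eval_map] at hc
        exact hc
      rw [this, zero_mul]
    have hε : (RingHom.ker ε).IsPrime := RingHom.ker_isPrime ε
    -- As `R` is integrally closed, any relation of `y • φ` over `R` is a multiple of its minimal
    -- polynomial, which `ε` kills. So the point `ε` of `R[X]` lifts to a prime of the integral
    -- closure.
    obtain ⟨Q, -, hQ, hQP⟩ := Ideal.exists_ideal_over_prime_of_isIntegral (RingHom.ker ε)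
      (⊥ : Ideal D) (fun q hq ↦ hmε q hq)
    have hQmem (q : R[X]) : aeval φ' q ∈ Q ↔ ε q = 0 := by
      rw [← RingHom.mem_ker (f := ε), ← hQP]
      rfl
    -- after multiplication by a power of `y`, every element of `J` is in `Q`
    have hJQ (z : S) (hz : z ∈ J) : ∃ n : ℕ, ∃ w ∈ Q, w.1 = y ^ n • z := by
      have hyQ (n : ℕ) {w : D} (hw : w ∈ Q) : algebraMap R D (y ^ n) * w ∈ Q :=
        Q.mul_mem_left _ hw
      have hadd {a b : S} (ha : ∃ n : ℕ, ∃ w ∈ Q, w.1 = y ^ n • a)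
          (hb : ∃ n : ℕ, ∃ w ∈ Q, w.1 = y ^ n • b) : ∃ n : ℕ, ∃ w ∈ Q, w.1 = y ^ n • (a + b) := by
        obtain ⟨n, w, hw, hwa⟩ := ha
        obtain ⟨l, w', hw', hwb⟩ := hb
        refine ⟨n + l, _, add_mem (hyQ l hw) (hyQ n hw'), ?_⟩
        change algebraMap R S (y ^ l) * w.1 + algebraMap R S (y ^ n) * w'.1 = _
        rw [hwa, hwb]
        simp only [Algebra.smul_def, pow_add, map_mul, map_pow]
        ring
      have hmul {a : S} (b : S) (ha : ∃ n : ℕ, ∃ w ∈ Q, w.1 = y ^ n • a) :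
          ∃ n : ℕ, ∃ w ∈ Q, w.1 = y ^ n • (b * a) := by
        obtain ⟨n, w, hw, hwa⟩ := ha
        obtain ⟨l, hl⟩ := hpow b
        refine ⟨l + n, _, Q.mul_mem_left ⟨_, hl⟩ hw, ?_⟩
        change y ^ l • b * w.1 = _
        rw [hwa]
        simp only [Algebra.smul_def, pow_add, map_mul, map_pow]
        ring
      obtain ⟨a, ha, b, hb, rfl⟩ := Submodule.mem_sup.1 hz
      clear hz
      refine hadd ?_ ?_
      · induction ha using Submodule.span_induction with
        | mem x hx =>
          obtain ⟨r, hr, rfl⟩ := hx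
          refine ⟨0, algebraMap R D r, ?_, by simp⟩
          have := (hQmem (C r)).2 (by simpa [ε] using hr)
          rwa [aeval_C] at this
        | zero => exact ⟨0, 0, zero_mem _, by simp⟩
        | add a b _ _ ha hb => exact hadd ha hb
        | smul c a _ ha => exact hmul c ha
      · obtain ⟨b, rfl⟩ := Ideal.mem_span_singleton'.1 hb
        refine hmul b ⟨1, φ' - algebraMap R D (y * algebraMap k R c), ?_, ?_⟩
        · have := (hQmem (X - C (y * algebraMap k R c))).2 (by simp [ε])
          rwa [map_sub, aeval_X, aeval_C] at this
        · change y • φ - algebraMap R S (y * algebraMap k R c) = _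
          rw [pow_one, smul_sub, IsScalarTower.algebraMap_apply k R S c, map_mul,
            Algebra.smul_def y (algebraMap R S _)]
    -- If `J` contained `1`, some power of `y` would lie in `Q`, against `χ y ≠ 0`.
    obtain ⟨n, w, hw, hw1⟩ := hJQ 1 (htop ▸ Submodule.mem_top)
    have hwy : w = aeval φ' (C (y ^ n)) := by
      rw [aeval_C]
      apply Subtype.ext
      rw [hw1, Algebra.smul_def, _root_.mul_one]
      rfl
    rw [hwy, hQmem] at hw
    rw [show ε (C (y ^ n)) = χ (y ^ n) from eval₂_C _ _, map_pow] at hw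
    exact hχy (eq_zero_of_pow_eq_zero hw)
  obtain ⟨n, hn, hJn⟩ := J.exists_le_maximal hJ
  obtain ⟨χ', hχ'⟩ := exists_algHom_ker_eq (k := k) n
  refine ⟨χ', fun r ↦ ?_, ?_⟩
  · have h1 : r - algebraMap k R (χ r) ∈ RingHom.ker χ := by simp [RingHom.mem_ker]
    have h2 : algebraMap R S (r - algebraMap k R (χ r)) ∈ RingHom.ker χ' :=
      hχ' ▸ hJn (Submodule.mem_sup_left (Ideal.mem_map_of_mem _ h1))
    rw [RingHom.mem_ker, map_sub, map_sub, ← IsScalarTower.algebraMap_apply k R S,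
      AlgHom.commutes, sub_eq_zero] at h2
    exact h2
  · have h2 : φ - algebraMap k S c ∈ RingHom.ker χ' :=
      hχ' ▸ hJn (Submodule.mem_sup_right (Ideal.mem_span_singleton_self _))
    rw [RingHom.mem_ker, map_sub, AlgHom.commutes, sub_eq_zero] at h2
    exact h2

end GenericallyFinite

end EllipticRelations

/-! ### Values of fractions at points of a Dedekind domain -/

namespace EllipticRelations

section LocalValue

variable {k R K : Type u} [Field k] [CommRing R] [Field K] [Algebra k R]
  [Algebra R K]

/-- The fraction `f` is defined at the point `χ` of `R`, with value `c`. -/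
def LocalVal (χ : R →ₐ[k] k) (f : K) (c : k) : Prop :=
  ∃ a b : R, χ b ≠ 0 ∧ f * algebraMap R K b = algebraMap R K a ∧ c * χ b = χ a

variable {χ : R →ₐ[k] k}

/-- A fraction defined at every point of `R` is in `R`. -/
lemma exists_algebraMap_eq_of_localVal [IsAlgClosed k] [Algebra.FiniteType k R] {f : K}
    (h : ∀ χ : R →ₐ[k] k, ∃ c, LocalVal χ f c) : ∃ r, algebraMap R K r = f := by
  -- The ideal of denominators of `f`: regularity at every point keeps it out of every maximal
  -- ideal.
  let I : Ideal R :=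
    { carrier := {b | ∃ a, f * algebraMap R K b = algebraMap R K a}
      add_mem' := by
        rintro b b' ⟨a, ha⟩ ⟨a', ha'⟩
        exact ⟨a + a', by rw [map_add, map_add, mul_add, ha, ha']⟩
      zero_mem' := ⟨0, by simp⟩
      smul_mem' := by
        rintro r b ⟨a, ha⟩
        refine ⟨r * a, ?_⟩
        rw [smul_eq_mul, map_mul, map_mul, ← ha]
        ring }
  have hI : I = ⊤ := by
    by_contra hne
    obtain ⟨m, hm, hIm⟩ := I.exists_le_maximal hne
    obtain ⟨χ, hχ⟩ := exists_algHom_ker_eq (k := k) m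
    obtain ⟨c, a, b, hb, hf, -⟩ := h χ
    exact hb (by rw [← RingHom.mem_ker, hχ]; exact hIm ⟨a, hf⟩)
  obtain ⟨a, ha⟩ : (1 : R) ∈ I := hI ▸ Submodule.mem_top
  exact ⟨a, by rw [← ha, map_one, _root_.mul_one]⟩

namespace LocalVal

lemma of (r : R) : LocalVal χ (algebraMap R K r) (χ r) := ⟨r, 1, by simp, by simp, by simp⟩

lemma add {f g : K} {c d : k} (h : LocalVal χ f c) (h' : LocalVal χ g d) :
    LocalVal χ (f + g) (c + d) := by
  obtain ⟨a, b, hb, hf, hc⟩ := h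
  obtain ⟨a', b', hb', hf', hd⟩ := h'
  refine ⟨a * b' + a' * b, b * b', by simp [hb, hb'], ?_, ?_⟩
  · simp only [map_mul, map_add, ← hf, ← hf']; ring
  · simp only [map_mul, map_add, ← hc, ← hd]; ring

lemma mul {f g : K} {c d : k} (h : LocalVal χ f c) (h' : LocalVal χ g d) :
    LocalVal χ (f * g) (c * d) := by
  obtain ⟨a, b, hb, hf, hc⟩ := h
  obtain ⟨a', b', hb', hf', hd⟩ := h'
  refine ⟨a * a', b * b', by simp [hb, hb'], ?_, ?_⟩
  · simp only [map_mul, ← hf, ← hf']; ring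
  · simp only [map_mul, ← hc, ← hd]; ring

section Const

variable [Algebra k K] [IsScalarTower k R K]

lemma const (c : k) : LocalVal χ (algebraMap k K c) c := by
  simpa [← IsScalarTower.algebraMap_apply k R K] using of (K := K) (χ := χ) (algebraMap k R c)

lemma pow {f : K} {c : k} (h : LocalVal χ f c) (n : ℕ) : LocalVal χ (f ^ n) (c ^ n) := by
  induction n with
  | zero => simpa using const (χ := χ) (K := K) 1
  | succ n ih => rw [pow_succ, pow_succ]; exact ih.mul h

end Const

variable [IsFractionRing R K]

lemma unique {f : K} {c d : k} (h : LocalVal χ f c) (h' : LocalVal χ f d) : c = d := by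
  obtain ⟨a, b, hb, hf, hc⟩ := h
  obtain ⟨a', b', hb', hf', hd⟩ := h'
  have h1 : a * b' = a' * b := IsFractionRing.injective R K (by
    rw [map_mul, map_mul, ← hf, ← hf']; ring)
  have h2 := congrArg χ h1
  rw [map_mul, map_mul, ← hc, ← hd] at h2
  exact mul_right_cancel₀ (mul_ne_zero hb hb') (by linear_combination h2)

variable [Algebra k K] [IsScalarTower k R K]

lemma ne_zero {f : K} {c : k} (h : LocalVal χ f c) (hc : c ≠ 0) : f ≠ 0 := by
  rintro rfl
  exact hc (h.unique (by simpa using const (χ := χ) (K := K) 0))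

lemma inv {f : K} {c : k} (h : LocalVal χ f c) (hc0 : c ≠ 0) : LocalVal χ f⁻¹ c⁻¹ := by
  have hf0 := h.ne_zero hc0
  obtain ⟨a, b, hb, hf, hc⟩ := h
  refine ⟨b, a, by rw [← hc]; exact mul_ne_zero hc0 hb, ?_, ?_⟩
  · rw [← hf, inv_mul_cancel_left₀ hf0]
  · rw [← hc, inv_mul_cancel_left₀ hc0]

end LocalVal

section Dedekind

variable [IsFractionRing R K] [IsDedekindDomain R] (χ)

/-- Around a point of a Dedekind domain every element is a power of a uniformizer up to units. -/
lemma exists_uniformizer_algHom (hR : ¬ IsField R) : ∃ t : R, t ≠ 0 ∧ χ t = 0 ∧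
    ∀ y ≠ 0, ∃ (n : ℕ) (s r : R), χ s ≠ 0 ∧ χ r ≠ 0 ∧ y * s = t ^ n * r := by
  have hmax := isMaximal_ker χ
  let m : Ideal R := RingHom.ker χ
  have hm : m.IsPrime := hmax.isPrime
  have hm0 : m ≠ ⊥ := Ring.ne_bot_of_isMaximal_of_not_isField hmax hR
  let L := Localization.AtPrime m
  have hdvr : IsDiscreteValuationRing L :=
    IsLocalization.AtPrime.isDiscreteValuationRing_of_dedekind_domain R hm0 L
  have hinj : Function.Injective (algebraMap R L) :=
    IsLocalization.injective L m.primeCompl_le_nonZeroDivisors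
  have hunit (s : m.primeCompl) : IsUnit (algebraMap R L s) := IsLocalization.map_units L s
  have hmem (x : R) : χ x ≠ 0 ↔ x ∈ m.primeCompl := Iff.rfl
  obtain ⟨ϖ, hϖ⟩ := IsDiscreteValuationRing.exists_irreducible L
  obtain ⟨⟨t, s₀⟩, ht⟩ := IsLocalization.surj m.primeCompl ϖ
  have hirr : Irreducible (algebraMap R L t) := by
    rw [← ht]
    exact (irreducible_mul_isUnit (hunit s₀)).2 hϖ
  refine ⟨t, fun h ↦ hirr.ne_zero (by simp [h]), ?_, fun y hy ↦ ?_⟩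
  · by_contra h
    exact hirr.not_isUnit (hunit ⟨t, (hmem t).1 h⟩)
  · obtain ⟨n, w, hw⟩ := IsDiscreteValuationRing.associated_pow_irreducible
      (x := algebraMap R L y) (fun h ↦ hy (hinj (by rw [h, map_zero]))) hirr
    obtain ⟨⟨s, r⟩, hs⟩ := IsLocalization.surj m.primeCompl (w : L)
    refine ⟨n, s, r, ?_, (hmem _).2 r.2, hinj ?_⟩
    · intro h
      have h1 : IsUnit (algebraMap R L s) := by
        rw [← hs]
        exact w.isUnit.mul (hunit r)
      rw [IsLocalization.AtPrime.isUnit_to_map_iff L m] at h1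
      exact h1 h
    · simp only at hs
      rw [map_mul, map_mul, map_pow, ← hw, ← hs]
      ring

/-- There is a fraction with a simple pole at a given point of `R` and no other pole. -/
lemma exists_simple_pole (hR : ¬ IsField R) [IsAlgClosed k] [Algebra.FiniteType k R] :
    ∃ e : K, (∀ c, ¬ LocalVal χ e c) ∧ (∀ t, LocalVal χ t 0 → ∃ c, LocalVal χ (t * e) c) ∧
      ∀ χ' : R →ₐ[k] k, χ' ≠ χ → ∃ c, LocalVal χ' e c := by
  have hmax := isMaximal_ker χ
  let m : Ideal R := RingHom.ker χ
  have hm0 : m ≠ ⊥ := Ring.ne_bot_of_isMaximal_of_not_isField hmax hR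
  -- An element of the inverse of `m` outside `R`. Every element of `m` is a denominator of `e`, so
  -- `e` is regular away from `χ`; regularity at `χ` as well would put it in `R`.
  obtain ⟨e, he, he1⟩ := FractionalIdeal.exists_notMem_one_of_ne_bot (K := K) hm0 hmax.ne_top
  have hem (a : R) (ha : a ∈ m) : ∃ b, e * algebraMap R K a = algebraMap R K b := by
    rw [FractionalIdeal.mem_inv_iff (FractionalIdeal.coeIdeal_ne_zero.2 hm0)] at he
    obtain ⟨b, hb⟩ := (FractionalIdeal.mem_one_iff _).1
      (he _ (FractionalIdeal.mem_coeIdeal_of_mem _ ha))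
    exact ⟨b, hb.symm⟩
  have h3 (χ' : R →ₐ[k] k) (hχ' : χ' ≠ χ) : ∃ c, LocalVal χ' e c := by
    obtain ⟨a, ha, ha'⟩ : ∃ a ∈ m, χ' a ≠ 0 := by
      by_contra! h
      exact hχ' (algHom_eq_of_ker_le fun a ha ↦ h a ha).symm
    obtain ⟨b, hb⟩ := hem a ha
    exact ⟨χ' b / χ' a, b, a, ha', hb, by field_simp⟩
  refine ⟨e, fun c hc ↦ he1 ?_, ?_, h3⟩
  · obtain ⟨r, hr⟩ := exists_algebraMap_eq_of_localVal (k := k) (R := R) (f := e) fun χ' ↦ by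
      by_cases h : χ' = χ
      · exact ⟨c, h ▸ hc⟩
      · exact h3 χ' h
    exact (FractionalIdeal.mem_one_iff _).2 ⟨r, hr⟩
  · rintro t ⟨a, b, hb, ht, h0⟩
    rw [zero_mul] at h0
    obtain ⟨a', ha'⟩ := hem a h0.symm
    refine ⟨χ a' / χ b, a', b, hb, ?_, by field_simp⟩
    rw [← ha', ← ht]
    ring

variable [Algebra k K] [IsScalarTower k R K]

variable (K)

/-- Around a point of a Dedekind domain every nonzero fraction is a power of a uniformizer up to
units. -/
lemma exists_uniformizer_localVal (hR : ¬ IsField R) : ∃ t : K, t ≠ 0 ∧ LocalVal χ t 0 ∧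
    ∀ f ≠ 0, ∃ (n : ℤ) (w : K) (d : k), d ≠ 0 ∧ LocalVal χ w d ∧ f = t ^ n * w := by
  obtain ⟨t, ht0, ht, h⟩ := exists_uniformizer_algHom χ hR
  have hinj := IsFractionRing.injective R K
  have hne (r : R) (hr : r ≠ 0) : algebraMap R K r ≠ 0 := fun h ↦ hr (hinj (by rw [h, map_zero]))
  refine ⟨algebraMap R K t, hne t ht0, by simpa [ht] using LocalVal.of (K := K) (χ := χ) t, ?_⟩
  have key (y : R) (hy : y ≠ 0) : ∃ (n : ℕ) (w : K) (d : k), d ≠ 0 ∧ LocalVal χ w d ∧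
      algebraMap R K y = algebraMap R K t ^ n * w := by
    obtain ⟨n, s, r, hs, hr, e⟩ := h y hy
    refine ⟨n, algebraMap R K r * (algebraMap R K s)⁻¹, χ r * (χ s)⁻¹, by simp [hs, hr],
      (LocalVal.of r).mul ((LocalVal.of s).inv hs), ?_⟩
    have hs0 : algebraMap R K s ≠ 0 := (LocalVal.of s).ne_zero hs
    have := congrArg (algebraMap R K) e
    rw [map_mul, map_mul, map_pow] at this
    rw [← _root_.mul_assoc, ← this, mul_inv_cancel_right₀ hs0]
  intro f hf
  obtain ⟨a, b, hb, rfl⟩ := IsFractionRing.div_surjective (A := R) f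
  have hb0 : b ≠ 0 := nonZeroDivisors.ne_zero hb
  have ha0 : a ≠ 0 := by rintro rfl; simp at hf
  obtain ⟨n, w, d, hd, hw, ea⟩ := key a ha0
  obtain ⟨n', w', d', hd', hw', eb⟩ := key b hb0
  refine ⟨n - n', w * w'⁻¹, d * d'⁻¹, by simp [hd, hd'], hw.mul (hw'.inv hd'), ?_⟩
  have := hne t ht0
  have := hw'.ne_zero hd'
  rw [ea, eb, zpow_sub₀ (hne t ht0), zpow_natCast, zpow_natCast]
  field_simp

variable {K}

lemma localVal_or (hR : ¬ IsField R) (f : K) : (∃ c, LocalVal χ f c) ∨ LocalVal χ f⁻¹ 0 := by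
  obtain ⟨t, ht0, ht, h⟩ := exists_uniformizer_localVal K χ hR
  by_cases hf : f = 0
  · exact .inl ⟨0, by simpa [hf] using LocalVal.const (χ := χ) (K := K) 0⟩
  obtain ⟨n, w, d, hd, hw, rfl⟩ := h f hf
  obtain ⟨l, rfl | rfl⟩ := n.eq_nat_or_neg
  · exact .inl ⟨0 ^ l * d, by simpa using (ht.pow l).mul hw⟩
  · rcases Nat.eq_zero_or_pos l with rfl | hl
    · exact .inl ⟨d, by simpa using hw⟩
    · right
      simpa [hl.ne', mul_comm] using (ht.pow l).mul (hw.inv hd)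

/-- A nonzero fraction vanishing at a point is divisible by the uniformizer. -/
lemma exists_uniformizer_div (hR : ¬ IsField R) : ∃ t : K, t ≠ 0 ∧ LocalVal χ t 0 ∧
    ∀ f, LocalVal χ f 0 → ∃ c, LocalVal χ (f / t) c := by
  obtain ⟨t, ht0, ht, h⟩ := exists_uniformizer_localVal K χ hR
  refine ⟨t, ht0, ht, fun f hf ↦ ?_⟩
  by_cases hf0 : f = 0
  · exact ⟨0, by simpa [hf0] using LocalVal.const (χ := χ) (K := K) 0⟩
  obtain ⟨n, w, d, hd, hw, rfl⟩ := h f hf0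
  obtain ⟨l, rfl | rfl⟩ := n.eq_nat_or_neg
  · rcases l with - | l
    · exact absurd (hf.unique (by simpa using hw)).symm hd
    · refine ⟨0 ^ l * d, ?_⟩
      convert (ht.pow l).mul hw using 1
      rw [zpow_natCast, pow_succ]
      field_simp
  · have h1 := hf.mul (ht.pow l)
    rw [zero_mul, zpow_neg, zpow_natCast, mul_right_comm, inv_mul_cancel₀ (pow_ne_zero _ ht0),
      _root_.one_mul] at h1
    exact absurd (hw.unique h1) hd

/-- A function vanishing at the point is divisible by a uniformizer, so its `l`-th power cancels a
pole of order `l`. -/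
lemma exists_pow_mul_localVal (hR : ¬ IsField R) {t : K} (ht : LocalVal χ t 0) (g : K) :
    ∃ n : ℕ, ∃ c, LocalVal χ (t ^ n * g) c := by
  obtain ⟨ϖ, hϖ0, hϖ, h⟩ := exists_uniformizer_localVal K χ hR
  by_cases hg0 : g = 0
  · exact ⟨0, 0, by simpa [hg0] using LocalVal.const (χ := χ) (K := K) 0⟩
  by_cases ht0 : t = 0
  · exact ⟨1, 0, by simpa [ht0] using LocalVal.const (χ := χ) (K := K) 0⟩
  obtain ⟨n, w, d, hd, hw, rfl⟩ := h g hg0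
  obtain ⟨l, rfl | rfl⟩ := n.eq_nat_or_neg
  · exact ⟨0, 0 ^ l * d, by simpa using (hϖ.pow l).mul hw⟩
  -- The two uniformizers come from separate existence statements. It is enough that `ϖ'` is a
  -- positive power of `ϖ` up to a unit, which holds because it vanishes.
  obtain ⟨ϖ', hϖ'0, hϖ', h'⟩ := exists_uniformizer_div (K := K) χ hR
  refine ⟨l, ?_⟩
  obtain ⟨c', hc'⟩ := h' t ht
  obtain ⟨n', w', d', hd', hw', e⟩ := h ϖ' hϖ'0
  obtain ⟨j, rfl | rfl⟩ := n'.eq_nat_or_neg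
  · rcases j with - | j
    · exact absurd (hϖ'.unique (by simpa [e] using hw')).symm hd'
    · refine ⟨(c' * 0 ^ j * d') ^ l * d, ?_⟩
      convert (((hc'.mul (hϖ.pow j)).mul hw').pow l).mul hw using 1
      have h1 : t = t / ϖ' * ϖ' := by field_simp
      nth_rewrite 1 [h1]
      nth_rewrite 2 [e]
      rw [zpow_neg, zpow_natCast, zpow_natCast, pow_succ]
      simp only [mul_pow]
      have : ϖ ^ l ≠ 0 := pow_ne_zero _ hϖ0
      field_simp
  · have h1 := hϖ'.mul (hϖ.pow j)
    rw [e, zero_mul, zpow_neg, zpow_natCast, mul_right_comm,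
      inv_mul_cancel₀ (pow_ne_zero _ hϖ0), _root_.one_mul] at h1
    exact absurd (hw'.unique h1) hd'

end Dedekind

end LocalValue

end EllipticRelations

/-! ### Properness, and sections as `k`-algebras -/

namespace EllipticRelations

section Curve

attribute [local instance] MvPolynomial.gradedAlgebra

/-- `Proj` is proper over the spectrum of the degree-zero part, and here that part consists of the
constants. -/
instance isProper_projectiveSpaceToSpec (k : Type u) [Field k] (n : ℕ) :
    IsProper (projectiveSpaceToSpec k n) := by
  let 𝒜 := MvPolynomial.homogeneousSubmodule (Fin (n + 1)) k
  have hb : Function.Bijective (algebraMap k (𝒜 0)) := by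
    refine ⟨fun a b h ↦ MvPolynomial.C_injective _ _ (congrArg Subtype.val h), fun x ↦ ?_⟩
    have hx : (x : MvPolynomial (Fin (n + 1)) k).IsHomogeneous 0 := x.2
    rw [← MvPolynomial.totalDegree_zero_iff_isHomogeneous] at hx
    exact ⟨_, Subtype.ext (MvPolynomial.totalDegree_eq_zero_iff_eq_C.1 hx).symm⟩
  have : Algebra.FiniteType (𝒜 0) (MvPolynomial (Fin (n + 1)) k) :=
    have : IsScalarTower k (𝒜 0) (MvPolynomial (Fin (n + 1)) k) :=
      IsScalarTower.of_algebraMap_eq (R := k) (S := 𝒜 0) fun _ ↦ rfl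
    .of_restrictScalars_finiteType k (𝒜 0) _
  have : IsIso (Spec.map (CommRingCat.ofHom (algebraMap k (𝒜 0)))) := by
    have : IsIso (CommRingCat.ofHom (algebraMap k (𝒜 0))) :=
      (ConcreteCategory.isIso_iff_bijective _).2 hb
    infer_instance
  exact MorphismProperty.comp_mem @IsProper _ _
    (inferInstanceAs (IsProper (Proj.toSpecZero 𝒜))) inferInstance

variable {k : Type u} [Field k]

lemma IsProjective.isProper {X : Over (Spec (.of k))} (h : IsProjective X) : IsProper X.hom := by
  obtain ⟨n, i, hi, e⟩ := h
  rw [← e]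
  infer_instance

variable (X : Over (Spec (.of k))) [IsSmoothProjectiveCurve X]

instance : IsIntegral X.left := IsSmoothProjectiveCurve.isIntegral
instance : SmoothOfRelativeDimension 1 X.hom := IsSmoothProjectiveCurve.smooth
instance : IsProper X.hom := IsSmoothProjectiveCurve.isProjective.isProper
instance : JacobsonSpace X.left := LocallyOfFiniteType.jacobsonSpace X.hom
instance : IsLocallyNoetherian X.left := LocallyOfFiniteType.isLocallyNoetherian X.hom
instance : CompactSpace X.left :=
  (quasiCompact_iff_compactSpace X.hom).1 inferInstance
instance : IsNoetherian X.left where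

end Curve

section Sections

lemma id_appLE {Y : Scheme.{u}} (V : Y.Opens) (e : V ≤ (𝟙 Y : Y ⟶ Y) ⁻¹ᵁ V) :
    Scheme.Hom.appLE (𝟙 Y) V V e = 𝟙 _ := by
  rw [Scheme.Hom.appLE, Scheme.Hom.id_app]
  exact (Category.id_comp _).trans (CategoryTheory.Functor.map_id _ _)

variable {k : Type u} [Field k] {X : Over (Spec (.of k))}

/-- The `k`-algebra structure on the sections of a `k`-scheme. -/
noncomputable instance algebraSections (V : X.left.Opens) : Algebra k Γ(X.left, V) :=
  ((X.hom.appLE ⊤ V (le_of_le_of_eq le_top (Scheme.Hom.preimage_top X.hom).symm)).hom.comp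
    (Scheme.ΓSpecIso (.of k)).inv.hom).toAlgebra

lemma algebraMap_sections (V : X.left.Opens) (c : k) : algebraMap k Γ(X.left, V) c = constFun V c :=
  rfl

lemma map_constFun {V W : X.left.Opens} (i : W ≤ V) (c : k) :
    X.left.presheaf.map (homOfLE i).op (constFun V c) = constFun W c := by
  simp only [constFun, ← ConcreteCategory.comp_apply, Category.assoc, Scheme.Hom.appLE_map]

/-- Restriction of sections, as a `k`-algebra homomorphism. -/
noncomputable def resHom {V W : X.left.Opens} (i : W ≤ V) : Γ(X.left, V) →ₐ[k] Γ(X.left, W) where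
  __ := (X.left.presheaf.map (homOfLE i).op).hom
  commutes' c := map_constFun i c

/-- Pullback of sections along a morphism of `k`-schemes, as a `k`-algebra homomorphism. -/
noncomputable def pullHom {Y : Over (Spec (.of k))} (g : X ⟶ Y) {V : Y.left.Opens}
    {W : X.left.Opens} (i : W ≤ g.left ⁻¹ᵁ V) : Γ(Y.left, V) →ₐ[k] Γ(X.left, W) where
  __ := (g.left.appLE V W i).hom
  commutes' c := by
    change g.left.appLE V W i (constFun V c) = constFun W c
    simp only [constFun, ← ConcreteCategory.comp_apply, Category.assoc, Scheme.Hom.appLE_comp_appLE,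
      Over.w g]

/-- Evaluation of sections at a rational point. -/
noncomputable def evalHom {V : X.left.Opens} (P : RatPointIn X V) : Γ(X.left, V) →ₐ[k] k where
  __ := (Scheme.ΓSpecIso (.of k)).hom.hom.comp (P.1.left.appLE V ⊤ P.2).hom
  commutes' c := by
    change (Scheme.ΓSpecIso (.of k)).hom (P.1.left.appLE V ⊤ P.2 (constFun V c)) = c
    have h : P.1.left ≫ X.hom = 𝟙 _ := Over.w P.1
    -- A variable `q` allows substitution, since the inclusion proof inside `appLE` depends on the
    -- morphism.
    have key (q : Spec (.of k) ⟶ Spec (.of k)) (hq : q = 𝟙 _) (e) :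
        (Scheme.ΓSpecIso (.of k)).inv ≫ q.appLE ⊤ ⊤ e ≫ (Scheme.ΓSpecIso (.of k)).hom = 𝟙 _ := by
      subst hq
      rw [id_appLE, Category.id_comp, Iso.inv_hom_id]
    simp only [constFun, ← ConcreteCategory.comp_apply, Category.assoc,
      Scheme.Hom.appLE_comp_appLE_assoc]
    exact ConcreteCategory.congr_hom (key _ h _) c

lemma evalHom_apply {V : X.left.Opens} (P : RatPointIn X V) (s : Γ(X.left, V)) :
    evalHom P s = value s P := rfl

end Sections

end EllipticRelations

/-! ### Rational points and affine opens -/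

namespace EllipticRelations

section Points

variable {k : Type u} [Field k] {X : Over (Spec (.of k))} {V : X.left.Opens}

lemma specMap_fromSpec_comp_hom (hV : IsAffineOpen V) {B : CommRingCat.{u}}
    (χ : Γ(X.left, V) ⟶ B) : (Spec.map χ ≫ hV.fromSpec) ≫ X.hom =
      Spec.map (CommRingCat.ofHom (χ.hom.comp (algebraMap k Γ(X.left, V)))) := by
  have h := IsAffineOpen.SpecMap_appLE_fromSpec X.hom (isAffineOpen_top (Spec (.of k))) hV
    (le_of_le_of_eq le_top (Scheme.Hom.preimage_top X.hom).symm)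
  rw [Category.assoc, ← h, IsAffineOpen.fromSpec_top, Scheme.isoSpec_Spec_inv, ← Spec.map_comp,
    ← Spec.map_comp]
  rfl

lemma eq_specMap_fromSpec (hV : IsAffineOpen V) {B : CommRingCat.{u}} (g : Spec B ⟶ X.left)
    (hg : ⊤ ≤ g ⁻¹ᵁ V) :
    g = Spec.map (g.appLE V ⊤ hg ≫ (Scheme.ΓSpecIso B).hom) ≫ hV.fromSpec := by
  have h := IsAffineOpen.SpecMap_appLE_fromSpec g hV (isAffineOpen_top (Spec B)) hg
  rw [Spec.map_comp, Category.assoc, h, IsAffineOpen.fromSpec_top, Scheme.isoSpec_Spec_inv,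
    ← Category.assoc, ← Spec.map_comp, Iso.inv_hom_id, Spec.map_id, Category.id_comp]

lemma top_le_specMap_fromSpec (hV : IsAffineOpen V) {B : CommRingCat.{u}}
    (χ : Γ(X.left, V) ⟶ B) : ⊤ ≤ (Spec.map χ ≫ hV.fromSpec) ⁻¹ᵁ V := by
  rw [Scheme.Hom.comp_preimage, hV.fromSpec_preimage_self]
  exact le_rfl

lemma specMap_fromSpec_appLE (hV : IsAffineOpen V) {B : CommRingCat.{u}} (χ : Γ(X.left, V) ⟶ B)
    (hle : ⊤ ≤ (Spec.map χ ≫ hV.fromSpec) ⁻¹ᵁ V) :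
    (Spec.map χ ≫ hV.fromSpec).appLE V ⊤ hle ≫ (Scheme.ΓSpecIso B).hom = χ := by
  have h := eq_specMap_fromSpec hV _ hle
  rw [cancel_mono] at h
  exact (Spec.map_injective h).symm

/-- The rational point of an affine open set given by a homomorphism to `k`. -/
noncomputable def pointOfHom (hV : IsAffineOpen V) (χ : Γ(X.left, V) →ₐ[k] k) : RatPointIn X V :=
  ⟨Over.homMk (Spec.map (CommRingCat.ofHom χ.toRingHom) ≫ hV.fromSpec) (by
    refine (specMap_fromSpec_comp_hom hV _).trans ?_
    have h : (CommRingCat.ofHom χ.toRingHom).hom.comp (algebraMap k Γ(X.left, V)) = RingHom.id k :=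
      χ.comp_algebraMap
    rw [h]
    exact Spec.map_id _), top_le_specMap_fromSpec hV _⟩

lemma evalHom_pointOfHom (hV : IsAffineOpen V) (χ : Γ(X.left, V) →ₐ[k] k) :
    evalHom (pointOfHom hV χ) = χ := by
  ext s
  exact ConcreteCategory.congr_hom
    (specMap_fromSpec_appLE hV (CommRingCat.ofHom χ.toRingHom) _) s

lemma ratPoint_ext_of_evalHom (hV : IsAffineOpen V) {P Q : RatPointIn X V}
    (h : evalHom P = evalHom Q) : P = Q := by
  apply Subtype.ext
  apply Over.OverMorphism.ext
  rw [eq_specMap_fromSpec hV P.1.left P.2, eq_specMap_fromSpec hV Q.1.left Q.2]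
  congr 2
  ext s
  exact DFunLike.congr_fun h s

/-- The closed point of a scheme underlying a rational point. -/
noncomputable def pt (P : RatPoint X) : X.left := P.left (IsLocalRing.closedPoint k)

lemma top_le_preimage_iff {P : RatPoint X} : ⊤ ≤ P.left ⁻¹ᵁ V ↔ pt P ∈ V := by
  constructor
  · intro h
    exact h (x := IsLocalRing.closedPoint k) trivial
  · intro h x _
    have : x = IsLocalRing.closedPoint k := Subsingleton.elim (α := PrimeSpectrum k) _ _
    rw [this]
    exact h

lemma value_res {W : X.left.Opens} (i : W ≤ V) (s : Γ(X.left, V)) (P : RatPointIn X W) :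
    value (resHom i s) P = value s ⟨P.1, P.2.trans (Scheme.Hom.preimage_mono _ i)⟩ := by
  change (Scheme.ΓSpecIso (.of k)).hom (P.1.left.appLE W ⊤ P.2
    (X.left.presheaf.map (homOfLE i).op s)) = _
  exact congrArg (Scheme.ΓSpecIso (.of k)).hom
    (ConcreteCategory.congr_hom (Scheme.Hom.map_appLE P.1.left P.2 (homOfLE i).op) s)

lemma value_ne_zero_iff (s : Γ(X.left, V)) (P : RatPointIn X V) :
    value s P ≠ 0 ↔ pt P.1 ∈ X.left.basicOpen s := by
  have h1 : (Spec (.of k)).basicOpen (P.1.left.appLE V ⊤ P.2 s) =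
      P.1.left ⁻¹ᵁ X.left.basicOpen s := by
    exact (Scheme.basicOpen_appLE _ _ _ _ _).trans (inf_eq_right.2 le_top)
  rw [← top_le_preimage_iff, ← h1, top_le_iff]
  constructor
  · intro h
    apply Scheme.basicOpen_of_isUnit
    exact (MulEquiv.isUnit_map (Scheme.ΓSpecIso (.of k)).commRingCatIsoToRingEquiv).1
      (isUnit_iff_ne_zero.2 h)
  · intro h h0
    have h2 : P.1.left.appLE V ⊤ P.2 s = 0 :=
      (Scheme.ΓSpecIso (.of k)).commRingCatIsoToRingEquiv.injective (h0.trans (map_zero _).symm)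
    rw [h2, Scheme.basicOpen_zero] at h
    exact (h.ge (x := IsLocalRing.closedPoint k) trivial)

lemma value_pull {Y : Over (Spec (.of k))} (g : X ⟶ Y) {W : Y.left.Opens}
    (i : V ≤ g.left ⁻¹ᵁ W) (s : Γ(Y.left, W)) (P : RatPointIn X V) (hP : ⊤ ≤ (P.1 ≫ g).left ⁻¹ᵁ W) :
    value (pullHom g i s) P = value s ⟨P.1 ≫ g, hP⟩ := by
  change (Scheme.ΓSpecIso (.of k)).hom (P.1.left.appLE V ⊤ P.2 (g.left.appLE W V i s)) = _
  exact congrArg (Scheme.ΓSpecIso (.of k)).hom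
    (ConcreteCategory.congr_hom (Scheme.Hom.appLE_comp_appLE P.1.left g.left W V ⊤ i P.2) s)

variable [IsAlgClosed k] [LocallyOfFiniteType X.hom]

lemma isClosed_pt (P : RatPoint X) : IsClosed {pt P} :=
  (pointEquivClosedPoint X.hom ⟨P.left, Over.w P⟩).2

lemma exists_pt_eq {x : X.left} (hx : IsClosed {x}) : ∃ P : RatPoint X, pt P = x :=
  ⟨Over.homMk (pointOfClosedPoint X.hom x hx) (pointOfClosedPoint_comp X.hom x hx),
    pointOfClosedPoint_apply X.hom x hx _⟩

lemma pt_injective : Function.Injective (pt (X := X)) := fun P Q h ↦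
  Over.OverMorphism.ext (ext_of_apply_closedPoint_eq X.hom (Over.w P) (Over.w Q) h)

end Points

end EllipticRelations

/-! ### Geometry of smooth projective curves -/

namespace EllipticRelations

section CurveGeometry

variable {k : Type u} [Field k] {X : Over (Spec (.of k))}

lemma finiteType_sections [LocallyOfFiniteType X.hom] {V : X.left.Opens} (hV : IsAffineOpen V) :
    Algebra.FiniteType k Γ(X.left, V) := by
  have h := X.hom.finiteType_appLE (isAffineOpen_top (Spec (.of k))) hV
    (le_of_le_of_eq le_top (Scheme.Hom.preimage_top X.hom).symm)
  exact h.comp (RingHom.FiniteType.of_surjective _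
    (Scheme.ΓSpecIso (.of k)).symm.commRingCatIsoToRingEquiv.surjective)

variable [IsSmoothProjectiveCurve X]

lemma exists_affine_kaehlerDifferential (x : X.left) : ∃ V : X.left.Opens, IsAffineOpen V ∧ x ∈ V ∧
    Nonempty (Ω[Γ(X.left, V)⁄k] ≃ₗ[Γ(X.left, V)] Γ(X.left, V)) := by
  obtain ⟨U, hU, V, hV, hx, e, h⟩ :=
    SmoothOfRelativeDimension.exists_isStandardSmoothOfRelativeDimension (n := 1) (f := X.hom) x
  refine ⟨V, hV, hx, ?_⟩
  -- The base is a single point, so a nonempty open subset of it is everything.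
  obtain rfl : U = ⊤ := by
    refine top_le_iff.1 fun y _ ↦ ?_
    rw [show y = X.hom x from Subsingleton.elim (α := PrimeSpectrum k) _ _]
    exact e hx
  have : Nonempty V := ⟨⟨x, hx⟩⟩
  have h1 : (algebraMap k Γ(X.left, V)).IsStandardSmoothOfRelativeDimension 1 :=
    RingHom.isStandardSmoothOfRelativeDimension_respectsIso.2 _
      (Scheme.ΓSpecIso (.of k)).symm.commRingCatIsoToRingEquiv h
  rw [RingHom.isStandardSmoothOfRelativeDimension_algebraMap] at h1
  have hr := Algebra.IsStandardSmoothOfRelativeDimension.rank_kaehlerDifferential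
    (R := k) (S := Γ(X.left, V)) 1
  have : Algebra.IsStandardSmooth k Γ(X.left, V) := h1.isStandardSmooth
  have hf : Module.finrank Γ(X.left, V) Ω[Γ(X.left, V)⁄k] = 1 := by
    rw [Module.finrank, hr]; simp
  exact ⟨LinearEquiv.ofFinrankEq _ _ (by simp [hf])⟩

/-- A nonempty affine open subset of a curve whose coordinate ring is a Dedekind domain and not a
field. -/
structure IsCurveChart (V : X.left.Opens) : Prop where
  isAffineOpen : IsAffineOpen V
  nonempty : Nonempty V
  dedekind : IsDedekindDomain Γ(X.left, V)
  not_isField : ¬ IsField Γ(X.left, V)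

lemma genericPoint_mem {V : X.left.Opens} (hV : Nonempty V) : genericPoint X.left ∈ V :=
  ((genericPoint_spec X.left).mem_open_set_iff V.isOpen).mpr (by simpa using hV)

lemma nonempty_basicOpen {V : X.left.Opens} {s : Γ(X.left, V)} (hs : s ≠ 0) :
    Nonempty (X.left.basicOpen s) := by
  by_contra hemp
  refine hs ((basicOpen_eq_bot_iff s).1 ?_)
  ext x
  simpa using fun hx ↦ hemp ⟨⟨x, hx⟩⟩

variable [IsAlgClosed k]

lemma isCurveChart_of_kaehlerDifferential {V : X.left.Opens} (hV : IsAffineOpen V)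
    (hne : Nonempty V)
    (e : Ω[Γ(X.left, V)⁄k] ≃ₗ[Γ(X.left, V)] Γ(X.left, V)) : IsCurveChart V := by
  have := finiteType_sections hV
  have hω (x : Ω[Γ(X.left, V)⁄k]) : ∃ c : Γ(X.left, V), c • e.symm 1 = x :=
    ⟨e x, by rw [← map_smul, smul_eq_mul, _root_.mul_one, e.symm_apply_apply]⟩
  have : Nontrivial Ω[Γ(X.left, V)⁄k] := e.toEquiv.nontrivial
  exact ⟨hV, hne, isDedekindDomain_of_kaehler hω, not_isField_of_kaehler (k := k)⟩

lemma exists_isCurveChart (x : X.left) : ∃ V : X.left.Opens, x ∈ V ∧ IsCurveChart V := by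
  obtain ⟨V, hV, hx, ⟨e⟩⟩ := exists_affine_kaehlerDifferential x
  exact ⟨V, hx, isCurveChart_of_kaehlerDifferential hV ⟨⟨x, hx⟩⟩ e⟩

/-- In a Dedekind chart such a point is a nonzero, hence maximal, prime. It is therefore locally
closed in the curve, and locally closed points of a Jacobson space are closed. -/
lemma isClosed_singleton_of_ne_genericPoint {x : X.left} (hx : x ≠ genericPoint X.left) :
    IsClosed {x} := by
  obtain ⟨V, hxV, hV⟩ := exists_isCurveChart x
  have := hV.nonempty
  have := hV.dedekind
  let q : Spec Γ(X.left, V) := hV.isAffineOpen.primeIdealOf ⟨x, hxV⟩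
  have hq : hV.isAffineOpen.fromSpec q = x := hV.isAffineOpen.fromSpec_primeIdealOf ⟨x, hxV⟩
  have hq0 : q.asIdeal ≠ ⊥ := by
    intro h0
    have h1 := hV.isAffineOpen.fromSpec_primeIdealOf ⟨_, genericPoint_mem hV.nonempty⟩
    rw [hV.isAffineOpen.primeIdealOf_genericPoint, genericPoint_eq_bot_of_affine,
      show (⊥ : PrimeSpectrum Γ(X.left, V)) = q from PrimeSpectrum.ext h0.symm] at h1
    exact hx (hq.symm.trans h1)
  have hmax : q.asIdeal.IsMaximal := q.isPrime.isMaximal hq0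
  have hcl : IsClosed ({q} : Set (Spec Γ(X.left, V))) :=
    (PrimeSpectrum.isClosed_singleton_iff_isMaximal q).2 hmax
  apply isClosed_singleton_of_isLocallyClosed_singleton
  rw [← hq, ← Set.image_singleton]
  exact hcl.isLocallyClosed.image hV.isAffineOpen.fromSpec.isOpenEmbedding.isInducing
    hV.isAffineOpen.fromSpec.isOpenEmbedding.isOpen_range.isLocallyClosed

/-- By noetherianity `Z` is a finite union of irreducible closed sets, each the closure of a point
that is already closed. -/
lemma finite_of_isClosed {Z : Set X.left} (hZ : IsClosed Z) (hη : genericPoint X.left ∉ Z) :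
    Z.Finite := by
  obtain ⟨S, hS, hcl, hirr, rfl⟩ :=
    TopologicalSpace.NoetherianSpace.exists_finite_set_isClosed_irreducible hZ
  refine hS.sUnion fun t ht ↦ ?_
  obtain ⟨x, hx⟩ := QuasiSober.sober (hirr t ht) (hcl t ht)
  have hxt : x ∈ t := hx.mem
  have : IsClosed {x} := isClosed_singleton_of_ne_genericPoint fun h ↦
    hη (Set.mem_sUnion.2 ⟨t, ht, h ▸ hxt⟩)
  rw [← hx.def, this.closure_eq]
  exact Set.finite_singleton x

lemma finite_ratPoint_notMem {V : X.left.Opens} (hV : Nonempty V) :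
    {P : RatPoint X | pt P ∉ V}.Finite := by
  have h := finite_of_isClosed (Z := (V : Set X.left)ᶜ) V.isOpen.isClosed_compl
    (fun h ↦ h (genericPoint_mem hV))
  exact h.preimage pt_injective.injOn

lemma exists_ratPoint_mem {V : X.left.Opens} (hV : Nonempty V) : ∃ P : RatPoint X, pt P ∈ V := by
  obtain ⟨x, hx, hcl⟩ := jacobsonSpace_iff_locallyClosed.1
    (inferInstance : JacobsonSpace X.left) V (by simpa using hV) V.isOpen.isLocallyClosed
  obtain ⟨P, rfl⟩ := exists_pt_eq hcl
  exact ⟨P, hx⟩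

/-- A chart is not a field, so some nonzero function vanishes at `P`, while nonzero functions do not
vanish at the generic point. -/
lemma pt_ne_genericPoint (P : RatPoint X) : pt P ≠ genericPoint X.left := by
  intro hP
  obtain ⟨V, hPV, hV⟩ := exists_isCurveChart (pt P)
  have := hV.dedekind
  let P' : RatPointIn X V := ⟨P, top_le_preimage_iff.2 hPV⟩
  obtain ⟨s, hs, hs0⟩ := Submodule.exists_mem_ne_zero_of_ne_bot
    (Ring.ne_bot_of_isMaximal_of_not_isField (isMaximal_ker (evalHom P')) hV.not_isField)
  refine (value_ne_zero_iff s P').2 ?_ hs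
  change pt P ∈ _
  rw [hP]
  exact genericPoint_mem (nonempty_basicOpen hs0)

lemma infinite_ratPoint : Infinite (RatPoint X) := by
  by_contra hfin
  rw [not_infinite_iff_finite] at hfin
  have hcl : IsClosed (Set.range (pt (X := X))) := by
    rw [← Set.iUnion_singleton_eq_range]
    exact isClosed_iUnion_of_finite isClosed_pt
  have hη : genericPoint X.left ∉ Set.range (pt (X := X)) := by
    rintro ⟨P, hP⟩
    exact pt_ne_genericPoint P hP
  obtain ⟨P, hP⟩ := exists_ratPoint_mem (X := X) (V := ⟨_, hcl.isOpen_compl⟩) ⟨⟨_, hη⟩⟩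
  exact hP ⟨P, rfl⟩

lemma eq_zero_of_value_eq_zero {V : X.left.Opens} (s : Γ(X.left, V))
    (h : ∀ P, value s P = 0) : s = 0 := by
  by_contra hs
  obtain ⟨P, hP⟩ := exists_ratPoint_mem (nonempty_basicOpen hs)
  exact (value_ne_zero_iff s ⟨P, top_le_preimage_iff.2 (X.left.basicOpen_le s hP)⟩).2 hP (h _)

/-- By properness and integrality the global sections form a finite field extension of the
algebraically closed `k`. -/
lemma exists_constFun_eq (s : Γ(X.left, ⊤)) : ∃ c : k, s = constFun ⊤ c := by
  let _ := (isField_of_universallyClosed k X.hom).toField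
  have h := finite_appTop_of_universallyClosed k X.hom
  have : Module.Finite k Γ(X.left, ⊤) := by
    have h1 : algebraMap k Γ(X.left, ⊤) =
        X.hom.appTop.hom.comp (Scheme.ΓSpecIso (.of k)).inv.hom := by
      rw [Scheme.Hom.appTop, ← Scheme.Hom.appLE_eq_app]
      rfl
    rw [← RingHom.finite_algebraMap, h1]
    exact h.comp (RingHom.Finite.of_surjective _
      (Scheme.ΓSpecIso (.of k)).symm.commRingCatIsoToRingEquiv.surjective)
  have hb : Function.Surjective (algebraMap k Γ(X.left, ⊤)) :=
    IsAlgClosed.algebraMap_bijective_of_isIntegral.2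
  obtain ⟨c, hc⟩ := hb s
  exact ⟨c, hc.symm⟩

end CurveGeometry

end EllipticRelations

/-! ### The function field of a curve -/

namespace EllipticRelations

section FunctionField

variable {k : Type u} [Field k] {X : Over (Spec (.of k))} [IsSmoothProjectiveCurve X]

/-- The germ at the generic point, as a ring homomorphism. -/
noncomputable def genGerm {V : X.left.Opens} (hV : genericPoint X.left ∈ V) :
    Γ(X.left, V) →+* X.left.functionField := (X.left.presheaf.germ V _ hV).hom

lemma genGerm_res {V W : X.left.Opens} (i : W ≤ V) (hW : genericPoint X.left ∈ W)
    (s : Γ(X.left, V)) : genGerm hW (resHom i s) = genGerm (i hW) s :=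
  X.left.presheaf.germ_res_apply (homOfLE i) _ hW s

lemma genGerm_injective {V : X.left.Opens} (hV : genericPoint X.left ∈ V) :
    Function.Injective (genGerm hV) :=
  germ_injective_of_isIntegral _ _ _

lemma exists_genGerm_eq (f : X.left.functionField) :
    ∃ (V : X.left.Opens) (hV : genericPoint X.left ∈ V) (s : Γ(X.left, V)), genGerm hV s = f :=
  X.left.presheaf.exists_germ_eq f

noncomputable instance algebraFunctionField : Algebra k X.left.functionField :=
  ((genGerm (X := X) (V := ⊤) trivial).comp (algebraMap k Γ(X.left, ⊤))).toAlgebra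

lemma genGerm_algebraMap {V : X.left.Opens} (hV : genericPoint X.left ∈ V) (c : k) :
    genGerm hV (algebraMap k _ c) = algebraMap k X.left.functionField c := by
  change _ = genGerm _ (algebraMap k Γ(X.left, ⊤) c)
  rw [← genGerm_res (le_top : V ≤ ⊤) hV, AlgHom.commutes]

lemma algebraMap_eq_genGerm {V : X.left.Opens} [hV : Nonempty V] (s : Γ(X.left, V)) :
    algebraMap Γ(X.left, V) X.left.functionField s = genGerm (genericPoint_mem hV) s := rfl

instance {V : X.left.Opens} [hV : Nonempty V] :
    IsScalarTower k Γ(X.left, V) X.left.functionField :=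
  .of_algebraMap_eq fun c ↦ (genGerm_algebraMap (genericPoint_mem hV) c).symm

/-- The rational function `f` is regular at `P` with value `c`. -/
def HasVal (P : RatPoint X) (f : X.left.functionField) (c : k) : Prop :=
  ∃ (V : X.left.Opens) (hP : ⊤ ≤ P.left ⁻¹ᵁ V) (hV : genericPoint X.left ∈ V) (s : Γ(X.left, V)),
    genGerm hV s = f ∧ value s ⟨P, hP⟩ = c

/-- This transfers the algebra of Dedekind domains to the curve. A section near `P` restricts to a
basic open set of `V`, where it becomes a fraction; conversely a fraction is a section where its
denominator is invertible. -/
lemma hasVal_iff_localVal {V : X.left.Opens} [Nonempty V] (hV : IsAffineOpen V)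
    (P : RatPointIn X V) {f : X.left.functionField} {c : k} :
    HasVal P.1 f c ↔ LocalVal (evalHom P) f c := by
  constructor
  · rintro ⟨W, hP, hW, s, rfl, rfl⟩
    obtain ⟨b, hbW, hPb⟩ := hV.exists_basicOpen_le ⟨pt P.1, top_le_preimage_iff.1 hP⟩
      (top_le_preimage_iff.1 P.2)
    have hb : X.left.basicOpen b ≤ V := X.left.basicOpen_le b
    have hb' : genericPoint X.left ∈ X.left.basicOpen b := genericPoint_mem ⟨⟨_, hPb⟩⟩
    let P' : RatPointIn X (X.left.basicOpen b) := ⟨P.1, top_le_preimage_iff.2 hPb⟩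
    have hloc := hV.isLocalization_basicOpen b
    obtain ⟨⟨a, ⟨_, n, rfl⟩⟩, ha⟩ := IsLocalization.surj (Submonoid.powers b) (resHom hbW s)
    have ha' : resHom hbW s * resHom hb (b ^ n) = resHom hb a := ha
    have hbP : value b P ≠ 0 := (value_ne_zero_iff b P).2 hPb
    refine ⟨a, b ^ n, ?_, ?_, ?_⟩
    · rw [map_pow]
      exact pow_ne_zero _ hbP
    · rw [algebraMap_eq_genGerm, algebraMap_eq_genGerm, ← genGerm_res hbW hb', ← genGerm_res hb hb',
        ← genGerm_res hb hb', ← map_mul, ha']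
    · have h := congrArg (evalHom P') ha'
      rw [map_mul, evalHom_apply, evalHom_apply, evalHom_apply, value_res, value_res,
        value_res] at h
      exact h
  · rintro ⟨a, b, hb0, hf, hc⟩
    have hb : X.left.basicOpen b ≤ V := X.left.basicOpen_le b
    have hPb : pt P.1 ∈ X.left.basicOpen b := (value_ne_zero_iff b P).1 hb0
    have hb' : genericPoint X.left ∈ X.left.basicOpen b := genericPoint_mem ⟨⟨_, hPb⟩⟩
    let P' : RatPointIn X (X.left.basicOpen b) := ⟨P.1, top_le_preimage_iff.2 hPb⟩
    have hbu : IsUnit (resHom hb b) := RingedSpace.isUnit_res_basicOpen _ b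
    obtain ⟨b', hbb'⟩ := hbu.exists_right_inv
    refine ⟨_, P'.2, hb', resHom hb a * b', ?_, ?_⟩
    · have h1 : genGerm hb' (resHom hb b) * genGerm hb' b' = 1 := by rw [← map_mul, hbb', map_one]
      have h2 : genGerm hb' (resHom hb a) = f * genGerm hb' (resHom hb b) := by
        rw [genGerm_res, genGerm_res]
        exact hf.symm
      rw [map_mul, h2, _root_.mul_assoc, h1, _root_.mul_one]
    · have h1 : evalHom P' (resHom hb b) * evalHom P' b' = 1 := by rw [← map_mul, hbb', map_one]
      have h2 : evalHom P' (resHom hb a) = c * evalHom P' (resHom hb b) := by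
        rw [evalHom_apply, evalHom_apply, value_res, value_res]
        exact hc.symm
      change evalHom P' (resHom hb a * b') = c
      rw [map_mul, h2, _root_.mul_assoc, h1, _root_.mul_one]

section Global

variable [IsAlgClosed k]

lemma exists_mem_of_forall_pt_mem {I : Type*} {V : I → X.left.Opens}
    (h : ∀ P : RatPoint X, ∃ i, pt P ∈ V i) : ⊤ ≤ iSup V := by
  by_contra hne
  have hcl : IsClosed ((iSup V : X.left.Opens) : Set X.left)ᶜ := (iSup V).isOpen.isClosed_compl
  have hnon : (((iSup V : X.left.Opens) : Set X.left)ᶜ).Nonempty := by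
    by_contra hemp
    apply hne
    intro x _
    by_contra hx
    exact hemp ⟨x, hx⟩
  obtain ⟨x, hx, hxc⟩ := jacobsonSpace_iff_locallyClosed.1
    (inferInstance : JacobsonSpace X.left) _ hnon hcl.isLocallyClosed
  obtain ⟨P, rfl⟩ := exists_pt_eq hxc
  obtain ⟨i, hi⟩ := h P
  exact hx (TopologicalSpace.Opens.mem_iSup.2 ⟨i, hi⟩)

/-- The local sections share the generic germ `f`, so they agree on overlaps and glue; covering the
rational points covers the curve, and global sections are constant. -/
lemma exists_eq_algebraMap_of_hasVal {f : X.left.functionField} (h : ∀ P, ∃ c, HasVal P f c) :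
    ∃ c, f = algebraMap k _ c := by
  choose c V hP hV s hs _ using h
  obtain ⟨g, hg, -⟩ := X.left.sheaf.existsUnique_gluing' V ⊤ (fun i ↦ homOfLE le_top)
    (exists_mem_of_forall_pt_mem fun P ↦ ⟨P, top_le_preimage_iff.1 (hP P)⟩) s (by
      intro P Q
      have hPQ : genericPoint X.left ∈ V P ⊓ V Q := ⟨hV P, hV Q⟩
      apply genGerm_injective hPQ
      exact (genGerm_res (inf_le_left : V P ⊓ V Q ≤ V P) hPQ (s P)).trans
        (((hs P).trans (hs Q).symm).trans
          (genGerm_res (inf_le_right : V P ⊓ V Q ≤ V Q) hPQ (s Q)).symm))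
  obtain ⟨P⟩ : Nonempty (RatPoint X) := (infinite_ratPoint (X := X)).nonempty
  obtain ⟨d, rfl⟩ := exists_constFun_eq g
  refine ⟨d, ?_⟩
  rw [← hs P, ← hg P, ← genGerm_algebraMap (V := V P) (hV P)]
  exact congrArg (genGerm (hV P)) (map_constFun le_top d)

/-- A nonzero rational function has finitely many zeros. -/
lemma finite_zeros {f : X.left.functionField} (hf : f ≠ 0) :
    {P : RatPoint X | HasVal P f 0}.Finite := by
  obtain ⟨V, -, hV⟩ := exists_isCurveChart (genericPoint X.left)
  have := hV.nonempty
  have hfr := functionField_isFractionRing_of_isAffineOpen X.left V hV.isAffineOpen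
  have := hV.dedekind
  obtain ⟨a, b, hb, rfl⟩ := IsFractionRing.div_surjective (A := Γ(X.left, V)) f
  have ha : a ≠ 0 := by rintro rfl; simp at hf
  have hb0 : algebraMap Γ(X.left, V) X.left.functionField b ≠ 0 :=
    IsFractionRing.to_map_ne_zero_of_mem_nonZeroDivisors hb
  refine (finite_ratPoint_notMem (nonempty_basicOpen ha)).subset fun P hP hPa ↦ ?_
  let P' : RatPointIn X V := ⟨P, top_le_preimage_iff.2 (X.left.basicOpen_le a hPa)⟩
  have h1 : LocalVal (evalHom P') _ _ := (hasVal_iff_localVal hV.isAffineOpen P').1 hP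
  have h2 := h1.mul (LocalVal.of b)
  rw [div_mul_cancel₀ _ hb0, zero_mul] at h2
  exact (value_ne_zero_iff a P').2 hPa ((LocalVal.of a).unique h2)

end Global

section Pullback

variable {Y : Over (Spec (.of k))} [IsSmoothProjectiveCurve Y]
  {Z : Over (Spec (.of k))} [IsSmoothProjectiveCurve Z]

/-- Pullback of rational functions along a dominant morphism of curves. -/
noncomputable def pullFun (g : X ⟶ Y) (hg : g.left (genericPoint X.left) = genericPoint Y.left) :
    Y.left.functionField →+* X.left.functionField :=
  (Y.left.presheaf.stalkSpecializes (specializes_of_eq hg) ≫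
    g.left.stalkMap (genericPoint X.left)).hom

lemma pullFun_genGerm (g : X ⟶ Y) (hg : g.left (genericPoint X.left) = genericPoint Y.left)
    {V : Y.left.Opens} {W : X.left.Opens} (hV : genericPoint Y.left ∈ V)
    (hW : genericPoint X.left ∈ W) (i : W ≤ g.left ⁻¹ᵁ V) (s : Γ(Y.left, V)) :
    pullFun g hg (genGerm hV s) = genGerm hW (pullHom g i s) := by
  have h : Y.left.presheaf.germ V _ hV ≫ Y.left.presheaf.stalkSpecializes (specializes_of_eq hg) ≫
      g.left.stalkMap (genericPoint X.left) =
      g.left.appLE V W i ≫ X.left.presheaf.germ W _ hW := by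
    rw [TopCat.Presheaf.germ_stalkSpecializes_assoc, Scheme.Hom.germ_stalkMap, Scheme.Hom.appLE,
      Category.assoc, TopCat.Presheaf.germ_res]
  exact ConcreteCategory.congr_hom h s

lemma pullFun_algebraMap (g : X ⟶ Y) (hg : g.left (genericPoint X.left) = genericPoint Y.left)
    (c : k) : pullFun g hg (algebraMap k _ c) = algebraMap k _ c := by
  have hX : genericPoint X.left ∈ (⊤ : X.left.Opens) := trivial
  have hY : genericPoint Y.left ∈ (⊤ : Y.left.Opens) := trivial
  rw [← genGerm_algebraMap hY, pullFun_genGerm g hg hY hX le_top, AlgHom.commutes,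
    genGerm_algebraMap]

lemma pullFun_comp (g : X ⟶ Y) (hg : g.left (genericPoint X.left) = genericPoint Y.left)
    (h : Y ⟶ Z) (hh : h.left (genericPoint Y.left) = genericPoint Z.left)
    (hgh : (g ≫ h).left (genericPoint X.left) = genericPoint Z.left) (f : Z.left.functionField) :
    pullFun (g ≫ h) hgh f = pullFun g hg (pullFun h hh f) := by
  obtain ⟨V, hV, s, rfl⟩ := exists_genGerm_eq f
  have hV' : genericPoint Y.left ∈ h.left ⁻¹ᵁ V := by
    change h.left _ ∈ V
    rwa [hh]
  have hV'' : genericPoint X.left ∈ g.left ⁻¹ᵁ (h.left ⁻¹ᵁ V) := by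
    change g.left _ ∈ h.left ⁻¹ᵁ V
    rwa [hg]
  rw [pullFun_genGerm h hh hV hV' le_rfl, pullFun_genGerm g hg hV' hV'' le_rfl,
    pullFun_genGerm (g ≫ h) hgh hV hV'' le_rfl]
  congr 1
  exact (ConcreteCategory.congr_hom
    (Scheme.Hom.appLE_comp_appLE g.left h.left V _ _ le_rfl le_rfl) s).symm

lemma pullFun_id (hg) (f : X.left.functionField) : pullFun (𝟙 X) hg f = f := by
  obtain ⟨V, hV, s, rfl⟩ := exists_genGerm_eq f
  rw [pullFun_genGerm _ _ hV hV (show V ≤ (𝟙 X : X ⟶ X).left ⁻¹ᵁ V from le_rfl)]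
  congr 1
  exact ConcreteCategory.congr_hom (id_appLE V le_rfl) s

lemma HasVal.pullFun {g : X ⟶ Y} (hg : g.left (genericPoint X.left) = genericPoint Y.left)
    {P : RatPoint X} {f : Y.left.functionField} {c : k} (h : HasVal (P ≫ g) f c) :
    HasVal P (pullFun g hg f) c := by
  obtain ⟨V, hP, hV, s, rfl, rfl⟩ := h
  have hV' : genericPoint X.left ∈ g.left ⁻¹ᵁ V := by
    change g.left _ ∈ V
    rwa [hg]
  rw [pullFun_genGerm g hg hV hV' le_rfl]
  refine ⟨g.left ⁻¹ᵁ V, hP, hV', _, rfl, ?_⟩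
  exact value_pull g le_rfl s ⟨P, hP⟩ hP

lemma map_genericPoint_of_isIso (g : X ⟶ Y) [IsIso g] :
    g.left (genericPoint X.left) = genericPoint Y.left := by
  have : IsIso g.left := inferInstanceAs (IsIso ((Over.forget _).map g))
  exact genericPoint_eq_of_isOpenImmersion g.left

end Pullback

end FunctionField

end EllipticRelations

/-! ### Translations on an elliptic curve -/

namespace EllipticRelations

section Translation

variable {k : Type u} [Field k]

/-- The structure morphism to the terminal object. -/
noncomputable def toBase (X : Over (Spec (.of k))) : X ⟶ Over.mk (𝟙 (Spec (.of k))) :=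
  Over.homMk X.hom

lemma eq_toBase {X : Over (Spec (.of k))} (g : X ⟶ Over.mk (𝟙 (Spec (.of k)))) : g = toBase X :=
  Over.mkIdTerminal.hom_ext _ _

variable (A : Over (Spec (.of k))) [EllipticCurve A]

/-- Translation by a rational point. -/
noncomputable def translation (b : RatPoint A) : A ⟶ A := 𝟙 A * (toBase A ≫ b)

lemma comp_translation {T : Over (Spec (.of k))} (g : T ⟶ A) (b : RatPoint A) :
    g ≫ translation A b = g * (toBase T ≫ b) := by
  rw [translation, comp_mul, Category.comp_id, ← Category.assoc, eq_toBase (g ≫ toBase A)]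

lemma ratPoint_comp_translation (P b : RatPoint A) : P ≫ translation A b = P * b := by
  rw [comp_translation, ← eq_toBase (𝟙 _), Category.id_comp]

lemma translation_comp (a b : RatPoint A) :
    translation A a ≫ translation A b = translation A (a * b) := by
  rw [comp_translation, translation, translation, comp_mul, _root_.mul_assoc]

lemma translation_one : translation A 1 = 𝟙 A := by
  rw [translation, comp_one, _root_.mul_one]

instance (b : RatPoint A) : IsIso (translation A b) :=
  ⟨translation A b⁻¹, by rw [translation_comp, mul_inv_cancel, translation_one],
    by rw [translation_comp, inv_mul_cancel, translation_one]⟩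

/-- Pullback of rational functions along a translation. -/
noncomputable def translationFun (b : RatPoint A) :
    A.left.functionField →ₐ[k] A.left.functionField where
  __ := pullFun (translation A b) (map_genericPoint_of_isIso _)
  commutes' c := pullFun_algebraMap _ _ c

lemma translationFun_mul (a b : RatPoint A) (f : A.left.functionField) :
    translationFun A (a * b) f = translationFun A a (translationFun A b f) := by
  have h (g : A ⟶ A) (hg : g = translation A a ≫ translation A b)
      (hg' : g.left (genericPoint A.left) = genericPoint A.left) : pullFun g hg' f =
        translationFun A a (translationFun A b f) := by
    subst hg
    exact pullFun_comp _ (map_genericPoint_of_isIso _) _ (map_genericPoint_of_isIso _) _ f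
  exact h _ (translation_comp A a b).symm (map_genericPoint_of_isIso _)

lemma hasVal_translationFun {P b : RatPoint A} {f : A.left.functionField} {c : k} :
    HasVal P (translationFun A b f) c ↔ HasVal (P * b) f c := by
  have h {P b : RatPoint A} {f : A.left.functionField} {c : k} (h : HasVal (P * b) f c) :
      HasVal P (translationFun A b f) c := by
    rw [← ratPoint_comp_translation] at h
    exact h.pullFun (map_genericPoint_of_isIso _)
  refine ⟨fun h' ↦ ?_, h⟩
  -- The converse is the direct implication applied to the inverse translation.
  have h1 : HasVal (P * b) (translationFun A b⁻¹ (translationFun A b f)) c := by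
    apply h
    rwa [mul_inv_cancel_right]
  rw [← translationFun_mul, inv_mul_cancel] at h1
  have h2 : translationFun A 1 f = f := by
    have h3 (g : A ⟶ A) (hg : g = 𝟙 A) (hg' : g.left (genericPoint A.left) = genericPoint A.left) :
        pullFun g hg' f = f := by
      subst hg
      exact pullFun_id _ f
    exact h3 _ (translation_one A) (map_genericPoint_of_isIso _)
  rwa [h2] at h1

variable [IsAlgClosed k]

/-- The function field of an elliptic curve. -/
noncomputable def ellipticFunctionField :
    GroupFunctionField k A.left.functionField (Additive (RatPoint A)) where
  v x f c := HasVal x.toMul f c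
  unique {x f c d} h h' := by
    obtain ⟨V, hxV, hV⟩ := exists_isCurveChart (pt x.toMul)
    have := hV.nonempty
    have := functionField_isFractionRing_of_isAffineOpen A.left V hV.isAffineOpen
    let P : RatPointIn A V := ⟨x.toMul, top_le_preimage_iff.2 hxV⟩
    exact ((hasVal_iff_localVal hV.isAffineOpen P).1 h).unique
      ((hasVal_iff_localVal hV.isAffineOpen P).1 h')
  add {x f g c d} h h' := by
    obtain ⟨V, hxV, hV⟩ := exists_isCurveChart (pt x.toMul)
    have := hV.nonempty
    let P : RatPointIn A V := ⟨x.toMul, top_le_preimage_iff.2 hxV⟩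
    exact (hasVal_iff_localVal hV.isAffineOpen P).2
      (((hasVal_iff_localVal hV.isAffineOpen P).1 h).add
        ((hasVal_iff_localVal hV.isAffineOpen P).1 h'))
  mul {x f g c d} h h' := by
    obtain ⟨V, hxV, hV⟩ := exists_isCurveChart (pt x.toMul)
    have := hV.nonempty
    let P : RatPointIn A V := ⟨x.toMul, top_le_preimage_iff.2 hxV⟩
    exact (hasVal_iff_localVal hV.isAffineOpen P).2
      (((hasVal_iff_localVal hV.isAffineOpen P).1 h).mul
        ((hasVal_iff_localVal hV.isAffineOpen P).1 h'))
  const x c := by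
    refine ⟨⊤, le_top, trivial, algebraMap k _ c, genGerm_algebraMap _ c, ?_⟩
    exact (evalHom _).commutes c
  inv {x f c} h hc := by
    obtain ⟨V, hxV, hV⟩ := exists_isCurveChart (pt x.toMul)
    have := hV.nonempty
    have := functionField_isFractionRing_of_isAffineOpen A.left V hV.isAffineOpen
    let P : RatPointIn A V := ⟨x.toMul, top_le_preimage_iff.2 hxV⟩
    exact (hasVal_iff_localVal hV.isAffineOpen P).2
      (((hasVal_iff_localVal hV.isAffineOpen P).1 h).inv hc)
  regular_or x f := by
    obtain ⟨V, hxV, hV⟩ := exists_isCurveChart (pt x.toMul)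
    have := hV.nonempty
    have := hV.dedekind
    have := functionField_isFractionRing_of_isAffineOpen A.left V hV.isAffineOpen
    let P : RatPointIn A V := ⟨x.toMul, top_le_preimage_iff.2 hxV⟩
    have h := localVal_or (evalHom P) hV.not_isField f
    simpa only [← hasVal_iff_localVal hV.isAffineOpen] using h
  uniformizer x := by
    obtain ⟨V, hxV, hV⟩ := exists_isCurveChart (pt x.toMul)
    have := hV.nonempty
    have := hV.dedekind
    have := functionField_isFractionRing_of_isAffineOpen A.left V hV.isAffineOpen
    let P : RatPointIn A V := ⟨x.toMul, top_le_preimage_iff.2 hxV⟩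
    have h := exists_uniformizer_div (K := A.left.functionField) (evalHom P) hV.not_isField
    simpa only [← hasVal_iff_localVal hV.isAffineOpen] using h
  exists_pow_mul {x t} ht g := by
    obtain ⟨V, hxV, hV⟩ := exists_isCurveChart (pt x.toMul)
    have := hV.nonempty
    have := hV.dedekind
    have := functionField_isFractionRing_of_isAffineOpen A.left V hV.isAffineOpen
    let P : RatPointIn A V := ⟨x.toMul, top_le_preimage_iff.2 hxV⟩
    have h := exists_pow_mul_localVal (evalHom P) hV.not_isField
      ((hasVal_iff_localVal hV.isAffineOpen P).1 ht) g
    simpa only [← hasVal_iff_localVal hV.isAffineOpen] using h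
  global h := exists_eq_algebraMap_of_hasVal fun P ↦ h (Additive.ofMul P)
  τ b := translationFun A b.toMul
  τ_add a b f := translationFun_mul A a.toMul b.toMul f
  τ_v := hasVal_translationFun A

end Translation

end EllipticRelations

/-! ### An affine chart on an elliptic curve -/

namespace EllipticRelations

open Polynomial

/-- The functions regular at `x` form a valuation ring, hence an integrally closed one. -/
lemma GroupFunctionField.mem_O_of_isIntegral {k K G : Type*} [Field k] [Field K] [Algebra k K]
    [AddCommGroup G] {V : GroupFunctionField k K G} {x : G} {f r : K} (hf : f ∈ V.O x)
    (hr : (aeval (R := k) f).toRingHom.IsIntegralElem r) : r ∈ V.O x := by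
  let B : ValuationSubring K :=
    { (V.O x).toSubring with
      mem_or_inv_mem' := fun g ↦ (V.regular_or x g).imp id fun h ↦ ⟨0, h⟩ }
  let j : k[X] →+* B := (aeval (⟨f, hf⟩ : V.O x)).toRingHom
  obtain ⟨p, hp, hpr⟩ := hr
  have hInt : _root_.IsIntegral B r := by
    refine ⟨p.map j, hp.map j, ?_⟩
    rw [eval₂_map, ← hpr]
    congr 1
    ext q
    · change (V.O x).val (aeval (⟨f, hf⟩ : V.O x) (C _)) = aeval f (C _)
      simp
    · change (V.O x).val (aeval (⟨f, hf⟩ : V.O x) X) = aeval f X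
      simp
  obtain ⟨y, rfl⟩ := IsIntegrallyClosed.isIntegral_iff.1 hInt
  exact y.2

section

variable {k : Type u} [Field k] (A : Over (Spec (.of k))) [EllipticCurve A] [IsAlgClosed k]

lemma ellipticFunctionField_v_iff {W : A.left.Opens} [Nonempty W] (hW : IsAffineOpen W)
    (P : RatPointIn A W) {f : A.left.functionField} {c : k} :
    (ellipticFunctionField A).v (Additive.ofMul P.1) f c ↔ LocalVal (evalHom P) f c :=
  hasVal_iff_localVal hW P

/-- Points are determined by the functions regular there and their values. -/
lemma eq_of_v_imp {x y : Additive (RatPoint A)}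
    (h : ∀ f c, (ellipticFunctionField A).v x f c → (ellipticFunctionField A).v y f c) :
    x = y := by
  obtain ⟨W, -, hW⟩ := exists_isCurveChart (genericPoint A.left)
  have := hW.nonempty
  have := functionField_isFractionRing_of_isAffineOpen A.left W hW.isAffineOpen
  have hfin (z : Additive (RatPoint A)) :
      {b : Additive (RatPoint A) | pt (z + b).toMul ∉ W}.Finite :=
    (finite_ratPoint_notMem hW.nonempty).preimage (f := fun b ↦ (z + b).toMul)
      (by intro b _ b' _ hb; exact add_left_cancel (Additive.toMul.injective hb))
  have : Infinite (Additive (RatPoint A)) := infinite_ratPoint (X := A)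
  -- A single translation moves both points into one affine chart, where evaluation on sections
  -- separates points.
  obtain ⟨b, hb⟩ := ((hfin x).union (hfin y)).infinite_compl.nonempty
  simp only [Set.compl_union, Set.mem_inter_iff, Set.mem_compl_iff, Set.mem_ofPred_eq,
    not_not] at hb
  let P : RatPointIn A W := ⟨(x + b).toMul, top_le_preimage_iff.2 hb.1⟩
  let Q : RatPointIn A W := ⟨(y + b).toMul, top_le_preimage_iff.2 hb.2⟩
  have hPQ : P = Q := by
    refine ratPoint_ext_of_evalHom hW.isAffineOpen ?_
    ext s
    have h1 : (ellipticFunctionField A).v (x + b) (algebraMap _ _ s) (evalHom P s) :=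
      (ellipticFunctionField_v_iff A hW.isAffineOpen P).2 (LocalVal.of s)
    rw [← (ellipticFunctionField A).τ_v] at h1
    have h2 := (ellipticFunctionField A).τ_v.1 (h _ _ h1)
    exact ((ellipticFunctionField_v_iff A hW.isAffineOpen Q).1 h2).unique (LocalVal.of s)
  exact add_right_cancel (b := b) (Additive.toMul.injective (congrArg Subtype.val hPQ))

/-- Noether normalization makes the coordinate ring of an affine open finite over `k[f]`; it is
torsion-free over a principal ideal domain, hence free. -/
theorem nonempty_chart : Nonempty (ellipticFunctionField A).Chart := by
  classical
  obtain ⟨W, -, hW⟩ := exists_isCurveChart (genericPoint A.left)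
  have hne := hW.nonempty
  have hded := hW.dedekind
  have hfr := functionField_isFractionRing_of_isAffineOpen A.left W hW.isAffineOpen
  have hft := finiteType_sections hW.isAffineOpen
  let V := ellipticFunctionField A
  let R := Γ(A.left, W)
  let K := A.left.functionField
  have hinj : Function.Injective (algebraMap R K) := IsFractionRing.injective R K
  obtain ⟨f, hfinj, hfin⟩ := exists_finite_aeval (k := k) hW.not_isField
  let T : Finset (Additive (RatPoint A)) :=
    ((finite_ratPoint_notMem hW.nonempty).preimage Additive.toMul.injective.injOn).toFinset
  have hT (x : Additive (RatPoint A)) : x ∉ T ↔ pt x.toMul ∈ W := by simp [T]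
  let pnt (x : Additive (RatPoint A)) (hx : x ∉ T) : RatPointIn A W :=
    ⟨x.toMul, top_le_preimage_iff.2 ((hT x).1 hx)⟩
  have hv (x : Additive (RatPoint A)) (hx : x ∉ T) {g : K} {c : k} :
      V.v x g c ↔ LocalVal (evalHom (pnt x hx)) g c :=
    ellipticFunctionField_v_iff A hW.isAffineOpen (pnt x hx)
  have hR (x : Additive (RatPoint A)) (hx : x ∉ T) (r : R) : algebraMap R K r ∈ V.O x :=
    ⟨_, (hv x hx).2 (LocalVal.of r)⟩
  have hχ (χ : R →ₐ[k] k) : ∃ x, ∃ hx : x ∉ T, evalHom (pnt x hx) = χ := by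
    let P := pointOfHom hW.isAffineOpen χ
    exact ⟨Additive.ofMul P.1, (hT _).2 (top_le_preimage_iff.1 P.2), evalHom_pointOfHom _ χ⟩
  let _ : Algebra k[X] R := (aeval f).toAlgebra
  have hmod : Module.Finite k[X] R := hfin
  have htf : Module.IsTorsionFree k[X] R :=
    have : FaithfulSMul k[X] R := (faithfulSMul_iff_algebraMap_injective _ _).2 hfinj
    inferInstance
  have hfree : Module.Free k[X] R := Module.free_of_finite_type_torsion_free'
  let b := Module.finBasis k[X] R
  have haeval (q : k[X]) : aeval (algebraMap R K f) q = algebraMap R K (algebraMap k[X] R q) :=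
    aeval_algebraMap_apply K f q
  have hcomb (P : Fin (Module.finrank k[X] R) → k[X]) :
      ∑ i, aeval (algebraMap R K f) (P i) * algebraMap R K (b i) =
        algebraMap R K (∑ i, P i • b i) := by
    rw [map_sum]
    exact Finset.sum_congr rfl fun i _ ↦ by rw [haeval, ← map_mul, Algebra.smul_def]
  refine ⟨⟨T, algebraMap R K f, Module.finrank k[X] R, fun i ↦ algebraMap R K (b i),
    fun hx ↦ hR _ hx f, ?_, fun hx i ↦ hR _ hx _, ?_, ?_, ?_⟩⟩
  -- If `f` had no pole at `x`, all of `R` would be regular there by integrality. Evaluation at `x`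
  -- would then be a point `w` of the chart, and `w = x` because every function regular at `w` has
  -- the same value at `x`.
  · intro x hx hfx
    have hmem (r : R) : algebraMap R K r ∈ V.O x := by
      refine GroupFunctionField.mem_O_of_isIntegral hfx ?_
      obtain ⟨p, hp, hpr⟩ := hfin.to_isIntegral r
      refine ⟨p, hp, ?_⟩
      have h1 : (aeval (R := k) (algebraMap R K f)).toRingHom =
          (algebraMap R K).comp (aeval f).toRingHom := RingHom.ext haeval
      rw [h1, ← hom_eval₂, hpr, map_zero]
    choose ev hev using hmem
    let χ : R →ₐ[k] k :=
      { toFun := ev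
        map_one' := V.unique (hev 1) (by simpa using V.const x 1)
        map_mul' := fun r s ↦ V.unique (hev _) (by simpa using V.mul (hev r) (hev s))
        map_zero' := V.unique (hev 0) (by simpa using V.const x 0)
        map_add' := fun r s ↦ V.unique (hev _) (by simpa using V.add (hev r) (hev s))
        commutes' := fun c ↦ V.unique (hev _)
          (by rw [← IsScalarTower.algebraMap_apply k R K]; exact V.const x c) }
    obtain ⟨w, hw, hwχ⟩ := hχ χ
    have hwx : w = x := by
      refine eq_of_v_imp A fun g c hg ↦ ?_
      obtain ⟨a, b, hb, hgb, hc⟩ := (hv w hw).1 hg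
      rw [hwχ] at hb hc
      have hb' : V.v x (algebraMap R K b) (χ b) := hev b
      have ha' : V.v x (algebraMap R K a) (χ a) := hev a
      have hb0 : algebraMap R K b ≠ 0 := fun h0 ↦ hb (V.unique hb' (by
        rw [h0]; exact GroupFunctionField.v_zero x))
      have := V.mul ha' (V.inv hb' hb)
      rwa [← hgb, ← hc, mul_inv_cancel_right₀ hb0, mul_inv_cancel_right₀ hb] at this
    exact hw (hwx ▸ hx)
  · intro g hg
    obtain ⟨r, rfl⟩ := exists_algebraMap_eq_of_localVal (k := k) (R := R) (f := g) fun χ ↦ by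
      obtain ⟨x, hx, rfl⟩ := hχ χ
      obtain ⟨c, hc⟩ := hg x hx
      exact ⟨c, (hv x hx).1 hc⟩
    exact ⟨fun i ↦ b.repr r i, by rw [hcomb, b.sum_repr]⟩
  · intro P hP
    rw [hcomb] at hP
    have h0 : ∑ i, P i • b i = 0 := hinj (by rw [hP, map_zero])
    exact funext (Fintype.linearIndependent_iff.1 b.linearIndependent P h0)
  · intro s hs
    obtain ⟨e, he, het, hex⟩ := exists_simple_pole (K := K) (evalHom (pnt s hs)) hW.not_isField
    refine ⟨e, ?_, ?_, ?_⟩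
    · rintro ⟨c, hc⟩
      exact he c ((hv s hs).1 hc)
    · intro t ht
      obtain ⟨c, hc⟩ := het t ((hv s hs).1 ht)
      exact ⟨c, (hv s hs).2 hc⟩
    · intro x hx hxs
      obtain ⟨c, hc⟩ := hex (evalHom (pnt x hx)) fun h ↦ hxs (Additive.toMul.injective
        (congrArg Subtype.val (ratPoint_ext_of_evalHom hW.isAffineOpen h)))
      exact ⟨c, (hv x hx).2 hc⟩

end

end EllipticRelations

/-! ### Tangent vectors and multiplication by integers -/

namespace EllipticRelations

section Tangent

variable {k : Type u} [Field k]

/-- The spectrum of a `k`-algebra as a `k`-scheme. -/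
noncomputable abbrev specOver (k : Type u) [Field k] (B : Type u) [CommRing B] [Algebra k B] :
    Over (Spec (.of k)) :=
  Over.mk (Spec.map (CommRingCat.ofHom (algebraMap k B)))

/-- The morphism of spectra given by a homomorphism of `k`-algebras. -/
noncomputable def specOverMap {B C : Type u} [CommRing B] [CommRing C] [Algebra k B] [Algebra k C]
    (φ : B →ₐ[k] C) : specOver k C ⟶ specOver k B :=
  Over.homMk (Spec.map (CommRingCat.ofHom φ.toRingHom)) (by
    change Spec.map _ ≫ Spec.map _ = Spec.map _
    rw [← Spec.map_comp, ← CommRingCat.ofHom_comp]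
    congr 2
    exact φ.comp_algebraMap)

variable {A : Over (Spec (.of k))} {W : A.left.Opens} (hW : IsAffineOpen W)
  {B C : Type u} [CommRing B] [CommRing C] [Algebra k B] [Algebra k C]

/-- The `B`-valued point of an affine open set given by a homomorphism to `B`. -/
noncomputable def specPoint (ψ : Γ(A.left, W) →ₐ[k] B) : specOver k B ⟶ A :=
  Over.homMk (Spec.map (CommRingCat.ofHom ψ.toRingHom) ≫ hW.fromSpec) (by
    refine (specMap_fromSpec_comp_hom hW _).trans ?_
    change _ = Spec.map _
    congr 2
    exact ψ.comp_algebraMap)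

lemma specOverMap_specPoint (φ : B →ₐ[k] C) (ψ : Γ(A.left, W) →ₐ[k] B) :
    specOverMap φ ≫ specPoint hW ψ = specPoint hW (φ.comp ψ) := by
  apply Over.OverMorphism.ext
  change Spec.map _ ≫ Spec.map _ ≫ _ = Spec.map _ ≫ _
  rw [← Category.assoc, ← Spec.map_comp]
  rfl

lemma specPoint_injective : Function.Injective (specPoint (B := B) hW) := by
  intro ψ ψ' h
  have h1 := congrArg (fun g ↦ Over.Hom.left g) h
  change Spec.map _ ≫ _ = Spec.map _ ≫ _ at h1
  rw [cancel_mono] at h1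
  have h2 := Spec.map_injective h1
  ext r
  exact ConcreteCategory.congr_hom h2 r

lemma exists_specPoint_eq (g : specOver k B ⟶ A) (hg : ⊤ ≤ g.left ⁻¹ᵁ W) :
    ∃ ψ, specPoint hW ψ = g := by
  have h := eq_specMap_fromSpec (B := .of B) hW g.left hg
  have hw := Over.w g
  rw [h, specMap_fromSpec_comp_hom hW] at hw
  have hw' := Spec.map_injective hw
  refine ⟨{ (g.left.appLE W ⊤ hg ≫ (Scheme.ΓSpecIso (.of B)).hom).hom with
    commutes' := fun c ↦ ConcreteCategory.congr_hom hw' c }, ?_⟩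
  apply Over.OverMorphism.ext
  exact h.symm

/-- A point with values in a nilpotent thickening of `k` lies in any open set that contains its
reduction. -/
lemma top_le_preimage_of_nilpotent (π : B →ₐ[k] k) (hπ : ∀ b, π b = 0 → IsNilpotent b)
    (g : specOver k B ⟶ A) (hg : ⊤ ≤ (specOverMap π ≫ g).left ⁻¹ᵁ W) : ⊤ ≤ g.left ⁻¹ᵁ W := by
  intro x _
  have hx : x = (Spec.map (CommRingCat.ofHom π.toRingHom)) (IsLocalRing.closedPoint k) := by
    apply PrimeSpectrum.ext
    have h1 : RingHom.ker π ≤ x.asIdeal := fun b hb ↦ by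
      obtain ⟨n, hn⟩ := hπ b hb
      exact x.isPrime.mem_of_pow_mem n (hn ▸ zero_mem _)
    rw [← (isMaximal_ker π).eq_of_le x.isPrime.ne_top h1]
    ext b
    change _ ↔ π b ∈ IsLocalRing.maximalIdeal k
    rw [IsLocalRing.maximalIdeal_eq_bot]
    rfl
  rw [hx]
  exact hg (x := IsLocalRing.closedPoint k) trivial

lemma toBase_comp_ratPoint (P : RatPointIn A W) :
    toBase (specOver k B) ≫ P.1 = specPoint hW ((Algebra.ofId k B).comp (evalHom P)) := by
  apply Over.OverMorphism.ext
  change Spec.map (CommRingCat.ofHom (algebraMap k B)) ≫ P.1.left = Spec.map _ ≫ _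
  rw [eq_specMap_fromSpec hW P.1.left P.2, ← Category.assoc, ← Spec.map_comp]
  rfl

section Derivation

open TrivSqZeroExt

variable {R : Type u} [CommRing R] [Algebra k R]

/-- The homomorphism to a square-zero extension given by a point `χ` and a tangent vector at it. -/
def tangentHom (χ : R →ₐ[k] k) (δ : R →ₗ[k] k)
    (hδ : ∀ a b, δ (a * b) = χ a * δ b + χ b * δ a) {M : Type u} [AddCommGroup M] [Module k M]
    [Module kᵐᵒᵖ M] [IsCentralScalar k M] (m : M) : R →ₐ[k] TrivSqZeroExt k M where
  toFun r := inl (χ r) + inr (δ r • m)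
  map_one' := by
    have h : δ 1 = 0 := by simpa using hδ 1 1
    simp [h]
  map_mul' a b := by
    ext
    · simp
    · simp [hδ, add_smul, mul_smul]
  map_zero' := by simp
  map_add' a b := by
    ext
    · simp
    · simp [add_smul]
  commutes' c := by
    have h : δ 1 = 0 := by simpa using hδ 1 1
    have h' : δ (algebraMap k R c) = 0 := by
      rw [Algebra.algebraMap_eq_smul_one, map_smul, h, smul_zero]
    ext
    · simp [h', algebraMap_eq_inl']
    · simp [h', algebraMap_eq_inl']

variable {χ : R →ₐ[k] k} {δ : R →ₗ[k] k} {hδ : ∀ a b, δ (a * b) = χ a * δ b + χ b * δ a}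

@[simp] lemma fst_tangentHom {M : Type u} [AddCommGroup M] [Module k M]
    [Module kᵐᵒᵖ M] [IsCentralScalar k M] (m : M) (r : R) :
    (tangentHom χ δ hδ m r).fst = χ r := by
  simp [tangentHom]

@[simp] lemma snd_tangentHom {M : Type u} [AddCommGroup M] [Module k M]
    [Module kᵐᵒᵖ M] [IsCentralScalar k M] (m : M) (r : R) :
    (tangentHom χ δ hδ m r).snd = δ r • m := by
  simp [tangentHom]

lemma map_comp_tangentHom {M N : Type u} [AddCommGroup M] [Module k M]
    [Module kᵐᵒᵖ M] [IsCentralScalar k M] [AddCommGroup N] [Module k N]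
    [Module kᵐᵒᵖ N] [IsCentralScalar k N] (l : M →ₗ[k] N) (m : M) :
    (TrivSqZeroExt.map l).comp (tangentHom χ δ hδ m) = tangentHom χ δ hδ (l m) := by
  ext r
  · simp
  · simp

lemma tangentHom_zero {M : Type u} [AddCommGroup M] [Module k M]
    [Module kᵐᵒᵖ M] [IsCentralScalar k M] :
    tangentHom χ δ hδ (0 : M) = (Algebra.ofId k (TrivSqZeroExt k M)).comp χ := by
  ext r
  · simp [Algebra.ofId_apply, algebraMap_eq_inl']
  · simp [Algebra.ofId_apply, algebraMap_eq_inl']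

end Derivation

section Group

open TrivSqZeroExt

variable [EllipticCurve A] (P : RatPointIn A W) {δ : Γ(A.left, W) →ₗ[k] k}
  (hδ : ∀ a b, δ (a * b) = evalHom P a * δ b + evalHom P b * δ a)

lemma specPoint_tangentHom_zero (hP : P.1 = 1) {M : Type u} [AddCommGroup M] [Module k M]
    [Module kᵐᵒᵖ M] [IsCentralScalar k M] :
    specPoint hW (tangentHom (evalHom P) δ hδ (0 : M)) = 1 := by
  rw [tangentHom_zero, ← toBase_comp_ratPoint, hP, comp_one]

/-- The group law adds tangent vectors at the identity. The product `g` of the two universal vectors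
lives over the square-zero extension by `k × k`. Each coordinate projection turns one factor into
the identity, so `g` must be the vector `(1, 1)`; the general case is its image under `(s, t) ↦ s •
x + t • y`. -/
lemma specPoint_tangentHom_mul (hP : P.1 = 1) (x y : k) :
    specPoint hW (tangentHom (evalHom P) δ hδ x) * specPoint hW (tangentHom (evalHom P) δ hδ y) =
      specPoint hW (tangentHom (evalHom P) δ hδ (x + y)) := by
  let g := specPoint hW (tangentHom (evalHom P) δ hδ ((1, 0) : k × k)) *
    specPoint hW (tangentHom (evalHom P) δ hδ ((0, 1) : k × k))
  have hg {M : Type u} [AddCommGroup M] [Module k M] [Module kᵐᵒᵖ M] [IsCentralScalar k M]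
      (l : k × k →ₗ[k] M) : specOverMap (TrivSqZeroExt.map l) ≫ g =
        specPoint hW (tangentHom (evalHom P) δ hδ (l (1, 0))) *
          specPoint hW (tangentHom (evalHom P) δ hδ (l (0, 1))) := by
    rw [comp_mul, specOverMap_specPoint, specOverMap_specPoint, map_comp_tangentHom,
      map_comp_tangentHom]
  obtain ⟨ψ, hψ⟩ : ∃ ψ, specPoint hW ψ = g := by
    refine exists_specPoint_eq hW g (top_le_preimage_of_nilpotent (fstHom k k (k × k)) ?_ g ?_)
    · intro b hb
      rw [isNilpotent_iff_isNilpotent_fst]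
      exact ⟨1, by simpa using hb⟩
    · have h1 : specOverMap (fstHom k k (k × k)) ≫ g = 1 := by
        have h2 (m : k × k) : (fstHom k k (k × k)).comp (tangentHom (evalHom P) δ hδ m) =
            (Algebra.ofId k k).comp (evalHom P) := by
          ext r
          simp
        rw [comp_mul, specOverMap_specPoint, specOverMap_specPoint, h2, h2, ← toBase_comp_ratPoint,
          hP, comp_one, _root_.mul_one]
      rw [h1, ← comp_one (f := toBase (specOver k k)), ← hP, toBase_comp_ratPoint hW P]
      exact top_le_specMap_fromSpec hW _
  have hfst : (TrivSqZeroExt.map (LinearMap.fst k k k)).comp ψ =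
      tangentHom (evalHom P) δ hδ (1 : k) := by
    apply specPoint_injective hW
    rw [← specOverMap_specPoint, hψ, hg]
    simp only [LinearMap.fst_apply]
    rw [specPoint_tangentHom_zero hW P hδ hP, _root_.mul_one]
  have hsnd : (TrivSqZeroExt.map (LinearMap.snd k k k)).comp ψ =
      tangentHom (evalHom P) δ hδ (1 : k) := by
    apply specPoint_injective hW
    rw [← specOverMap_specPoint, hψ, hg]
    simp only [LinearMap.snd_apply]
    rw [specPoint_tangentHom_zero hW P hδ hP, _root_.one_mul]
  have hψ' : ψ = tangentHom (evalHom P) δ hδ ((1, 1) : k × k) := by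
    ext r
    · have := congrArg TrivSqZeroExt.fst (DFunLike.congr_fun hfst r)
      simpa using this
    · have := congrArg TrivSqZeroExt.snd (DFunLike.congr_fun hfst r)
      simpa using this
    · have := congrArg TrivSqZeroExt.snd (DFunLike.congr_fun hsnd r)
      simpa using this
  let l : k × k →ₗ[k] k := (LinearMap.fst k k k).smulRight x + (LinearMap.snd k k k).smulRight y
  have h := hg l
  rw [← hψ, hψ', specOverMap_specPoint, map_comp_tangentHom] at h
  simpa [l] using h.symm

end Group

variable (A) in
/-- On an elliptic curve multiplication by an integer that is invertible in `k` is not zero. -/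
theorem id_pow_ne_one [IsAlgClosed k] [EllipticCurve A] {l : ℕ} (hl : (l : k) ≠ 0) :
    (𝟙 A : A ⟶ A) ^ l ≠ 1 := by
  intro hpow
  obtain ⟨W, hW, hxW, ⟨e⟩⟩ := exists_affine_kaehlerDifferential (pt (1 : RatPoint A))
  let P : RatPointIn A W := ⟨1, top_le_preimage_iff.2 hxW⟩
  -- A tangent vector at the identity, read off from a trivialization of the differentials; it is
  -- nonzero because differentials of functions generate.
  let δ : Γ(A.left, W) →ₗ[k] k := (evalHom P).toLinearMap ∘ₗ
    (e.toLinearMap.restrictScalars k) ∘ₗ (KaehlerDifferential.D k Γ(A.left, W)).toLinearMap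
  have hδa (r) : δ r = evalHom P (e (KaehlerDifferential.D k Γ(A.left, W) r)) := rfl
  have hδ (a b) : δ (a * b) = evalHom P a * δ b + evalHom P b * δ a := by
    simp [hδa]
  obtain ⟨r, hr⟩ : ∃ r, δ r ≠ 0 := by
    by_contra! h
    have h1 (w : Ω[Γ(A.left, W)⁄k]) : evalHom P (e w) = 0 := by
      have hw : w ∈ Submodule.span Γ(A.left, W)
          (Set.range (KaehlerDifferential.D k Γ(A.left, W))) := by
        rw [KaehlerDifferential.span_range_derivation]
        exact Submodule.mem_top
      induction hw using Submodule.span_induction with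
      | mem x hx => obtain ⟨r, rfl⟩ := hx; exact h r
      | zero => simp
      | add x y _ _ hx hy => rw [map_add, map_add, hx, hy, add_zero]
      | smul a x _ hx => rw [map_smul, smul_eq_mul, map_mul, hx, mul_zero]
    simpa using h1 (e.symm 1)
  let β (x : k) := specPoint hW (tangentHom (evalHom P) δ hδ x)
  have hβ (n : ℕ) : β 1 ^ n = β n := by
    induction n with
    | zero =>
      rw [pow_zero, Nat.cast_zero]
      exact (specPoint_tangentHom_zero hW P hδ rfl).symm
    | succ n ih =>
      rw [pow_succ, ih, Nat.cast_succ]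
      exact specPoint_tangentHom_mul hW P hδ rfl _ _
  have h1 : β 1 ^ l = 1 := by
    rw [← Category.comp_id (β 1), ← comp_pow, hpow, comp_one]
  -- The `l`-th power of `β 1` is both `β l` and the identity, so `l * δ r = 0` for every `r`.
  have h2 : β l = β 0 := by
    rw [← hβ, h1]
    exact (specPoint_tangentHom_zero hW P hδ rfl).symm
  have h3 := DFunLike.congr_fun (specPoint_injective hW h2) r
  have h4 := congrArg TrivSqZeroExt.snd h3
  simp [hr, hl] at h4

end Tangent

end EllipticRelations

/-! ### Nonconstant morphisms and multiplication by integers -/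

namespace EllipticRelations

section Morphism

variable {k : Type u} [Field k] [IsAlgClosed k] {X Y : Over (Spec (.of k))}
  [IsSmoothProjectiveCurve X] [IsSmoothProjectiveCurve Y] {Φ : X ⟶ Y}

/-- Otherwise the generic point maps to a closed point, and so does each of its specializations,
that is, every point. A morphism from the integral curve is determined by its effect on points, so
`Φ` would be constant. -/
lemma map_genericPoint_of_not_isConstant (hΦ : ¬ IsConstant Φ) :
    Φ.left (genericPoint X.left) = genericPoint Y.left := by
  by_contra hne
  obtain ⟨Q, hQ⟩ := exists_pt_eq (isClosed_singleton_of_ne_genericPoint hne)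
  refine hΦ ⟨Q, Over.OverMorphism.ext ?_⟩
  have h1 : Φ.left ≫ Y.hom = X.hom := Over.w Φ
  have h2 : (toBase X ≫ Q).left ≫ Y.hom = X.hom := Over.w (toBase X ≫ Q)
  have : LocallyOfFiniteType (Φ.left ≫ Y.hom) := by rw [h1]; infer_instance
  refine ext_of_apply_eq Y.hom Set.univ isClosed_univ.isLocallyClosed dense_univ (fun x _ _ ↦ ?_)
    (h1.trans h2.symm)
  have h3 : Φ.left x = pt Q := by
    have hs : genericPoint X.left ⤳ x := (genericPoint_spec X.left).specializes trivial
    have hs' := hs.map Φ.left.continuous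
    rw [← hQ] at hs'
    exact (hs'.mem_closed (isClosed_pt Q) rfl)
  rw [h3]
  change pt Q = Q.left (X.hom x)
  rw [pt]
  congr 1
  exact Subsingleton.elim (α := PrimeSpectrum k) _ _

/-- Properness makes the image closed, and it contains the generic point. Each fibre over a closed
point is then closed and nonempty, so it contains a rational point. -/
lemma surjective_comp_of_not_isConstant (hΦ : ¬ IsConstant Φ) (Q : RatPoint Y) :
    ∃ P : RatPoint X, P ≫ Φ = Q := by
  have h1 : Φ.left ≫ Y.hom = X.hom := Over.w Φ
  have : IsProper (Φ.left ≫ Y.hom) := by rw [h1]; infer_instance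
  have : IsProper Φ.left := IsProper.of_comp Φ.left Y.hom
  have hcl : IsClosed (Set.range Φ.left) := Φ.left.isClosedMap.isClosed_range
  have hrange : Set.range Φ.left = Set.univ := by
    rw [← Set.univ_subset_iff, ← (genericPoint_spec Y.left).def]
    exact hcl.closure_subset_iff.2 (Set.singleton_subset_iff.2
      ⟨_, map_genericPoint_of_not_isConstant hΦ⟩)
  obtain ⟨x, hx⟩ : pt Q ∈ Set.range Φ.left := hrange ▸ Set.mem_univ _
  obtain ⟨y, hy, hyc⟩ := jacobsonSpace_iff_locallyClosed.1 (inferInstance : JacobsonSpace X.left)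
    (Φ.left ⁻¹' {pt Q}) ⟨x, hx⟩ ((isClosed_pt Q).preimage Φ.left.continuous).isLocallyClosed
  obtain ⟨P, rfl⟩ := exists_pt_eq hyc
  exact ⟨P, pt_injective hy⟩

lemma finite_fibre_of_not_isConstant (hΦ : ¬ IsConstant Φ) (Q : RatPoint Y) :
    {P : RatPoint X | P ≫ Φ = Q}.Finite := by
  have h := finite_of_isClosed ((isClosed_pt Q).preimage Φ.left.continuous) (fun h ↦ by
    have h1 : Φ.left (genericPoint X.left) = pt Q := h
    rw [map_genericPoint_of_not_isConstant hΦ] at h1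
    exact pt_ne_genericPoint Q h1.symm)
  refine (h.preimage pt_injective.injOn).subset ?_
  rintro P rfl
  rfl

end Morphism

section Multiplication

variable {k : Type u} [Field k] (A : Over (Spec (.of k))) [EllipticCurve A]

lemma not_isConstant_id_zpow {m : ℤ} (hm : ∃ x : RatPoint A, x ^ m ≠ 1) :
    ¬ IsConstant ((𝟙 A : A ⟶ A) ^ m) := by
  rintro ⟨Q, hQ⟩
  have h (x : RatPoint A) : x ^ m = Q := by
    have := congrArg (x ≫ ·) hQ
    simp only [GrpObj.comp_zpow, Category.comp_id] at this
    rw [this, ← Category.assoc, eq_toBase (x ≫ _), ← eq_toBase (𝟙 _), Category.id_comp]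
  obtain ⟨x, hx⟩ := hm
  exact hx (by rw [h, ← h 1, one_zpow])

lemma not_isConstant_id_zpow_of_ne_one {m : ℤ} (hm : (𝟙 A : A ⟶ A) ^ m ≠ 1) :
    ¬ IsConstant ((𝟙 A : A ⟶ A) ^ m) := by
  rintro ⟨Q, hQ⟩
  have h1 : (1 : RatPoint A) = Q := by
    have := congrArg ((1 : RatPoint A) ≫ ·) hQ
    simp only [GrpObj.comp_zpow, Category.comp_id, one_zpow] at this
    rw [this, ← Category.assoc, eq_toBase ((1 : RatPoint A) ≫ _), ← eq_toBase (𝟙 _),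
      Category.id_comp]
  apply hm
  rw [hQ, ← h1, comp_one]

variable [IsAlgClosed k]

lemma finite_torsion_prime (l : ℕ) (hl : l.Prime) :
    {x : Additive (RatPoint A) | l • x = 0}.Finite := by
  have : Infinite (Additive (RatPoint A)) := infinite_ratPoint (X := A)
  by_cases h : (l : k) = 0
  · have : Fact l.Prime := ⟨hl⟩
    have : CharP k l := (CharP.charP_iff_prime_eq_zero hl).2 h
    obtain ⟨W⟩ := nonempty_chart A
    exact W.finite_torsion l
  · have h1 : ¬ IsConstant ((𝟙 A : A ⟶ A) ^ (l : ℤ)) := not_isConstant_id_zpow_of_ne_one A (by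
      rw [zpow_natCast]
      exact id_pow_ne_one A h)
    refine ((finite_fibre_of_not_isConstant h1 1).preimage Additive.toMul.injective.injOn).subset ?_
    intro x hx
    change x.toMul ≫ _ = 1
    rw [GrpObj.comp_zpow, Category.comp_id, zpow_natCast]
    exact hx

lemma finite_torsion_nat {n : ℕ} (hn : n ≠ 0) :
    {x : Additive (RatPoint A) | n • x = 0}.Finite := by
  induction n using Nat.recOnMul with
  | zero => exact absurd rfl hn
  | one => simp
  | prime l hl => exact finite_torsion_prime A l hl
  | mul a b ha hb =>
    have ha' := ha (left_ne_zero_of_mul hn)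
    have hb' := hb (right_ne_zero_of_mul hn)
    -- The `a * b`-torsion is the preimage of the `a`-torsion under multiplication by `b`, whose
    -- nonempty fibres are cosets of the `b`-torsion.
    refine (ha'.preimage' (f := fun x ↦ b • x) fun y _ ↦ ?_).subset fun x hx ↦ ?_
    · rcases Set.eq_empty_or_nonempty ((fun x ↦ b • x) ⁻¹' {y}) with h | ⟨x₀, hx₀⟩
      · rw [h]; exact Set.finite_empty
      · refine (hb'.image (x₀ + ·)).subset fun x hx ↦ ⟨x - x₀, ?_, by simp⟩
        have h1 : b • x = y := hx
        have h2 : b • x₀ = y := hx₀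
        change b • (x - x₀) = 0
        rw [smul_sub, h1, h2, sub_self]
    · change a • b • x = 0
      rw [← mul_smul]
      exact hx

lemma finite_torsion_int {m : ℤ} (hm : m ≠ 0) :
    {x : Additive (RatPoint A) | m • x = 0}.Finite := by
  refine (finite_torsion_nat A (Int.natAbs_ne_zero.2 hm)).subset fun x hx ↦ ?_
  have hx' : m • x = 0 := hx
  change m.natAbs • x = 0
  rw [← natCast_zsmul, Int.natCast_natAbs]
  rcases abs_choice m with h | h
  · rw [h, hx']
  · rw [h, neg_smul, hx', neg_zero]

/-- Surjectivity follows from finite torsion: since `A(k)` is infinite, multiplication by `m` is not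
trivial on it, hence not constant, hence onto. -/
theorem isogenyMul : IsogenyMul (Additive (RatPoint A)) where
  finite_ker hm := finite_torsion_int A hm
  surjective {m} hm := by
    have hinf : Infinite (Additive (RatPoint A)) := infinite_ratPoint (X := A)
    obtain ⟨x, hx⟩ := (finite_torsion_int A hm).infinite_compl.nonempty
    have h1 := not_isConstant_id_zpow A (m := m) ⟨x.toMul, hx⟩
    intro y
    obtain ⟨P, hP⟩ := surjective_comp_of_not_isConstant h1 y.toMul
    rw [GrpObj.comp_zpow, Category.comp_id] at hP
    exact ⟨Additive.ofMul P, hP⟩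

end Multiplication

end EllipticRelations

/-! ### Values over the elliptic curve, and the conclusion -/

namespace EllipticRelations

section Main

open Polynomial

lemma eq_X_sub_C_pow_of_forall_isRoot {k : Type*} [Field k] [IsAlgClosed k] {q : k[X]}
    (hq : q.Monic) {z : k} (h : ∀ c, q.IsRoot c → c = z) : q = (X - C z) ^ q.natDegree := by
  have hs := IsAlgClosed.splits q
  have hr : q.roots = Multiset.replicate q.natDegree z := by
    rw [Multiset.eq_replicate]
    exact ⟨hs.natDegree_eq_card_roots.symm, fun c hc ↦ h c (isRoot_of_mem_roots hc)⟩
  nth_rewrite 1 [hs.eq_prod_roots_of_monic hq, hr]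
  simp

variable {k : Type u} [Field k] [IsAlgClosed k]

/-- Inside every nonempty open subset of a curve there is a nonempty affine open subset with
Dedekind coordinate ring. -/
lemma exists_isCurveChart_le {X : Over (Spec (.of k))} [IsSmoothProjectiveCurve X]
    {U : X.left.Opens} (hU : Nonempty U) : ∃ V ≤ U, IsAffineOpen V ∧ Nonempty V ∧
      IsDedekindDomain Γ(X.left, V) := by
  obtain ⟨V, hηV, hV⟩ := exists_isCurveChart (genericPoint X.left)
  have := hV.dedekind
  obtain ⟨b, hbU, hb⟩ := hV.isAffineOpen.exists_basicOpen_le ⟨_, genericPoint_mem hU⟩ hηV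
  have hloc := hV.isAffineOpen.isLocalization_basicOpen b
  have hne : Nonempty (X.left.basicOpen b) := ⟨⟨_, hb⟩⟩
  have hb0 : b ≠ 0 := by
    rintro rfl
    rw [Scheme.basicOpen_zero] at hb
    exact hb
  exact ⟨_, hbU, hV.isAffineOpen.basicOpen b, hne, IsLocalization.isDedekindDomain Γ(X.left, V)
    (powers_le_nonZeroDivisors_of_noZeroDivisors hb0) _⟩

variable {X A : Over (Spec (.of k))} [IsSmoothProjectiveCurve X] [EllipticCurve A]

/-- The values of a regular function over the points of `A`, for a nonconstant morphism to `A`: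
up to finitely many points they are the roots of a polynomial over the function field. -/
lemma exists_values {Φ : X ⟶ A} (hΦ : ¬ IsConstant Φ) {U : X.left.Opens} (hU : Nonempty U)
    (φ : Γ(X.left, U)) :
    ∃ (T : Set (Additive (RatPoint A))) (N : ℕ) (M : k → A.left.functionField),
      T.Finite ∧ N ≠ 0 ∧
      (∀ x ∉ T, ∃ P : RatPointIn X U, Additive.ofMul (P.1 ≫ Φ) = x) ∧
      ∀ x ∉ T, ∀ c, (∀ P : RatPointIn X U, Additive.ofMul (P.1 ≫ Φ) = x → value φ P = c) →
        ∀ s, (ellipticFunctionField A).v x (M s) ((s - c) ^ N) := by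
  have hη := map_genericPoint_of_not_isConstant hΦ
  obtain ⟨W, hηW, hW⟩ := exists_isCurveChart (genericPoint A.left)
  have hWne := hW.nonempty
  have hWd := hW.dedekind
  have hηV : genericPoint X.left ∈ U ⊓ Φ.left ⁻¹ᵁ W := by
    refine ⟨genericPoint_mem hU, ?_⟩
    change Φ.left _ ∈ W
    rwa [hη]
  obtain ⟨V, hVU, hV, hVne, hVd⟩ := exists_isCurveChart_le ⟨⟨_, hηV⟩⟩
  have i : V ≤ Φ.left ⁻¹ᵁ W := hVU.trans inf_le_right
  have i' : V ≤ U := hVU.trans inf_le_left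
  let R := Γ(A.left, W)
  let S := Γ(X.left, V)
  have hfr := functionField_isFractionRing_of_isAffineOpen A.left W hW.isAffineOpen
  have hft : Algebra.FiniteType k S := finiteType_sections hV
  let _ : Algebra R S := (pullHom Φ i).toAlgebra
  have htower : IsScalarTower k R S := .of_algebraMap_eq fun c ↦ ((pullHom Φ i).commutes c).symm
  have hinj : Function.Injective (algebraMap R S) := by
    rw [injective_iff_map_eq_zero]
    intro r hr
    by_contra hr0
    have h1 : genericPoint X.left ∈ X.left.basicOpen (algebraMap R S r) := by
      refine (Scheme.basicOpen_appLE Φ.left V W i r).ge ⟨genericPoint_mem hVne, ?_⟩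
      change Φ.left _ ∈ A.left.basicOpen r
      rw [hη]
      exact genericPoint_mem (nonempty_basicOpen hr0)
    rw [hr, Scheme.basicOpen_zero] at h1
    exact h1
  have hfaith : FaithfulSMul R S := (faithfulSMul_iff_algebraMap_injective R S).2 hinj
  have halg : Algebra.IsAlgebraic R S := isAlgebraic_of_dimensionLEOne (k := k) hW.not_isField
  obtain ⟨y, hy0, m, hm, hdeg, hroot⟩ :=
    exists_polynomial_of_isAlgebraic (k := k) (R := R) (S := S) (resHom i' φ)
  have hlift (Q : RatPointIn A W) (hQ : value y Q ≠ 0) (c : k)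
      (hc : (m.map (evalHom Q).toRingHom).IsRoot (value y Q * c)) :
      ∃ P : RatPointIn X U, P.1 ≫ Φ = Q.1 ∧ value φ P = c := by
    obtain ⟨χ', h1, h2⟩ := hroot (evalHom Q) hQ c hc
    let P := pointOfHom hV χ'
    have hPW : ⊤ ≤ (P.1 ≫ Φ).left ⁻¹ᵁ W := P.2.trans (Scheme.Hom.preimage_mono _ i)
    have hev : evalHom P = χ' := evalHom_pointOfHom hV χ'
    refine ⟨⟨P.1, P.2.trans (Scheme.Hom.preimage_mono _ i')⟩, ?_, ?_⟩
    · refine congrArg Subtype.val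
        (ratPoint_ext_of_evalHom hW.isAffineOpen (P := ⟨P.1 ≫ Φ, hPW⟩) (Q := Q) ?_)
      ext r
      rw [evalHom_apply, ← value_pull Φ i r P hPW, ← evalHom_apply, hev]
      exact h1 r
    · rw [← value_res i' φ P, ← evalHom_apply, hev, h2]
  let K := A.left.functionField
  -- If `c` is the only value over `x`, then `m` specializes at `x` to `(X - y c) ^ N`. Thus `m(y s)
  -- / y ^ N` has value `(s - c) ^ N` at `x`, whether or not the extension is separable.
  let r (s : k) : R := m.eval (y * algebraMap k R s)
  refine ⟨{x | pt x.toMul ∉ A.left.basicOpen y}, m.natDegree,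
    fun s ↦ algebraMap R K (r s) * (algebraMap R K y)⁻¹ ^ m.natDegree,
    (finite_ratPoint_notMem (nonempty_basicOpen hy0)).preimage Additive.toMul.injective.injOn,
    hdeg, ?_, ?_⟩
  · intro x hx
    rw [Set.mem_ofPred_eq, not_not] at hx
    let Q : RatPointIn A W := ⟨x.toMul, top_le_preimage_iff.2 (A.left.basicOpen_le y hx)⟩
    have hQ : value y Q ≠ 0 := (value_ne_zero_iff y Q).2 hx
    obtain ⟨z, hz⟩ := IsAlgClosed.exists_root (m.map (evalHom Q).toRingHom) (by
      rw [hm.degree_map]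
      intro h0
      exact hdeg (natDegree_eq_of_degree_eq_some h0))
    obtain ⟨P, hP, -⟩ := hlift Q hQ (z / value y Q) (by rwa [mul_div_cancel₀ _ hQ])
    exact ⟨P, congrArg Additive.ofMul hP⟩
  · intro x hx c hc s
    rw [Set.mem_ofPred_eq, not_not] at hx
    let Q : RatPointIn A W := ⟨x.toMul, top_le_preimage_iff.2 (A.left.basicOpen_le y hx)⟩
    have hQ : value y Q ≠ 0 := (value_ne_zero_iff y Q).2 hx
    have hmap := eq_X_sub_C_pow_of_forall_isRoot (hm.map (evalHom Q).toRingHom)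
      (z := value y Q * c) (fun z hz ↦ by
        obtain ⟨P, hP, hPz⟩ := hlift Q hQ (z / value y Q) (by rwa [mul_div_cancel₀ _ hQ])
        rw [← hc P (congrArg Additive.ofMul hP), hPz, mul_div_cancel₀ _ hQ])
    rw [hm.natDegree_map] at hmap
    have hr : evalHom Q (r s) = (value y Q * s - value y Q * c) ^ m.natDegree := by
      have h1 : evalHom Q (r s) =
          (m.map (evalHom Q).toRingHom).eval (evalHom Q (y * algebraMap k R s)) := by
        rw [Polynomial.eval_map]
        exact hom_eval₂ _ _ _ _
      rw [h1, hmap, map_mul, AlgHom.commutes]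
      simp [evalHom_apply]
    refine (ellipticFunctionField_v_iff A hW.isAffineOpen Q).2 ?_
    have h2 := (LocalVal.of (K := K) (χ := evalHom Q) (r s)).mul
      (((LocalVal.of (K := K) (χ := evalHom Q) y).inv hQ).pow m.natDegree)
    convert h2 using 1
    rw [hr, evalHom_apply, ← mul_pow]
    congr 1
    field_simp

/-- A regular function whose values are determined by a constant over almost all points of `A`
is constant. -/
lemma eq_constFun_of_values {Φ : X ⟶ A} (hΦ : ¬ IsConstant Φ) {U : X.left.Opens}
    (hU : Nonempty U) {φ : Γ(X.left, U)} {T : Set (Additive (RatPoint A))} (hT : T.Finite) {c : k}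
    (h : ∀ P : RatPointIn X U, Additive.ofMul (P.1 ≫ Φ) ∉ T → value φ P = c) :
    φ = constFun U c := by
  have hη := map_genericPoint_of_not_isConstant hΦ
  let Z : Set A.left := ⋃ x ∈ T, {pt x.toMul}
  have hZ : IsClosed Z := hT.isClosed_biUnion fun x _ ↦ isClosed_pt _
  let W : A.left.Opens := ⟨Zᶜ, hZ.isOpen_compl⟩
  have hmem : genericPoint X.left ∈ U ⊓ Φ.left ⁻¹ᵁ W := by
    refine ⟨genericPoint_mem hU, ?_⟩
    change Φ.left _ ∉ Z
    rw [hη]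
    intro hz
    obtain ⟨x, -, hx⟩ := Set.mem_iUnion₂.1 hz
    exact pt_ne_genericPoint x.toMul (Set.mem_singleton_iff.1 hx).symm
  have i : U ⊓ Φ.left ⁻¹ᵁ W ≤ U := inf_le_left
  -- Over the complement of the finite set `T` all values are `c`; that open set contains the
  -- generic point, so restriction to it is injective.
  have h0 : resHom i (φ - constFun U c) = 0 := by
    refine eq_zero_of_value_eq_zero _ fun P ↦ ?_
    rw [value_res, ← evalHom_apply, map_sub, sub_eq_zero, ← algebraMap_sections, AlgHom.commutes]
    refine h _ fun hx ↦ ?_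
    have h1 : Φ.left (pt P.1) ∉ Z := (top_le_preimage_iff.1 P.2).2
    exact h1 (Set.mem_iUnion₂.2 ⟨_, hx, rfl⟩)
  have h1 := congrArg (genGerm hmem) h0
  rw [genGerm_res, map_zero, ← map_zero (genGerm (i hmem))] at h1
  exact sub_eq_zero.1 (genGerm_injective _ h1)

end Main

end EllipticRelations

open EllipticRelations in
theorem mainTheorem9 {k : Type u} [Field k] [IsAlgClosed k] (p : ℕ) [CharP k p]
    (X A : Over (Spec (.of k))) [IsSmoothProjectiveCurve X] [EllipticCurve A]
    (Φ : X ⟶ A) (hΦ : ¬ IsConstant Φ)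
    (n : ℕ) (hn : 3 ≤ n) (a : Fin n → ℤ) (ha : ∀ i, a i ≠ 0) (hap : ¬ ∀ i, (p : ℤ) ∣ a i)
    (U : X.left.Opens) (hU : IsAffineOpen U) (φ : Γ(X.left, U))
    (hφ : ∀ P : Fin n → RatPointIn X U,
      ∑ i, a i • Additive.ofMul ((P i).1 ≫ Φ) = 0 → ∑ i, (a i : k) * value φ (P i) = 0) :
    (∃ c : k, φ = constFun U c) ∧ (¬ (p : ℤ) ∣ ∑ i, a i → φ = 0) := by
  have hzero : constFun U 0 = (0 : Γ(X.left, U)) := map_zero (algebraMap k Γ(X.left, U))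
  -- For empty `U` there are no points and `φ` is zero.
  by_cases hne : Nonempty U
  · push Not at hap
    obtain ⟨i₁, hi₁⟩ := hap
    have hi₁' : (a i₁ : k) ≠ 0 := by rwa [Ne, CharP.intCast_eq_zero_iff k p]
    obtain ⟨T, N, M, hT, hN, hL, hM⟩ := exists_values hΦ hne φ
    have hinf : Infinite (Additive (RatPoint A)) := infinite_ratPoint (X := A)
    have hzeros (f : A.left.functionField) (hf : f ≠ 0) :
        {x | (ellipticFunctionField A).v x f 0}.Finite :=
      Set.Finite.preimage (f := Additive.toMul) Additive.toMul.injective.injOn (finite_zeros hf)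
    obtain ⟨c, hc, hc0⟩ := (ellipticFunctionField A).exists_const_of_relation (isogenyMul A)
      hzeros hT
      -- A relation rather than a function, because several points of `U` may lie over `x`; that
      -- their values agree is part of what is proved.
      (L := fun x d ↦ ∃ P : RatPointIn X U, Additive.ofMul (P.1 ≫ Φ) = x ∧ value φ P = d)
      (fun x hx ↦ by
        obtain ⟨P, hP⟩ := hL x hx
        exact ⟨_, P, hP, rfl⟩) hN (M := M)
      (fun x hx c hc s ↦ hM x hx c (fun P hP ↦ hc _ ⟨P, hP, rfl⟩) s) hn ha hi₁'
      (fun x c hx hsum ↦ by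
        choose P hP hPc using hx
        simp only [← hP] at hsum
        simpa only [hPc] using hφ P hsum)
    have hconst : φ = constFun U c :=
      eq_constFun_of_values hΦ hne hT fun P hP ↦ hc _ hP _ ⟨P, rfl, rfl⟩
    refine ⟨⟨c, hconst⟩, fun hsum ↦ ?_⟩
    rw [hconst, hc0 ?_, hzero]
    rwa [← Int.cast_sum, Ne, CharP.intCast_eq_zero_iff k p]
  · have hφ0 : φ = 0 := eq_zero_of_value_eq_zero φ fun P ↦
      absurd ⟨⟨pt P.1, top_le_preimage_iff.1 P.2⟩⟩ hne
    exact ⟨⟨0, by rw [hφ0, hzero]⟩, fun _ ↦ hφ0⟩
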